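/- **Conventions.** Chain complexes are $\mathbb Z$-graded complexes of abelian groups with differential of degree $-1$; tensor products are over $\mathbb Z$ with the Koszul sign rule; $\mathrm{Ch}$ is the dg-category of chain complexes. A *PROP* $\mathcal E$ is a strict symmetric monoidal dg-category whose monoid of objects is $(\mathbb N,+)$. A dg-functor $\Phi:\mathcal E\to\mathrm{Ch}$ is written as a right action $\Phi(a)\otimes\mathcal E(a,b)\to\Phi(b)$, $x\otimes f\mapsto x\cdot f$, and composition in diagrammatic order ($f\cdot g$ is $f$ followed by $g$). An *$A_\infty$-multiplication* $i$ on $\mathcal E$ is a symmetric monoidal dg-functor, identity on objects, from the PROP of planar forests to $\mathcal E$; equivalently, a family $m_k\in\mathcal E(k,1)$, $k\ge 2$, of degree $k-2$, with $$d\,m_k=\sum_{\substack{a+b+c=k\\ b\ge2,\ a+c\ge1}}(-1)^{(a+1)(b+1)}\,(\mathrm{id}_a\otimes m_b\otimes \mathrm{id}_c)\cdot m_{a+1+c}.$$ It is *unital* if moreover a cycle $u\in\mathcal E(0,1)$ of degree $0$ is given with $(u\otimes \mathrm{id}_1)\cdot m_2=\mathrm{id}_1=(\mathrm{id}_1\otimes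 u)\cdot m_2$ and $(\mathrm{id}_a\otimes u\otimes\mathrm{id}_c)\cdot m_{a+1+c}=0$ for $a+1+c\ge3$. A (lax) *monoidal functor* $\Phi:\mathcal E\to\mathrm{Ch}$ is a dg-functor with natural, associative and unital chain maps $\mathbb Z\to\Phi(0)$ and $\Phi(a)\otimes\Phi(b)\to\Phi(a+b)$. It is *split* if these maps are isomorphisms, and *h-split* if they are quasi-isomorphisms. **Hochschild complex.** For $1\le K<N$ and $r=N+1-K$ let $f_{N,K}\in\mathcal E(N,K)$ be $$f_{N,K}=\sum_{a=0}^{K-1}(-1)^{(a+1)(r+1)}\,\mathrm{id}_a\otimes m_r\otimes\mathrm{id}_{K-1-a}\;+\;\sum_{t=1}^{r-1}(-1)^{r+1+t(N-t)}\;s_{N-t,t}\cdot(m_r\otimes \mathrm{id}_{K-1}),$$ where $s_{N-t,t}$ is the symmetry exchanging the first $N-t$ with the last $t$ inputs. For a dg-functor $\Phi$ put $$C(\Phi)(m)=\bigoplus_{n\ge0}\Phi(n+1+m)\otimes L_{n+1},\qquad L_{n+1}=\mathbb Z\,l_{n+1},\ |l_{n+1}|=n,$$ $$d(x\otimes l_{n+1})=dx\otimes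 l_{n+1}+(-1)^{|x|}\sum_{k=0}^{n-1}x\cdot(f_{n+1,k+1}\otimes \mathrm{id}_m)\otimes l_{k+1},$$ with action $(x\otimes l_{n+1})\cdot f=(-1)^{n|f|}\,x\cdot(\mathrm{id}_{n+1}\otimes f)\otimes l_{n+1}$ of $f\in\mathcal E(m,m')$. If $i$ is unital, the *reduced* complex $\overline C(\Phi)(m)$ is the quotient of $C(\Phi)(m)$ by $\bigoplus_n U_{n+1}\otimes L_{n+1}$, where $U_{n+1}\subseteq\Phi(n+1+m)$ is spanned by the images of the maps $\Phi(n+m)\to\Phi(n+1+m)$ that insert $u$ in one of the positions $2,\dots,n+1$. The operator $C$ is iterated: $C^0(\Phi)=\Phi$, $C^{n+1}(\Phi)=C(C^n(\Phi))$. A product $F(a)\otimes G(b)\to K(a+b)$, natural in the two variables, induces a product $$C^n(F)(a)\otimes C^{n'}(G)(b)\to C^{n+n'}(K)(a+b),\qquad (x\otimes l)\otimes(y\otimes l')\mapsto(-1)^{|l||y|}\,(xy)\cdot\pi\otimes l\otimes l',$$ with $\pi$ the block permutation that moves the inputs belonging to $l'$ in front of the $a$ remaining inputs of $x$. For a monoidal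 functor $\Phi$, the products of $\Phi$ thus give products $C^n(\Phi)(m)\otimes C^{n'}(\Phi)(m')\to C^{n+n'}(\Phi)(m+m')$, and by iteration a map $$\lambda:\;C(\Phi)(0)^{\otimes n}\otimes\Phi(1)^{\otimes m}\longrightarrow C^n(\Phi)(m).$$ **Extensions.** The *Hochschild core category* $C\mathcal E$ is the monoidal dg-category with objects $(m,n)\in\mathbb N\times\mathbb N$ and morphisms $C\mathcal E((m_1,n_1),(m_2,n_2))=C^{n_2}(\mathcal E(m_1,-))(m_2)$ if $n_1=0$, and $0$ if $n_1\ne0$ (apart from identities); the compositions are those induced by precomposition in $\mathcal E$, and the monoidal structure is the product above induced by $\otimes:\mathcal E(a,-)\otimes\mathcal E(a',-)\to\mathcal E(a+a',-)$. An *extension* of $C\mathcal E$ is a strict monoidal dg-category $\widetilde{\mathcal E}$ with objects $\mathbb N\times\mathbb N$ with a monoidal inclusion $C\mathcal E\hookrightarrow\widetilde{\mathcal E}$ that is an isomorphism on the morphism complexes with source $(a,0)$, for every $a$. A symmetric monoidal extension is one with a symmetry restricting to that of $\mathcal E$ on the objects $(a,0)$. Extensions of $\overline C\mathcal E$ are defined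 likewise, with $\overline C$ for $C$. **Modules.** Let $\mathcal D$ be a monoidal dg-category with objects $\mathbb N\times\mathbb N$ and let $V,W$ be chain complexes. Consider a family of maps $$(V^{\otimes n_1}\otimes W^{\otimes m_1})\otimes\mathcal D((m_1,n_1),(m_2,n_2))\to V^{\otimes n_2}\otimes W^{\otimes m_2}.\qquad(*)$$ It makes $(V,W)$ a *$\mathcal D$-module* if it is a dg-functor $\Psi:\mathcal D\to\mathrm{Ch}$, $\Psi(m,n)=V^{\otimes n}\otimes W^{\otimes m}$, which has a split monoidal structure through which $\Psi(m,n)$ is the tensor product of $n$ copies of $\Psi(0,1)=V$ and $m$ copies of $\Psi(1,0)=W$. It makes $(V,W)$ a *homotopy $\mathcal D$-module* if the maps $(*)$ are chain maps and are compatible with identities, with composition and with such a monoidal structure up to chain homotopy. If $\mathcal D$ is symmetric, a module is *$\Sigma$-equivariant* if $\Psi$, with the reordering isomorphisms as monoidal structure, is symmetric monoidal; a homotopy module is *$\Sigma$-equivariant* if the maps $(*)$ commute strictly with the reordering isomorphisms and $\otimes$, and with the permutations of blocks of factors and the corresponding symmetries of $\mathcal D$, in source and target. **Theorem.** Let $(\mathcal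 E,i)$ be a PROP with $A_\infty$-multiplication, let $\widetilde{\mathcal E}$ be an extension of $C\mathcal E$, and let $\Phi:\mathcal E\to\mathrm{Ch}$ be a monoidal functor. The $C^n(\Phi)$ are dg-functors $\mathcal E\to\mathrm{Ch}$. There is a diagram of chain maps $$\bigl(C(\Phi)(0)^{\otimes n_1}\otimes\Phi(1)^{\otimes m_1}\bigr)\otimes\widetilde{\mathcal E}\bigl((m_1,n_1),(m_2,n_2)\bigr)\xrightarrow{\ \gamma\ }C^{n_2}(\Phi)(m_2)\xleftarrow{\ \lambda\ }C(\Phi)(0)^{\otimes n_2}\otimes\Phi(1)^{\otimes m_2},$$ natural in $\Phi$ with respect to monoidal natural transformations, where $\gamma$ is the explicit map $z\otimes f\mapsto\lambda(z)\cdot f$ with $$(x\otimes l)\cdot f=x\cdot\bigl((\mathrm{id}_a\otimes l)\cdot f\bigr)\qquad\bigl(x\in\Phi(a),\ l=l_{k_1}\otimes\dots\otimes l_{k_{n_1}},\ a=k_1+\dots+k_{n_1}+m_1\bigr).$$ Here $\mathrm{id}_a\otimes l\in C^{n_1}(\mathcal E(a,-))(m_1)=\widetilde{\mathcal E}((a,0),(m_1,n_1))$,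 so that $(\mathrm{id}_a\otimes l)\cdot f$ lies in $\widetilde{\mathcal E}((a,0),(m_2,n_2))=C^{n_2}(\mathcal E(a,-))(m_2)$, and the outer dot is the map $\Phi(a)\otimes C^{n_2}(\mathcal E(a,-))(m_2)\to C^{n_2}(\Phi)(m_2)$ induced by the action of $\mathcal E$ on $\Phi$. Moreover: 1. If $\Phi$ is split, then all the maps $\lambda$ are isomorphisms, and $\lambda^{-1}\circ\gamma$ makes $(C(\Phi)(0),\Phi(1))$ an $\widetilde{\mathcal E}$-module. If in addition $\Phi$ is symmetric monoidal and $\widetilde{\mathcal E}$ is a symmetric monoidal extension, this module is $\Sigma$-equivariant. 2. If $\Phi$ is h-split then, for any choice of chain maps $\lambda^{-1}$ that are inverse to the maps $\lambda$ up to chain homotopy, $\lambda^{-1}\circ\gamma$ makes $(C(\Phi)(0),\Phi(1))$ a homotopy $\widetilde{\mathcal E}$-module. If in addition $\Phi$ and $\lambda^{-1}$ are symmetric monoidal (so $\lambda^{-1}$ commutes strictly with units, products and permutations of blocks) and $\widetilde{\mathcal E}$ is a symmetric monoidal extension, this homotopy module is $\Sigma$-equivariant. 3. If $(\mathcal E,i)$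 is a PROP with unital $A_\infty$-multiplication and $\widetilde{\mathcal E}$ is an extension of $\overline C\mathcal E$, all of this holds with $\overline C$ in place of $C$ throughout. -/

import Mathlib

open scoped TensorProduct DirectSum

universe u v w

namespace HochschildAction

/-! ### Chain complexes of abelian groups

A complex is written through its total group `⨁ᵢ Mᵢ`, together with the subgroups of homogeneous
elements and the differential.  `PreComplex` is the bare data; `PreComplex.IsComplex` says that the
data form a chain complex. -/

/-- The sign `(-1) ^ i`. -/
def sgn (i : ℤ) : ℤ := ((Int.negOnePow i : ℤˣ) : ℤ)

/-- The additive map in two variables with values `f x y`. -/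
def biadd {M N P : Type*} [AddCommGroup M] [AddCommGroup N] [AddCommGroup P] (f : M → N → P)
    (h₁ : ∀ x x' y, f (x + x') y = f x y + f x' y)
    (h₂ : ∀ x y y', f x (y + y') = f x y + f x y') : M →+ N →+ P :=
  AddMonoidHom.mk' (fun x => AddMonoidHom.mk' (f x) (h₂ x))
    (fun x x' => AddMonoidHom.ext (h₁ x x'))

/-- The additive map on `M ⊗ N` that corresponds to a biadditive map. -/
noncomputable def tlift {M N P : Type*} [AddCommGroup M] [AddCommGroup N] [AddCommGroup P]
    (f : M →+ N →+ P) : M ⊗[ℤ] N →+ P :=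
  TensorProduct.liftAddHom f (fun r m n => by simp)

/-- A group, its subgroups of homogeneous elements, and an endomorphism. -/
structure PreComplex where
  carrier : Type u
  [grp : AddCommGroup carrier]
  /-- the homogeneous elements of degree `i` -/
  deg : ℤ → AddSubgroup carrier
  /-- the differential -/
  d : carrier →+ carrier

attribute [instance] PreComplex.grp

instance : CoeSort PreComplex.{u} (Type u) := ⟨PreComplex.carrier⟩

/-- `M` is a chain complex: the direct sum of its homogeneous parts, with a differential of
degree `-1` and square zero. -/
structure PreComplex.IsComplex (M : PreComplex.{u}) : Prop where
  internal : DirectSum.IsInternal M.deg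
  d_deg : ∀ (i : ℤ) (x : M), x ∈ M.deg i → M.d x ∈ M.deg (i - 1)
  d_d : ∀ x : M, M.d (M.d x) = 0

open Classical in
/-- On a graded group, the additive map that multiplies each homogeneous `x` by `c |x|`. -/
noncomputable def PreComplex.scale (M : PreComplex.{u}) (c : ℤ → ℤ) : M →+ M :=
  if h : ∃ e : M →+ M, ∀ (i : ℤ) (x : M), x ∈ M.deg i → e x = c i • x then h.choose else 0

/-- `x ↦ (-1) ^ (n |x|) x`, the sign for moving `x` past something of degree `n`. -/
noncomputable def PreComplex.koszul (M : PreComplex.{u}) (n : ℤ) : M →+ M :=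
  M.scale (fun i => sgn (n * i))

/-- The tensor product, with `d (x ⊗ y) = d x ⊗ y + (-1) ^ |x| x ⊗ d y`. -/
noncomputable def tensor (M : PreComplex.{u}) (N : PreComplex.{v}) : PreComplex.{max u v} where
  carrier := M ⊗[ℤ] N
  deg n := AddSubgroup.closure
    {z | ∃ (i j : ℤ) (x : M) (y : N), x ∈ M.deg i ∧ y ∈ N.deg j ∧ i + j = n ∧ z = x ⊗ₜ[ℤ] y}
  d := tlift (biadd (fun x y => M.d x ⊗ₜ[ℤ] y + M.koszul 1 x ⊗ₜ[ℤ] N.d y)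
    (fun x x' y => by simp only [map_add, TensorProduct.add_tmul]; abel)
    (fun x y y' => by simp only [map_add, TensorProduct.tmul_add]; abel))

/-- The elementary tensor `x ⊗ y`, as an element of the complex `M ⊗ N`. -/
noncomputable def tmk {M : PreComplex.{u}} {N : PreComplex.{v}} (x : M) (y : N) : tensor M N :=
  (x ⊗ₜ[ℤ] y : M ⊗[ℤ] N)

/-- The map `M ⊗ N → P` of a biadditive map. -/
noncomputable def onTensor {M : PreComplex.{u}} {N : PreComplex.{v}} {P : Type w} [AddCommGroup P]
    (f : M →+ N →+ P) : tensor M N →+ P :=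
  (tlift f : M ⊗[ℤ] N →+ P)

theorem tmk_add_left {M : PreComplex.{u}} {N : PreComplex.{v}} (x x' : M) (y : N) :
    tmk (x + x') y = tmk x y + tmk x' y := TensorProduct.add_tmul x x' y

theorem tmk_add_right {M : PreComplex.{u}} {N : PreComplex.{v}} (x : M) (y y' : N) :
    tmk x (y + y') = tmk x y + tmk x y' := TensorProduct.tmul_add x y y'

/-- The unit complex: `ℤ` in degree `0`. -/
def unitComplex : PreComplex.{v} where
  carrier := ULift.{v} ℤ
  deg i := if i = 0 then ⊤ else ⊥
  d := 0

/-- Chain maps (of degree `0`). -/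
structure IsChainMap {M : PreComplex.{u}} {N : PreComplex.{v}} (f : M →+ N) : Prop where
  map_deg : ∀ (i : ℤ) (x : M), x ∈ M.deg i → f x ∈ N.deg i
  map_d : ∀ x : M, f (M.d x) = N.d (f x)

/-- Chain homotopy. -/
def Homotopic {M : PreComplex.{u}} {N : PreComplex.{v}} (f g : M →+ N) : Prop :=
  ∃ h : M →+ N, (∀ (i : ℤ) (x : M), x ∈ M.deg i → h x ∈ N.deg (i + 1)) ∧
    ∀ x : M, f x - g x = N.d (h x) + h (M.d x)

/-- A chain map that is bijective on homology. -/
structure IsQuasiIso {M : PreComplex.{u}} {N : PreComplex.{v}} (f : M →+ N) : Prop where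
  chain : IsChainMap f
  inj : ∀ x : M, M.d x = 0 → (∃ z : N, f x = N.d z) → ∃ z : M, x = M.d z
  surj : ∀ y : N, N.d y = 0 → ∃ x : M, M.d x = 0 ∧ ∃ z : N, y = f x + N.d z

/-! ### dg-categories, monoidal dg-categories, PROPs -/

/-- A dg-category with objects `O`.  Composition is written in diagrammatic order:
`comp f g` is `f` followed by `g`. -/
structure DGCat (O : Type) where
  Hom : O → O → PreComplex.{u}
  isComplex : ∀ a b, (Hom a b).IsComplex
  one : ∀ a, Hom a a
  comp : ∀ {a b c}, Hom a b →+ Hom b c →+ Hom a c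
  one_deg : ∀ a, one a ∈ (Hom a a).deg 0
  comp_deg : ∀ {a b c} (i j : ℤ) (f : Hom a b) (g : Hom b c),
    f ∈ (Hom a b).deg i → g ∈ (Hom b c).deg j → comp f g ∈ (Hom a c).deg (i + j)
  comp_d : ∀ {a b c} (i : ℤ) (f : Hom a b) (g : Hom b c), f ∈ (Hom a b).deg i →
    (Hom a c).d (comp f g) = comp ((Hom a b).d f) g + sgn i • comp f ((Hom b c).d g)
  one_comp : ∀ {a b} (f : Hom a b), comp (one a) f = f
  comp_one : ∀ {a b} (f : Hom a b), comp f (one b) = f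
  comp_assoc : ∀ {a b c e} (f : Hom a b) (g : Hom b c) (h : Hom c e),
    comp (comp f g) h = comp f (comp g h)

open Classical in
/-- The identity, as a morphism `a ⟶ b`, if `a = b` (and `0` if `a ≠ b`). -/
noncomputable def DGCat.eqId {O : Type} (D : DGCat.{u} O) (a b : O) : D.Hom a b :=
  if h : a = b then h ▸ D.one a else 0

/-- A strict monoidal dg-category, whose objects form the monoid `O`. -/
structure MonDGCat (O : Type) [AddMonoid O] extends DGCat.{u} O where
  tens : ∀ {a b c e}, Hom a b →+ Hom c e →+ Hom (a + c) (b + e)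
  tens_deg : ∀ {a b c e} (i j : ℤ) (f : Hom a b) (g : Hom c e),
    f ∈ (Hom a b).deg i → g ∈ (Hom c e).deg j → tens f g ∈ (Hom (a + c) (b + e)).deg (i + j)
  tens_d : ∀ {a b c e} (i : ℤ) (f : Hom a b) (g : Hom c e), f ∈ (Hom a b).deg i →
    (Hom (a + c) (b + e)).d (tens f g) = tens ((Hom a b).d f) g + sgn i • tens f ((Hom c e).d g)
  tens_one : ∀ a b, tens (one a) (one b) = one (a + b)
  interchange : ∀ {a b c a' b' c'} (i j : ℤ) (f : Hom a b) (g : Hom b c) (f' : Hom a' b')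
    (g' : Hom b' c'), g ∈ (Hom b c).deg i → f' ∈ (Hom a' b').deg j →
    comp (tens f f') (tens g g') = sgn (i * j) • tens (comp f g) (comp f' g')
  tens_assoc : ∀ {a a' b b' c c'} (f : Hom a a') (g : Hom b b') (h : Hom c c'),
    comp (tens (tens f g) h) (toDGCat.eqId (a' + b' + c') (a' + (b' + c'))) =
      comp (toDGCat.eqId (a + b + c) (a + (b + c))) (tens f (tens g h))
  zero_tens : ∀ {a b} (f : Hom a b),
    comp (tens (one 0) f) (toDGCat.eqId (0 + b) b) = comp (toDGCat.eqId (0 + a) a) f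
  tens_zero : ∀ {a b} (f : Hom a b),
    comp (tens f (one 0)) (toDGCat.eqId (b + 0) b) = comp (toDGCat.eqId (a + 0) a) f

/-- A symmetry on a strict monoidal dg-category. -/
structure Symmetry {O : Type} [AddMonoid O] (D : MonDGCat.{u} O) where
  braid : ∀ a b, D.Hom (a + b) (b + a)
  braid_deg : ∀ a b, braid a b ∈ (D.Hom (a + b) (b + a)).deg 0
  braid_d : ∀ a b, (D.Hom (a + b) (b + a)).d (braid a b) = 0
  naturality : ∀ {a a' b b'} (i j : ℤ) (f : D.Hom a a') (g : D.Hom b b'),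
    f ∈ (D.Hom a a').deg i → g ∈ (D.Hom b b').deg j →
    D.comp (D.tens f g) (braid a' b') = sgn (i * j) • D.comp (braid a b) (D.tens g f)
  braid_braid : ∀ a b, D.comp (braid a b) (braid b a) = D.one (a + b)
  hexagon : ∀ a b c,
    D.comp (D.comp (D.eqId (a + b + c) (a + (b + c))) (braid a (b + c)))
        (D.eqId (b + c + a) (b + (c + a))) =
      D.comp (D.comp (D.tens (braid a b) (D.one c)) (D.eqId (b + a + c) (b + (a + c))))
        (D.tens (D.one b) (braid a c))

/-- A PROP in chain complexes: a symmetric strict monoidal dg-category with objects `ℕ`. -/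
structure DGProp extends MonDGCat.{u} ℕ where
  sym : Symmetry toMonDGCat

namespace DGProp

/-- `id_a ⊗ f ⊗ id_c`. -/
def ins (E : DGProp.{u}) (a : ℕ) {x y : ℕ} (f : E.Hom x y) (c : ℕ) :
    E.Hom (a + x + c) (a + y + c) :=
  E.tens (E.tens (E.one a) f) (E.one c)

end DGProp

/-! ### PROPs with (unital) `A_∞`-multiplication

The PROP `A_∞` of planar forests is free as a graded symmetric monoidal category on the corollas
`m_k : k ⟶ 1`, `k ≥ 2`, of degree `k - 2`, and its differential is determined by that of the
corollas, the sum of all their blow-ups.  So a symmetric monoidal dg-functor from it to `E` which is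
the identity on objects is the same thing as a family of morphisms `m_k` of `E` satisfying the
equations below.  The signs are those of the orientation `v ∧ h₁ ∧ ⋯ ∧ h_{k+1}` of the corollas. -/

/-- An `A_∞`-multiplication on `E`.  (The values `m 0`, `m 1` play no role.) -/
structure AInfMult (E : DGProp.{u}) where
  m : ∀ k : ℕ, E.Hom k 1
  m_deg : ∀ k : ℕ, 2 ≤ k → m k ∈ (E.Hom k 1).deg ((k : ℤ) - 2)
  m_d : ∀ k : ℕ, 2 ≤ k → (E.Hom k 1).d (m k) =
    ∑ a ∈ Finset.range (k + 1), ∑ b ∈ Finset.range (k + 1), ∑ c ∈ Finset.range (k + 1),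
      if a + b + c = k ∧ 2 ≤ b ∧ 1 ≤ a + c then
        sgn ((a + 1) * (b + 1)) •
          E.comp (E.comp (E.eqId k (a + b + c)) (E.ins a (m b) c)) (m (a + 1 + c))
      else 0

/-- A strict unit for an `A_∞`-multiplication: together they amount to a symmetric monoidal
dg-functor from `A_∞⁺`, the PROP of planar forests in which the single outgoing leaf is allowed. -/
structure StrictUnit {E : DGProp.{u}} (A : AInfMult E) where
  u : E.Hom 0 1
  u_deg : u ∈ (E.Hom 0 1).deg 0
  u_d : (E.Hom 0 1).d u = 0
  unit_left : E.comp (E.tens u (E.one 1)) (A.m 2) = E.eqId (0 + 1) 1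
  unit_right : E.comp (E.tens (E.one 1) u) (A.m 2) = E.eqId (1 + 0) 1
  unit_higher : ∀ a c : ℕ, 3 ≤ a + 1 + c → E.comp (E.ins a u c) (A.m (a + 1 + c)) = 0

/-- The component `f_{N,K} : N ⟶ K` of the differential of `l_N`, where `1 ≤ K < N` and
`r = N + 1 - K`: the sum of the operations `m_r` on `r` cyclically consecutive inputs.
First come the `K` intervals that do not wrap around; then those consisting of the last `t` and the
first `r - t` inputs, whose output is put in first place. -/
noncomputable def AInfMult.hoch {E : DGProp.{u}} (A : AInfMult E) (N K : ℕ) : E.Hom N K :=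
  let r := N + 1 - K
  (∑ a ∈ Finset.range K, sgn ((a + 1) * (r + 1)) •
    E.comp (E.comp (E.eqId N (a + r + (K - 1 - a))) (E.ins a (A.m r) (K - 1 - a)))
      (E.eqId (a + 1 + (K - 1 - a)) K)) +
  ∑ t ∈ Finset.Ico 1 r, sgn (r + 1 + t * (N - t)) •
    E.comp (E.comp (E.comp (E.comp (E.eqId N (N - t + t)) (E.sym.braid (N - t) t))
      (E.eqId (t + (N - t)) (r + (K - 1)))) (E.tens (A.m r) (E.one (K - 1))))
      (E.eqId (1 + (K - 1)) K)

/-! ### dg-functors to chain complexes -/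

/-- The data of a dg-functor `D → Ch`, as a right module: `act : F a ⊗ D(a, b) → F b`. -/
structure PreFunctor {O : Type} (D : DGCat.{u} O) where
  obj : O → PreComplex.{v}
  act : ∀ {a b}, obj a →+ D.Hom a b →+ obj b

/-- `F` is a dg-functor from `D` to chain complexes. -/
structure PreFunctor.IsDGFunctor {O : Type} {D : DGCat.{u} O} (F : PreFunctor.{u, v} D) :
    Prop where
  isComplex : ∀ a, (F.obj a).IsComplex
  act_deg : ∀ {a b} (i j : ℤ) (x : F.obj a) (f : D.Hom a b),
    x ∈ (F.obj a).deg i → f ∈ (D.Hom a b).deg j → F.act x f ∈ (F.obj b).deg (i + j)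
  act_d : ∀ {a b} (i : ℤ) (x : F.obj a) (f : D.Hom a b), x ∈ (F.obj a).deg i →
    (F.obj b).d (F.act x f) = F.act ((F.obj a).d x) f + sgn i • F.act x ((D.Hom a b).d f)
  act_one : ∀ {a} (x : F.obj a), F.act x (D.one a) = x
  act_comp : ∀ {a b c} (x : F.obj a) (f : D.Hom a b) (g : D.Hom b c),
    F.act x (D.comp f g) = F.act (F.act x f) g

/-- The functor `D(a, -)`. -/
def rep {O : Type} (D : DGCat.{u} O) (a : O) : PreFunctor.{u, u} D where
  obj b := D.Hom a b
  act := D.comp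

/-- A (lax) monoidal structure on a dg-functor `D → Ch`. -/
structure MonStr {O : Type} [AddMonoid O] {D : MonDGCat.{u} O}
    (F : PreFunctor.{u, v} D.toDGCat) where
  one : F.obj 0
  mul : ∀ {a b}, F.obj a →+ F.obj b →+ F.obj (a + b)
  one_deg : one ∈ (F.obj 0).deg 0
  one_d : (F.obj 0).d one = 0
  mul_deg : ∀ {a b} (i j : ℤ) (x : F.obj a) (y : F.obj b),
    x ∈ (F.obj a).deg i → y ∈ (F.obj b).deg j → mul x y ∈ (F.obj (a + b)).deg (i + j)
  mul_d : ∀ {a b} (i : ℤ) (x : F.obj a) (y : F.obj b), x ∈ (F.obj a).deg i →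
    (F.obj (a + b)).d (mul x y) = mul ((F.obj a).d x) y + sgn i • mul x ((F.obj b).d y)
  naturality : ∀ {a a' b b'} (i j : ℤ) (x : F.obj a) (f : D.Hom a a') (y : F.obj b)
    (g : D.Hom b b'), f ∈ (D.Hom a a').deg i → y ∈ (F.obj b).deg j →
    mul (F.act x f) (F.act y g) = sgn (i * j) • F.act (mul x y) (D.tens f g)
  mul_assoc : ∀ {a b c} (x : F.obj a) (y : F.obj b) (z : F.obj c),
    F.act (mul (mul x y) z) (D.eqId (a + b + c) (a + (b + c))) = mul x (mul y z)
  one_mul : ∀ {a} (x : F.obj a), F.act (mul one x) (D.eqId (0 + a) a) = x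
  mul_one : ∀ {a} (x : F.obj a), F.act (mul x one) (D.eqId (a + 0) a) = x

namespace MonStr

variable {O : Type} [AddMonoid O] {D : MonDGCat.{u} O} {F : PreFunctor.{u, v} D.toDGCat}

/-- The unit map `ℤ → F 0`. -/
def unitMap (M : MonStr F) : unitComplex.{v} →+ F.obj 0 :=
  AddMonoidHom.mk' (fun z : ULift.{v} ℤ => z.down • M.one) (fun z z' => add_smul z.down z'.down _)

/-- The structure maps `ℤ → F 0` and `F a ⊗ F b → F (a + b)` are isomorphisms. -/
def Split (M : MonStr F) : Prop :=
  Function.Bijective M.unitMap ∧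
    ∀ a b, Function.Bijective (onTensor (M.mul (a := a) (b := b)))

/-- The structure maps `ℤ → F 0` and `F a ⊗ F b → F (a + b)` are quasi-isomorphisms. -/
def HSplit (M : MonStr F) : Prop :=
  IsQuasiIso M.unitMap ∧
    ∀ a b, IsQuasiIso (onTensor (M.mul (a := a) (b := b)))

/-- Compatibility with the symmetries of `D` and of chain complexes. -/
def Symmetric (M : MonStr F) (τ : Symmetry D) : Prop :=
  ∀ {a b} (i j : ℤ) (x : F.obj a) (y : F.obj b), x ∈ (F.obj a).deg i → y ∈ (F.obj b).deg j →
    F.act (M.mul x y) (τ.braid a b) = sgn (i * j) • M.mul y x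

end MonStr

/-- A monoidal natural transformation of monoidal dg-functors. -/
structure IsMonNat {O : Type} [AddMonoid O] {D : MonDGCat.{u} O}
    {F F' : PreFunctor.{u, v} D.toDGCat} (M : MonStr F) (M' : MonStr F')
    (η : ∀ a, F.obj a →+ F'.obj a) : Prop where
  chain : ∀ a, IsChainMap (η a)
  map_act : ∀ {a b} (x : F.obj a) (f : D.Hom a b), η b (F.act x f) = F'.act (η a x) f
  map_one : η 0 M.one = M'.one
  map_mul : ∀ {a b} (x : F.obj a) (y : F.obj b), η (a + b) (M.mul x y) = M'.mul (η a x) (η b y)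

/-! ### The Hochschild complex

`C(Φ)(m) = ⨁_{n ≥ 0} Φ(n + 1 + m) ⊗ L_{n+1}`, with `L_{n+1}` generated by `l_{n+1}` in degree `n`.
The summand of index `n` is that of `l_{n+1}`. -/

section Hochschild

variable {E : DGProp.{u}} (A : AInfMult E)

/-- The Hochschild complex `C(Φ)`, with
`d (x ⊗ l_{n+1}) = d x ⊗ l_{n+1} + (-1)^|x| ∑_{k<n} x · (f_{n+1,k+1} ⊗ id_m) ⊗ l_{k+1}` and
`(x ⊗ l_{n+1}) · f = (-1)^(n|f|) x · (id_{n+1} ⊗ f) ⊗ l_{n+1}`. -/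
noncomputable def hochschild (Φ : PreFunctor.{u, v} E.toDGCat) : PreFunctor.{u, v} E.toDGCat where
  obj m :=
    { carrier := ⨁ n : ℕ, Φ.obj (n + 1 + m)
      deg := fun i => ⨅ n : ℕ, ((Φ.obj (n + 1 + m)).deg (i - n)).comap
        (DFinsupp.evalAddMonoidHom n)
      d := DirectSum.toAddMonoid fun n =>
        (DirectSum.of (fun n : ℕ => Φ.obj (n + 1 + m)) n).comp (Φ.obj (n + 1 + m)).d +
        ∑ k ∈ Finset.range n, (DirectSum.of (fun n : ℕ => Φ.obj (n + 1 + m)) k).comp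
          ((Φ.act.flip (E.tens (A.hoch (n + 1) (k + 1)) (E.one m))).comp
            ((Φ.obj (n + 1 + m)).koszul 1)) }
  act {a b} := DirectSum.toAddMonoid fun n =>
    biadd (fun (x : Φ.obj (n + 1 + a)) (f : E.Hom a b) =>
        DirectSum.of (fun n : ℕ => Φ.obj (n + 1 + b)) n
          (Φ.act x (E.tens (E.one (n + 1)) ((E.Hom a b).koszul n f))))
      (fun x x' f => by simp) (fun x f f' => by simp)

variable {A} in
/-- `id_{a+1} ⊗ u ⊗ id : n ⟶ n + 1`, the insertion of a unit in position `a + 2`, for `a < n`. -/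
noncomputable def StrictUnit.insert (U : StrictUnit A) (n a : ℕ) : E.Hom n (n + 1) :=
  E.comp (E.comp (E.eqId n (a + 1 + 0 + (n - 1 - a))) (E.ins (a + 1) U.u (n - 1 - a)))
    (E.eqId (a + 1 + 1 + (n - 1 - a)) (n + 1))

variable {A} in
/-- The degenerate part `⨁ U_{n+1} ⊗ L_{n+1}` of `C(Φ)(m)`, where `U_{n+1} ⊆ Φ(n + 1 + m)` is
spanned by the images of the insertions of a unit in the positions `2, …, n + 1`. -/
noncomputable def StrictUnit.degenerate (U : StrictUnit A) (Φ : PreFunctor.{u, v} E.toDGCat)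
    (m : ℕ) : AddSubgroup ((hochschild A Φ).obj m) :=
  ⨅ n : ℕ, (AddSubgroup.closure {x : Φ.obj (n + 1 + m) | ∃ a < n, ∃ y : Φ.obj (n + m),
    x = Φ.act y (E.tens (U.insert n a) (E.one m))}).comap
      (DFinsupp.evalAddMonoidHom n : (⨁ n : ℕ, Φ.obj (n + 1 + m)) →+ Φ.obj (n + 1 + m))

open Classical in
/-- The map `M ⧸ U → P` induced by `T : M → P` when `T` vanishes on `U`
(and `0` otherwise, which does not occur for the maps considered here). -/
noncomputable def descend {M : Type u} {P : Type v} [AddCommGroup M] [AddCommGroup P]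
    (U : AddSubgroup M) (T : M →+ P) : M ⧸ U →+ P :=
  if h : ∀ x ∈ U, T x = 0 then QuotientAddGroup.lift U T h else 0

variable {A} in
/-- The reduced Hochschild complex, the quotient of `C(Φ)` by its degenerate part. -/
noncomputable def StrictUnit.reducedHochschild (U : StrictUnit A) (Φ : PreFunctor.{u, v} E.toDGCat) :
    PreFunctor.{u, v} E.toDGCat where
  obj m :=
    { carrier := (hochschild A Φ).obj m ⧸ U.degenerate Φ m
      deg := fun i => (((hochschild A Φ).obj m).deg i).map
        (QuotientAddGroup.mk' (U.degenerate Φ m))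
      d := descend _ ((QuotientAddGroup.mk' (U.degenerate Φ m)).comp
        ((hochschild A Φ).obj m).d) }
  act {_ b} := descend _ ((hochschild A Φ).act.compr₂
    (QuotientAddGroup.mk' (U.degenerate Φ b)))

/-- The two variants of the Hochschild complex: `C`, and, for a PROP with unital
`A_∞`-multiplication, the reduced one. -/
inductive Variant : Type u
  | unreduced : Variant
  | reduced (U : StrictUnit A) : Variant

end Hochschild

namespace Variant

variable {E : DGProp.{u}} {A : AInfMult E} (H : Variant A)

/-- The Hochschild complex operator (`C` or its reduced variant). -/
noncomputable def op (Φ : PreFunctor.{u, v} E.toDGCat) : PreFunctor.{u, v} E.toDGCat :=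
  match H with
  | unreduced => hochschild A Φ
  | reduced U => U.reducedHochschild Φ

/-- `x ↦ x ⊗ l_{n+1}`. -/
noncomputable def gen (Φ : PreFunctor.{u, v} E.toDGCat) (m n : ℕ) :
    Φ.obj (n + 1 + m) →+ (H.op Φ).obj m :=
  match H with
  | unreduced => DirectSum.of (fun n : ℕ => Φ.obj (n + 1 + m)) n
  | reduced U => (QuotientAddGroup.mk' (U.degenerate Φ m)).comp
      (DirectSum.of (fun n : ℕ => Φ.obj (n + 1 + m)) n)

/-- The additive map with `x ⊗ l_{n+1} ↦ T n x`. -/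
noncomputable def lift (Φ : PreFunctor.{u, v} E.toDGCat) (m : ℕ) {P : Type w} [AddCommGroup P]
    (T : ∀ n : ℕ, Φ.obj (n + 1 + m) →+ P) : (H.op Φ).obj m →+ P :=
  match H with
  | unreduced => DirectSum.toAddMonoid T
  | reduced U => descend (U.degenerate Φ m) (DirectSum.toAddMonoid T)

/-- The iterated Hochschild complex `Cⁿ(Φ)`. -/
noncomputable def pow : ℕ → PreFunctor.{u, v} E.toDGCat → PreFunctor.{u, v} E.toDGCat
  | 0, Φ => Φ
  | n + 1, Φ => H.op (pow n Φ)

/-- The map `Cⁿ(Φ) → Cⁿ(Φ')` induced by `η : Φ → Φ'`. -/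
noncomputable def map {Φ Φ' : PreFunctor.{u, v} E.toDGCat} (η : ∀ a, Φ.obj a →+ Φ'.obj a) :
    ∀ n m : ℕ, (H.pow n Φ).obj m →+ (H.pow n Φ').obj m
  | 0, m => η m
  | n + 1, m => H.lift (H.pow n Φ) m fun k => (H.gen (H.pow n Φ') m k).comp (map η n (k + 1 + m))

/-- `Φ(a) ⊗ Cⁿ(E(a, -))(m) → Cⁿ(Φ)(m)`, induced by the action of `E` on `Φ`. -/
noncomputable def ev (Φ : PreFunctor.{u, v} E.toDGCat) (a : ℕ) :
    ∀ n m : ℕ, Φ.obj a →+ (H.pow n (rep E.toDGCat a)).obj m →+ (H.pow n Φ).obj m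
  | 0, _ => Φ.act
  | n + 1, m => (H.lift (H.pow n (rep E.toDGCat a)) m fun k =>
      ((ev Φ a n (k + 1 + m)).compr₂ (H.gen (H.pow n Φ) m k)).flip).flip

/-- The additive map on `Cⁿ(Φ)(m)` with
`x ⊗ l_{k₁} ⊗ ⋯ ⊗ l_{kₙ} ↦ T a (id_a ⊗ l_{k₁} ⊗ ⋯ ⊗ l_{kₙ}) x`, for `x ∈ Φ(a)`,
`a = k₁ + ⋯ + kₙ + m`. -/
noncomputable def ofUniversal (Φ : PreFunctor.{u, v} E.toDGCat) {P : Type w} [AddCommGroup P] :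
    ∀ (n m : ℕ) (_ : ∀ a, (H.pow n (rep E.toDGCat a)).obj m → (Φ.obj a →+ P)),
      (H.pow n Φ).obj m →+ P
  | 0, m, T => T m (E.one m)
  | n + 1, m, T => H.lift (H.pow n Φ) m fun k =>
      ofUniversal Φ n (k + 1 + m) fun a z => T a (H.gen (H.pow n (rep E.toDGCat a)) m k z)

section Products

variable {F G K : PreFunctor.{u, v} E.toDGCat}
  (p : ∀ a b, F.obj a →+ G.obj b →+ K.obj (a + b))

/-- `Cⁿ(F)(a) ⊗ G(b) → Cⁿ(K)(a + b)`, `(x ⊗ l) ⊗ y ↦ (-1)^(|l||y|) p(x, y) ⊗ l`. -/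
noncomputable def rmul : ∀ n a b : ℕ, (H.pow n F).obj a →+ G.obj b →+ (H.pow n K).obj (a + b)
  | 0, a, b => p a b
  | n + 1, a, b => H.lift (H.pow n F) a fun k =>
      biadd (fun x y => H.gen (H.pow n K) (a + b) k
          ((H.pow n K).act (rmul n (k + 1 + a) b x ((G.obj b).koszul k y))
            (E.eqId (k + 1 + a + b) (k + 1 + (a + b)))))
        (fun x x' y => by simp; rfl) (fun x y y' => by simp; rfl)

/-- `Cⁿ(F)(a) ⊗ Cⁿ'(G)(b) → Cⁿ⁺ⁿ'(K)(a + b)`, where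
`(x ⊗ l) ⊗ (y ⊗ l') ↦ (-1)^(|l||y|) p(x, y) · (permutation) ⊗ l ⊗ l'`;
the permutation moves the inputs of the `l'` past the `a` last inputs of `x`. -/
noncomputable def pair :
    ∀ n n' a b : ℕ, (H.pow n F).obj a →+ (H.pow n' G).obj b →+ (H.pow (n + n') K).obj (a + b)
  | n, 0, a, b => H.rmul p n a b
  | n, n' + 1, a, b => (H.lift (H.pow n' G) b fun k =>
      biadd (fun y x => H.gen (H.pow (n + n') K) (a + b) k
          ((H.pow (n + n') K).act (pair n n' a (k + 1 + b) x y)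
            (E.comp (E.comp (E.eqId (a + (k + 1 + b)) (a + (k + 1) + b))
              (E.tens (E.sym.braid a (k + 1)) (E.one b)))
              (E.eqId (k + 1 + a + b) (k + 1 + (a + b))))))
        (fun y y' x => by simp) (fun y x x' => by simp)).flip

end Products

end Variant

/-! ### Tensor powers `V^{⊗n} ⊗ W^{⊗m}` -/

section TensorPowers

/-- `V^{⊗n}`. -/
noncomputable def vpow (V : PreComplex.{v}) : ℕ → PreComplex.{v}
  | 0 => unitComplex
  | n + 1 => tensor (vpow V n) V

/-- `V^{⊗n} ⊗ W^{⊗m}`. -/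
noncomputable def vwpow (V W : PreComplex.{v}) (n : ℕ) : ℕ → PreComplex.{v}
  | 0 => vpow V n
  | m + 1 => tensor (vwpow V W n m) W

/-- `V^{⊗n} ⊗ W^{⊗m}` for the object `(m, n)` of `ℕ × ℕ`. -/
noncomputable def tpow (V W : PreComplex.{v}) (p : ℕ × ℕ) : PreComplex.{v} := vwpow V W p.2 p.1

/-- `1 ∈ ℤ = V^{⊗0} ⊗ W^{⊗0}`. -/
def tone (V W : PreComplex.{v}) : tpow V W 0 := (ULift.up 1 : ULift.{v} ℤ)

/-- `v ∈ V`, as an element of `ℤ ⊗ V = V^{⊗1} ⊗ W^{⊗0}`. -/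
noncomputable def inV (V W : PreComplex.{v}) (x : V) : tpow V W (0, 1) :=
  (tmk (ULift.up 1 : ULift.{v} ℤ) x : tensor unitComplex.{v} V)

/-- `w ∈ W`, as an element of `ℤ ⊗ W = V^{⊗0} ⊗ W^{⊗1}`. -/
noncomputable def inW (V W : PreComplex.{v}) (x : W) : tpow V W (1, 0) :=
  (tmk (ULift.up 1 : ULift.{v} ℤ) x : tensor unitComplex.{v} W)

/-- `f^{⊗n} : V^{⊗n} → V'^{⊗n}`. -/
noncomputable def vmap {V V' : PreComplex.{v}} (f : V →+ V') : ∀ n : ℕ, vpow V n →+ vpow V' n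
  | 0 => AddMonoidHom.id _
  | n + 1 => onTensor (biadd (fun x y => tmk (vmap f n x) (f y))
      (fun x x' y => by rw [map_add, tmk_add_left]; rfl) (fun x y y' => by rw [map_add, tmk_add_right]; rfl))

/-- `f^{⊗n} ⊗ g^{⊗m}`. -/
noncomputable def vwmap {V V' W W' : PreComplex.{v}} (f : V →+ V') (g : W →+ W') (n : ℕ) :
    ∀ m : ℕ, vwpow V W n m →+ vwpow V' W' n m
  | 0 => vmap f n
  | m + 1 => onTensor (biadd (fun x y => tmk (vwmap f g n m x) (g y))
      (fun x x' y => by rw [map_add, tmk_add_left]; rfl) (fun x y y' => by rw [map_add, tmk_add_right]; rfl))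

/-- Insertion of `v ∈ V` between the factors `V` and the factors `W`, with the Koszul sign:
`(x ⊗ w) ⊗ v ↦ (-1)^(|w||v|) (x ⊗ v) ⊗ w`.  In the formula `v` is split into its parts of even
and of odd degree. -/
noncomputable def insV (V W : PreComplex.{v}) (n : ℕ) :
    ∀ m : ℕ, vwpow V W n m →+ V →+ vwpow V W (n + 1) m
  | 0 => biadd (fun x y => (tmk x y : tensor (vpow V n) V))
      (fun x x' y => tmk_add_left x x' y) (fun x y y' => tmk_add_right x y y')
  | m + 1 => onTensor (biadd (fun x w =>
      (AddMonoidHom.mk' (fun y : V =>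
        (tmk (insV V W n m x (V.scale (fun i => if Even i then 1 else 0) y)) w +
          tmk (insV V W n m x (V.scale (fun i => if Even i then 0 else 1) y)) (W.koszul 1 w) :
            tensor (vwpow V W (n + 1) m) W))
        (fun y y' => by simp only [map_add, tmk_add_left]; abel) :
          V →+ vwpow V W (n + 1) (m + 1)))
      (fun x x' w => by
        ext y
        simp only [map_add, AddMonoidHom.add_apply, tmk_add_left]
        exact add_add_add_comm _ _ _ _)
      (fun x w w' => by
        ext y
        simp only [map_add, AddMonoidHom.add_apply, tmk_add_right]
        exact add_add_add_comm _ _ _ _))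

/-- The reordering `V^{⊗n} ⊗ V^{⊗n'} ⊗ W^{⊗m} → V^{⊗n+n'} ⊗ W^{⊗m}`. -/
noncomputable def shuffleV (V W : PreComplex.{v}) (n m : ℕ) :
    ∀ n' : ℕ, vwpow V W n m →+ vpow V n' →+ vwpow V W (n + n') m
  | 0 => biadd (fun x (z : ULift.{v} ℤ) => z.down • x)
      (fun x x' z => smul_add _ x x') (fun x z z' => add_smul z.down z'.down x)
  | n' + 1 => (onTensor (biadd (fun y v =>
      ((insV V W (n + n') m).flip v).comp ((shuffleV V W n m n').flip y))
      (fun y y' v => by ext x; simp) (fun y v v' => by ext x; simp))).flip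

/-- The canonical isomorphism `(V^{⊗n} ⊗ W^{⊗m}) ⊗ (V^{⊗n'} ⊗ W^{⊗m'}) → V^{⊗n+n'} ⊗ W^{⊗m+m'}`,
the reordering of the factors with the Koszul sign. -/
noncomputable def shuffleVW (V W : PreComplex.{v}) (n m n' : ℕ) :
    ∀ m' : ℕ, vwpow V W n m →+ vwpow V W n' m' →+ vwpow V W (n + n') (m + m')
  | 0 => shuffleV V W n m n'
  | m' + 1 => (onTensor (biadd (fun y w =>
      (AddMonoidHom.mk' (fun x =>
          (tmk (shuffleVW V W n m n' m' x y) w : tensor (vwpow V W (n + n') (m + m')) W))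
        (fun x x' => by simp only [map_add, AddMonoidHom.add_apply, tmk_add_left]; rfl) :
          vwpow V W n m →+ vwpow V W (n + n') (m + (m' + 1))))
      (fun y y' w => by
        ext x; simp only [map_add, AddMonoidHom.add_apply, tmk_add_left]
        rfl)
      (fun y w w' => by
        ext x; simp only [AddMonoidHom.add_apply, tmk_add_right]
        rfl))).flip

/-- The reordering isomorphism `shuffleVW`, for objects of `ℕ × ℕ`. -/
noncomputable def shuffle (V W : PreComplex.{v}) (p q : ℕ × ℕ) :
    tpow V W p →+ tpow V W q →+ tpow V W (p + q) :=
  shuffleVW V W p.2 p.1 q.2 q.1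

end TensorPowers

/-! ### Extensions of the Hochschild core category -/

section Extensions

variable {E : DGProp.{u}} {A : AInfMult E}

/-- An extension of the Hochschild core category `CE` (or of its reduced variant): a strict monoidal
dg-category with objects the pairs `(m, n)` of natural numbers, whose morphisms with source `(a, 0)`
are identified with those of `CE`, that is with `Cⁿ(E(a, -))(m)`, compatibly with identities, with
the compositions of `CE`, and with its monoidal structure. -/
structure Extension (H : Variant A) where
  cat : MonDGCat.{u} (ℕ × ℕ)
  ι : ∀ a m n : ℕ, (H.pow n (rep E.toDGCat a)).obj m ≃+ cat.Hom (a, 0) (m, n)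
  ι_deg : ∀ (a m n : ℕ) (i : ℤ) (x : (H.pow n (rep E.toDGCat a)).obj m),
    ι a m n x ∈ (cat.Hom (a, 0) (m, n)).deg i ↔ x ∈ ((H.pow n (rep E.toDGCat a)).obj m).deg i
  ι_d : ∀ (a m n : ℕ) (x : (H.pow n (rep E.toDGCat a)).obj m),
    ι a m n (((H.pow n (rep E.toDGCat a)).obj m).d x) = (cat.Hom (a, 0) (m, n)).d (ι a m n x)
  ι_one : ∀ a : ℕ, ι a a 0 (E.one a) = cat.one (a, 0)
  ι_comp : ∀ (a b m n : ℕ) (f : E.Hom a b) (x : (H.pow n (rep E.toDGCat b)).obj m),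
    cat.comp (ι a b 0 f) (ι b m n x) = ι a m n (H.ev (rep E.toDGCat a) b n m f x)
  ι_tens : ∀ (a m n a' m' n' : ℕ) (x : (H.pow n (rep E.toDGCat a)).obj m)
    (y : (H.pow n' (rep E.toDGCat a')).obj m'),
    cat.tens (ι a m n x) (ι a' m' n' y) =
      ι (a + a') (m + m') (n + n')
        (H.pair (F := rep E.toDGCat a) (G := rep E.toDGCat a') (K := rep E.toDGCat (a + a'))
          (fun _ _ => E.tens) n n' m m' x y)

namespace Extension

variable {H : Variant A} (X : Extension H)

/-- The symmetry `τ` makes `X` an extension of symmetric monoidal categories: it extends the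
symmetry of `E`. -/
def Compatible (τ : Symmetry X.cat) : Prop :=
  ∀ a b : ℕ, τ.braid (a, 0) (b, 0) = X.ι (a + b) (b + a) 0 (E.sym.braid a b)

/-- The action `Cⁿ¹(Φ)(m₁) ⊗ Ẽ((m₁, n₁), (m₂, n₂)) → Cⁿ²(Φ)(m₂)`: for `x ∈ Φ(a)`,
`(x ⊗ l) ⊗ f ↦ x · ((id_a ⊗ l) · f)`, where `id_a ⊗ l` is read as a morphism `(a, 0) ⟶ (m₁, n₁)`
of `Ẽ`, so that the composition with `f` is an element of `Cⁿ²(E(a, -))(m₂)`. -/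
noncomputable def act (Φ : PreFunctor.{u, v} E.toDGCat) (p q : ℕ × ℕ) :
    (H.pow p.2 Φ).obj p.1 →+ X.cat.Hom p q →+ (H.pow q.2 Φ).obj q.1 :=
  H.ofUniversal Φ p.2 p.1 fun a z =>
    (H.ev Φ a q.2 q.1).compl₂
      ((X.ι a q.1 q.2).symm.toAddMonoidHom.comp (X.cat.comp (X.ι a p.1 p.2 z)))

end Extension

namespace Variant

variable (H : Variant A)

/-- `C(Φ)(0)^{⊗n} ⊗ Φ(1)^{⊗m}`. -/
noncomputable def T (Φ : PreFunctor.{u, v} E.toDGCat) (p : ℕ × ℕ) : PreComplex.{v} :=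
  tpow ((H.op Φ).obj 0) (Φ.obj 1) p

variable {Φ : PreFunctor.{u, v} E.toDGCat} (M : MonStr (D := E.toMonDGCat) Φ)

/-- `C(Φ)(0)^{⊗n} → Cⁿ(Φ)(0)`,
`(x₁ ⊗ l_{k₁}) ⊗ ⋯ ⊗ (xₙ ⊗ l_{kₙ}) ↦ ± x₁ ⋯ xₙ ⊗ l_{k₁} ⊗ ⋯ ⊗ l_{kₙ}`. -/
noncomputable def lamV : ∀ n : ℕ, vpow ((H.op Φ).obj 0) n →+ (H.pow n Φ).obj 0
  | 0 => M.unitMap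
  | n + 1 => onTensor (H.lift Φ 0 fun k =>
      biadd (fun (y : Φ.obj (k + 1 + 0)) (x : vpow ((H.op Φ).obj 0) n) =>
          (H.gen (H.pow n Φ) 0 k ((H.pow n Φ).act
            (H.rmul (fun _ _ => M.mul) n 0 (k + 1 + 0) (lamV n x) y)
            (E.eqId (0 + (k + 1 + 0)) (k + 1 + 0))) : (H.op (H.pow n Φ)).obj 0))
        (fun y y' x => by simp) (fun y x x' => by simp)).flip

/-- `C(Φ)(0)^{⊗n} ⊗ Φ(1)^{⊗m} → Cⁿ(Φ)(m)`, induced by the monoidal structure of `Φ`. -/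
noncomputable def lamVW (n : ℕ) :
    ∀ m : ℕ, vwpow ((H.op Φ).obj 0) (Φ.obj 1) n m →+ (H.pow n Φ).obj m
  | 0 => H.lamV M n
  | m + 1 => onTensor ((H.rmul (F := Φ) (G := Φ) (K := Φ) (fun _ _ => M.mul) n m 1).comp
      (lamVW n m))

/-- The map `λ : C(Φ)(0)^{⊗n} ⊗ Φ(1)^{⊗m} → Cⁿ(Φ)(m)`. -/
noncomputable def lam (p : ℕ × ℕ) : H.T Φ p →+ (H.pow p.2 Φ).obj p.1 := H.lamVW M p.2 p.1

/-- The product `Cⁿ(Φ)(m) ⊗ Cⁿ'(Φ)(m') → Cⁿ⁺ⁿ'(Φ)(m + m')`. -/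
noncomputable def mulC (p q : ℕ × ℕ) : (H.pow p.2 Φ).obj p.1 →+ (H.pow q.2 Φ).obj q.1 →+
    (H.pow (p + q).2 Φ).obj (p + q).1 :=
  H.pair (F := Φ) (G := Φ) (K := Φ) (fun _ _ => M.mul) p.2 q.2 p.1 q.1

end Variant

/-- The map `γ : C(Φ)(0)^{⊗n₁} ⊗ Φ(1)^{⊗m₁} ⊗ Ẽ((m₁, n₁), (m₂, n₂)) → Cⁿ²(Φ)(m₂)`. -/
noncomputable def Extension.gamma {H : Variant A} (X : Extension H)
    {Φ : PreFunctor.{u, v} E.toDGCat} (M : MonStr (D := E.toMonDGCat) Φ) (p q : ℕ × ℕ) :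
    tensor (H.T Φ p) (X.cat.Hom p q) →+ (H.pow q.2 Φ).obj q.1 :=
  onTensor ((X.act Φ p q).comp (H.lam M p))

/-- The composition of `γ` with a family of maps `σ : Cⁿ(Φ)(m) → C(Φ)(0)^{⊗n} ⊗ Φ(1)^{⊗m}`. -/
noncomputable def Extension.gammaVia {H : Variant A} (X : Extension H)
    {Φ : PreFunctor.{u, v} E.toDGCat} (M : MonStr (D := E.toMonDGCat) Φ)
    (σ : ∀ p : ℕ × ℕ, (H.pow p.2 Φ).obj p.1 →+ H.T Φ p) (p q : ℕ × ℕ) :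
    H.T Φ p →+ X.cat.Hom p q →+ H.T Φ q :=
  ((X.act Φ p q).comp (H.lam M p)).compr₂ (σ q)

end Extensions

/-! ### Modules over a monoidal dg-category with objects `ℕ × ℕ` -/

section Modules

variable (D : MonDGCat.{u} (ℕ × ℕ)) (V W : PreComplex.{v})
  (act : ∀ p q : ℕ × ℕ, tpow V W p →+ D.Hom p q →+ tpow V W q)

/-- The data `(m, n) ↦ V^{⊗n} ⊗ W^{⊗m}`, with the action `act` of `D`. -/
noncomputable def tpowFunctor : PreFunctor.{u, v} D.toDGCat where
  obj := tpow V W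
  act {p q} := act p q

/-- The maps `act` make `(V, W)` a `D`-module: `(m, n) ↦ V^{⊗n} ⊗ W^{⊗m}` is a split monoidal
dg-functor, and it is through its monoidal structure that its value at `(m, n)` is the tensor
product of `n` copies of `V` and `m` copies of `W`. -/
structure IsModule : Prop where
  functor : (tpowFunctor D V W act).IsDGFunctor
  monoidal : ∃ S : MonStr (tpowFunctor D V W act), S.Split ∧ S.one = tone V W ∧
    (∀ (n : ℕ) (x : tpow V W (0, n)) (y : V),
      S.mul (a := (0, n)) (b := (0, 1)) x (inV V W y) = (tmk x y : tensor (vpow V n) V)) ∧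
    (∀ (m n : ℕ) (x : tpow V W (m, n)) (y : W),
      S.mul (a := (m, n)) (b := (1, 0)) x (inW V W y) = (tmk x y : tensor (vwpow V W n m) W))

/-- A `D`-module is `Σ`-equivariant if the functor `(m, n) ↦ V^{⊗n} ⊗ W^{⊗m}`, with the reordering
isomorphisms as monoidal structure, is symmetric monoidal. -/
def IsEquivariantModule (τ : Symmetry D) : Prop :=
  ∃ S : MonStr (tpowFunctor D V W act),
    (∀ p q (x : tpow V W p) (y : tpow V W q), S.mul (a := p) (b := q) x y = shuffle V W p q x y) ∧
    S.one = tone V W ∧ S.Split ∧ S.Symmetric τ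

/-- The maps `act` make `(V, W)` a homotopy `D`-module: they are chain maps which define a functor
up to homotopy, compatible up to homotopy with a monoidal structure as in `IsModule`. -/
structure IsHomotopyModule : Prop where
  chain : ∀ p q, IsChainMap (onTensor (act p q))
  act_one : ∀ p, Homotopic ((act p p).flip (D.one p)) (AddMonoidHom.id (tpow V W p))
  act_comp : ∀ p q r, Homotopic
    (onTensor (M := tensor (tpow V W p) (D.Hom p q)) (onTensor ((act p q).compr₂ (act q r))))
    (onTensor (M := tensor (tpow V W p) (D.Hom p q)) (onTensor
      (biadd (fun x f => (act p r x).comp (D.comp f))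
        (fun x x' f => by ext g; simp) (fun x f f' => by ext g; simp))))
  monoidal : ∃ mul : ∀ p q, tpow V W p →+ tpow V W q →+ tpow V W (p + q),
    (∀ p q, IsChainMap (onTensor (mul p q))) ∧
    (∀ n : ℕ, ∃ e : tensor (vpow V n) V →+ tensor (vpow V n) V,
      (∀ (x : tpow V W (0, n)) (y : V), e (tmk x y) = mul (0, n) (0, 1) x (inV V W y)) ∧
      Homotopic e (AddMonoidHom.id _)) ∧
    (∀ m n : ℕ, ∃ e : tensor (vwpow V W n m) W →+ tensor (vwpow V W n m) W,
      (∀ (x : tpow V W (m, n)) (y : W), e (tmk x y) = mul (m, n) (1, 0) x (inW V W y)) ∧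
      Homotopic e (AddMonoidHom.id _)) ∧
    (∀ p q p' q', ∃ e e' : tensor (tensor (tpow V W p) (D.Hom p q))
        (tensor (tpow V W p') (D.Hom p' q')) →+ tpow V W (q + q'),
      (∀ (x : tpow V W p) (f : D.Hom p q) (y : tpow V W p') (g : D.Hom p' q'),
        e (tmk (tmk x f) (tmk y g)) = mul q q' (act p q x f) (act p' q' y g)) ∧
      (∀ (i j : ℤ) (x : tpow V W p) (f : D.Hom p q) (y : tpow V W p') (g : D.Hom p' q'),
        f ∈ (D.Hom p q).deg i → y ∈ (tpow V W p').deg j →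
        e' (tmk (tmk x f) (tmk y g)) =
          sgn (i * j) • act (p + p') (q + q') (mul p p' x y) (D.tens f g)) ∧
      Homotopic e e')

/-- `P` is the permutation of the factors of `V^{⊗n} ⊗ W^{⊗m}` (with the Koszul sign) that exchanges
the blocks `b` and `c` of the object `a + (b + c) + e`. -/
def IsBlockSwap (a b c e : ℕ × ℕ) (P : tpow V W (a + (b + c) + e) →+ tpow V W (a + (c + b) + e)) :
    Prop :=
  ∀ (i j : ℤ) (s : tpow V W a) (x : tpow V W b) (y : tpow V W c) (t : tpow V W e),
    x ∈ (tpow V W b).deg i → y ∈ (tpow V W c).deg j →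
    P (shuffle V W _ _ (shuffle V W _ _ s (shuffle V W _ _ x y)) t) =
      sgn (i * j) • shuffle V W _ _ (shuffle V W _ _ s (shuffle V W _ _ y x)) t

variable {D} in
/-- The symmetry of `D` that exchanges the blocks `b` and `c` of `a + (b + c) + e`. -/
def blockSwap (τ : Symmetry D) (a b c e : ℕ × ℕ) : D.Hom (a + (b + c) + e) (a + (c + b) + e) :=
  D.tens (D.tens (D.one a) (τ.braid b c)) (D.one e)

/-- A homotopy `D`-module is `Σ`-equivariant if the maps `act` are compatible (not just up to
homotopy) with the reordering isomorphisms and the monoidal structure of `D`, and with the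
permutations of the factors and the symmetries of `D`, in the source and in the target. -/
structure IsEquivariantHomotopyModule (τ : Symmetry D) : Prop where
  mul : ∀ {p q p' q'} (i j : ℤ) (x : tpow V W p) (f : D.Hom p q) (y : tpow V W p')
    (g : D.Hom p' q'), f ∈ (D.Hom p q).deg i → y ∈ (tpow V W p').deg j →
    shuffle V W q q' (act p q x f) (act p' q' y g) =
      sgn (i * j) • act (p + p') (q + q') (shuffle V W p p' x y) (D.tens f g)
  source : ∀ {q} (a b c e : ℕ × ℕ) (P), IsBlockSwap V W a b c e P →
    ∀ (x : tpow V W (a + (b + c) + e)) (f : D.Hom (a + (c + b) + e) q),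
      act _ _ x (D.comp (blockSwap τ a b c e) f) = act _ _ (P x) f
  target : ∀ {p} (a b c e : ℕ × ℕ) (P), IsBlockSwap V W a b c e P →
    ∀ (x : tpow V W p) (f : D.Hom p (a + (b + c) + e)),
      act _ _ x (D.comp f (blockSwap τ a b c e)) = P (act _ _ x f)

end Modules

section Inverses

variable {E : DGProp.{u}} {A : AInfMult E} (H : Variant A)
  {Φ : PreFunctor.{u, v} E.toDGCat} (M : MonStr (D := E.toMonDGCat) Φ)
  (σ : ∀ p : ℕ × ℕ, (H.pow p.2 Φ).obj p.1 →+ H.T Φ p)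

/-- `σ` is a choice of `λ⁻¹` up to homotopy: chain maps inverse to `λ` up to chain homotopy. -/
structure IsHomotopyInverse : Prop where
  chain : ∀ p, IsChainMap (σ p)
  left : ∀ p, Homotopic ((σ p).comp (H.lam M p)) (AddMonoidHom.id (H.T Φ p))
  right : ∀ p, Homotopic ((H.lam M p).comp (σ p)) (AddMonoidHom.id ((H.pow p.2 Φ).obj p.1))

/-- The choice `σ` of `λ⁻¹` is symmetric monoidal: compatible with units and products, and
equivariant for the permutations. -/
structure IsSymMonInverse (X : Extension H) (τ : Symmetry X.cat) : Prop where
  one : σ 0 M.one = tone _ _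
  mul : ∀ p q (x : (H.pow p.2 Φ).obj p.1) (y : (H.pow q.2 Φ).obj q.1),
    σ (p + q) (H.mulC M p q x y) = shuffle _ _ p q (σ p x) (σ q y)
  swap : ∀ (a b c e : ℕ × ℕ) (P), IsBlockSwap ((H.op Φ).obj 0) (Φ.obj 1) a b c e P →
    ∀ x : (H.pow (a + (b + c) + e).2 Φ).obj (a + (b + c) + e).1,
      σ (a + (c + b) + e) (X.act Φ _ _ x (blockSwap τ a b c e)) = P (σ (a + (b + c) + e) x)

end Inverses

end HochschildAction

open HochschildAction

universe v₁ v₂ v₃ v₄ v₅ v₆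

namespace HochschildAction

/-! ### Signs -/

/-! Everything is reduced to the representable functors. Every element of Cⁿ(Φ)(m) is a sum of
elements x · z with x ∈ Φ(a) and z ∈ Cⁿ(E(a, -))(m) (`Extension.evFacts`), and such a z is the same
thing as a morphism (a, 0) ⟶ (m, n) of Ẽ. On these elements the action of f is x · z ↦ x · (z · f),
with composition taken in Ẽ (`Extension.act_ev`), and the product of x · z and y · w is ± (x y) · (z
⊗ w) (`Extension.pair_ev`). An identity between operations on the Cⁿ(Φ)(m) thereby splits into an
axiom of Ẽ and an axiom of Φ. Even d² = 0 is obtained in this way: for representable functors it is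
read off in the morphism complexes of Ẽ, and it passes to Φ along the pairing x, z ↦ x · z.

The outcome is that, for every monoidal Φ, the assignment (m, n) ↦ Cⁿ(Φ)(m) is a lax monoidal
dg-functor on Ẽ (`Extension.total_isDGFunctor`, `Extension.totalMon`), and a symmetric one if Φ and
the extension are symmetric (`Extension.totalMon_symmetric`). The map λ is the iterated
multiplication of this functor on its values at (0, 1) and (1, 0), and γ is λ followed by the
action.

If Φ is split, the products of the Cⁿ(Φ) are isomorphisms, because they are so on the coefficients
of each l (`IsProduct.pair_bijective`). Then λ is an isomorphism (`Extension.lam_bijective`), and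
the monoidal dg-functor is transported along it to the tensor powers. If λ has only an inverse σ up
to homotopy, each module axiom fails by insertions of λσ between two operations, and these are
homotopic to the identity (`Extension.isHomotopyModule`). Equivariance rests on the fact that λ
turns the reordering of tensor factors into the product (`Extension.lam_shuffle`).

The reduced variant needs one computation with the A_∞-operations: inserting a unit and then
applying the Hochschild differential gives degenerate elements again (`insert_hoch_mem`). After that
both variants obey the same rules (`Variant.lift_gen`, `Variant.d_gen`, `Variant.act_gen`), and a
single argument treats them together. -/

theorem sgn_zero : sgn 0 = 1 := by simp [sgn]

theorem sgn_add (a b : ℤ) : sgn (a + b) = sgn a * sgn b := by simp [sgn, Int.negOnePow_add]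

theorem sgn_congr {a b : ℤ} (h : Even (a - b)) : sgn a = sgn b := by
  have : a = (a - b) + b := by ring
  rw [this, sgn_add]
  simp [sgn, Int.negOnePow_even _ h]

theorem sgn_one : sgn 1 = -1 := by simp [sgn]

theorem sgn_smul_smul {M : Type*} [AddCommGroup M] (a b : ℤ) (x : M) :
    sgn a • sgn b • x = sgn (a + b) • x := by rw [smul_smul, sgn_add]

theorem sgn_smul_congr {M : Type*} [AddCommGroup M] {a b : ℤ} (x : M) (h : Even (a - b)) :
    sgn a • x = sgn b • x := by rw [sgn_congr h]

@[simp] theorem biadd_apply {M N P : Type*} [AddCommGroup M] [AddCommGroup N] [AddCommGroup P]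
    (f : M → N → P) (h₁ : ∀ x x' y, f (x + x') y = f x y + f x' y)
    (h₂ : ∀ x y y', f x (y + y') = f x y + f x y') (x : M) (y : N) :
    biadd f h₁ h₂ x y = f x y := rfl

@[simp] theorem tlift_tmul {M N P : Type*} [AddCommGroup M] [AddCommGroup N] [AddCommGroup P]
    (f : M →+ N →+ P) (x : M) (y : N) : tlift f (x ⊗ₜ[ℤ] y) = f x y := rfl

@[simp] theorem onTensor_tmk {M : PreComplex.{u}} {N : PreComplex.{v}} {P : Type w}
    [AddCommGroup P] (f : M →+ N →+ P) (x : M) (y : N) : onTensor f (tmk x y) = f x y := rfl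

/-! ### Graded groups -/

namespace PreComplex

/-- A group is the direct sum of subgroups if it is generated by them and there are projections. -/
theorem internal_of_proj (M : PreComplex.{u})
    (hgen : ∀ x : M, x ∈ AddSubgroup.closure {y : M | ∃ i, y ∈ M.deg i})
    (hproj : ∀ i, ∃ π : M →+ M, (∀ x ∈ M.deg i, π x = x) ∧ ∀ j, j ≠ i → ∀ x ∈ M.deg j, π x = 0) :
    DirectSum.IsInternal M.deg := by
  constructor
  · rw [injective_iff_map_eq_zero]
    intro z hz
    ext i
    obtain ⟨π, h1, h2⟩ := hproj i
    have key : ∀ z : ⨁ i, M.deg i, π (DirectSum.coeAddMonoidHom M.deg z) = (z i : M) := by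
      intro z
      induction z using DirectSum.induction_on with
      | zero => simp
      | of j x =>
        rw [DirectSum.coeAddMonoidHom_of]
        by_cases h : j = i
        · subst h
          rw [h1 _ x.2, DirectSum.of_eq_same]
        · rw [h2 j h _ x.2, DirectSum.of_eq_of_ne _ _ _ (Ne.symm h)]; rfl
      | add x y hx hy => simp [hx, hy]
    rw [← key, hz]; simp
  · intro x
    have := hgen x
    induction this using AddSubgroup.closure_induction with
    | mem x hx => obtain ⟨i, hi⟩ := hx; exact ⟨DirectSum.of (fun i => M.deg i) i ⟨x, hi⟩, by simp⟩
    | zero => exact ⟨0, map_zero _⟩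
    | add x y _ _ hx hy =>
      obtain ⟨a, rfl⟩ := hx; obtain ⟨b, rfl⟩ := hy; exact ⟨a + b, map_add _ _ _⟩
    | neg x _ hx => obtain ⟨a, rfl⟩ := hx; exact ⟨-a, map_neg _ _⟩

end PreComplex

section Internal

variable {M : PreComplex.{u}} (hM : DirectSum.IsInternal M.deg) {P : Type w} [AddCommGroup P]
include hM

theorem hom_induction {p : M → Prop} (x : M) (zero : p 0) (add : ∀ x y, p x → p y → p (x + y))
    (hom : ∀ i, ∀ x ∈ M.deg i, p x) : p x := by
  obtain ⟨z, rfl⟩ := hM.2 x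
  induction z using DirectSum.induction_on with
  | zero => simpa using zero
  | of j x => simpa using hom j _ x.2
  | add x y hx hy => rw [map_add]; exact add _ _ hx hy

/-- Signs and degree projections are formulas that depend on the degree of the argument. The direct
sum decomposition turns any such family into one additive map. -/
theorem exists_glue (T : ℤ → M →+ P) : ∃ e : M →+ P, ∀ i, ∀ x ∈ M.deg i, e x = T i x := by
  let φ : (⨁ i, M.deg i) ≃+ M := AddEquiv.ofBijective (DirectSum.coeAddMonoidHom M.deg) hM
  refine ⟨(DirectSum.toAddMonoid fun i => (T i).comp (M.deg i).subtype).comp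
    φ.symm.toAddMonoidHom, fun i x hx => ?_⟩
  have : φ.symm x = DirectSum.of (fun i => M.deg i) i ⟨x, hx⟩ := by
    rw [AddEquiv.symm_apply_eq]
    exact (DirectSum.coeAddMonoidHom_of M.deg i ⟨x, hx⟩).symm
  change DirectSum.toAddMonoid _ (φ.symm x) = _
  rw [this, DirectSum.toAddMonoid_of]; rfl

theorem hom_ext {f g : M →+ P} (h : ∀ i, ∀ x ∈ M.deg i, f x = g x) (x : M) : f x = g x := by
  refine hom_induction hM x (by simp) (fun x y hx hy => by simp [hx, hy]) h

/-- On a group that really is graded, the default value in the definition of `PreComplex.scale` is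
never taken. -/
theorem scale_apply (c : ℤ → ℤ) {i : ℤ} {x : M} (hx : x ∈ M.deg i) : M.scale c x = c i • x := by
  have h : ∃ e : M →+ M, ∀ (i : ℤ) (x : M), x ∈ M.deg i → e x = c i • x := by
    obtain ⟨e, he⟩ := exists_glue hM (fun i => c i • AddMonoidHom.id M)
    exact ⟨e, fun i x hx => by simpa using he i x hx⟩
  rw [PreComplex.scale, dif_pos h]
  exact h.choose_spec i x hx

theorem koszul_apply (n : ℤ) {i : ℤ} {x : M} (hx : x ∈ M.deg i) :
    M.koszul n x = sgn (n * i) • x := scale_apply hM _ hx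

theorem scale_deg (c : ℤ → ℤ) {i : ℤ} {x : M} (hx : x ∈ M.deg i) : M.scale c x ∈ M.deg i := by
  rw [scale_apply hM c hx]; exact AddSubgroup.zsmul_mem _ hx _

theorem koszul_deg (n : ℤ) {i : ℤ} {x : M} (hx : x ∈ M.deg i) : M.koszul n x ∈ M.deg i :=
  scale_deg hM _ hx

theorem koszul_koszul (m n : ℤ) (x : M) : M.koszul m (M.koszul n x) = M.koszul (m + n) x := by
  refine hom_ext hM (f := (M.koszul m).comp (M.koszul n)) (g := M.koszul (m + n)) ?_ x
  intro i x hx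
  rw [AddMonoidHom.comp_apply, koszul_apply hM n hx, map_zsmul, koszul_apply hM m hx,
    koszul_apply hM _ hx, sgn_smul_smul]
  congr 2; ring

theorem koszul_even {n : ℤ} (hn : Even n) (x : M) : M.koszul n x = x := by
  refine hom_ext hM (f := M.koszul n) (g := AddMonoidHom.id M) ?_ x
  intro i x hx
  rw [koszul_apply hM _ hx, ← one_smul ℤ x, ← sgn_zero, AddMonoidHom.id_apply, smul_smul,
    ← sgn_add, sgn_congr (b := 0)]
  obtain ⟨k, rfl⟩ := hn
  exact ⟨k * i, by ring⟩

theorem koszul_congr {m n : ℤ} (h : Even (m - n)) (x : M) : M.koszul m x = M.koszul n x := by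
  have : m = n + (m - n) := by ring
  rw [this, ← koszul_koszul hM, koszul_even hM h]

/-- The Koszul rule for an operator f of degree j: moving it past something of degree n costs
(-1)^(n j). It is applied to the differential. -/
theorem map_koszul_of_deg {N : PreComplex.{v}} (hN : DirectSum.IsInternal N.deg) {f : M →+ N}
    {j : ℤ} (hf : ∀ i, ∀ x ∈ M.deg i, f x ∈ N.deg (i + j)) (n : ℤ) (x : M) :
    N.koszul n (f x) = sgn (n * j) • f (M.koszul n x) := by
  refine hom_ext hM (g := (sgn (n * j)) • f.comp (M.koszul n)) (f := (N.koszul n).comp f) ?_ x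
  intro i x hx
  simp only [AddMonoidHom.comp_apply, AddMonoidHom.smul_apply, koszul_apply hM n hx,
    koszul_apply hN n (hf i x hx), map_zsmul, sgn_smul_smul]
  congr 2; ring

theorem map_koszul_bi {N : PreComplex.{v}} (hN : DirectSum.IsInternal N.deg) {Q : PreComplex.{w}}
    (hQ : DirectSum.IsInternal Q.deg) {B : M →+ N →+ Q}
    (hB : ∀ i j, ∀ x ∈ M.deg i, ∀ y ∈ N.deg j, B x y ∈ Q.deg (i + j)) (n : ℤ) (x : M) (y : N) :
    Q.koszul n (B x y) = B (M.koszul n x) (N.koszul n y) := by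
  refine hom_ext hM (f := (Q.koszul n).comp (B.flip y))
    (g := (B.flip (N.koszul n y)).comp (M.koszul n)) (fun i x hx => ?_) x
  refine hom_ext hN (f := (Q.koszul n).comp (B x))
    (g := (B (M.koszul n x)).comp (N.koszul n)) (fun j y hy => ?_) y
  simp only [AddMonoidHom.comp_apply, koszul_apply hM n hx, koszul_apply hN n hy,
    koszul_apply hQ n (hB i j x hx y hy), map_zsmul, AddMonoidHom.smul_apply, sgn_smul_smul]
  congr 2; ring

end Internal

namespace PreComplex.IsComplex

variable {M : PreComplex.{u}} (hM : M.IsComplex)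
include hM

theorem koszul_d (n : ℤ) (x : M) : M.koszul n (M.d x) = sgn n • M.d (M.koszul n x) := by
  have := map_koszul_of_deg hM.internal hM.internal (f := M.d) (j := -1) (fun i x hx => by
    simpa [sub_eq_add_neg] using hM.d_deg i x hx) n x
  rw [this]
  exact sgn_smul_congr _ ⟨-n, by ring⟩

end PreComplex.IsComplex

/-! ### Pairings and tensor products of complexes -/

/-- `B` corresponds to a chain map `M ⊗ N → P`. -/
structure IsPairing {M : PreComplex.{u}} {N : PreComplex.{v}} {P : PreComplex.{w}}
    (B : M →+ N →+ P) : Prop where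
  deg : ∀ i j x y, x ∈ M.deg i → y ∈ N.deg j → B x y ∈ P.deg (i + j)
  d : ∀ i x y, x ∈ M.deg i → P.d (B x y) = B (M.d x) y + sgn i • B x (N.d y)

theorem tensor_induction {M : PreComplex.{u}} {N : PreComplex.{v}} {p : tensor M N → Prop}
    (z : tensor M N) (tmul : ∀ x y, p (tmk x y)) (add : ∀ x y, p x → p y → p (x + y)) : p z := by
  refine TensorProduct.induction_on (R := ℤ) (M := M) (N := N) (motive := p) z ?_ tmul add
  have := tmul 0 0
  rwa [show (tmk (0 : M) (0 : N)) = 0 from TensorProduct.zero_tmul _ _] at this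

theorem tensor_hom_ext {M : PreComplex.{u}} {N : PreComplex.{v}} {P : Type w} [AddCommGroup P]
    {f g : tensor M N →+ P} (h : ∀ x y, f (tmk x y) = g (tmk x y)) : f = g := by
  ext z
  refine tensor_induction (p := fun z => f z = g z) z h fun x y hx hy => ?_
  rw [map_add, map_add, hx, hy]

theorem tmk_zsmul_left {M : PreComplex.{u}} {N : PreComplex.{v}} (n : ℤ) (x : M) (y : N) :
    tmk (n • x) y = n • tmk x y := rfl

theorem tmk_zsmul_right {M : PreComplex.{u}} {N : PreComplex.{v}} (n : ℤ) (x : M) (y : N) :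
    tmk x (n • y) = n • tmk x y := TensorProduct.tmul_smul n x y

theorem tmk_zero_left {M : PreComplex.{u}} {N : PreComplex.{v}} (y : N) :
    tmk (0 : M) y = 0 := TensorProduct.zero_tmul _ _

theorem tmk_zero_right {M : PreComplex.{u}} {N : PreComplex.{v}} (x : M) :
    tmk x (0 : N) = 0 := TensorProduct.tmul_zero _ _

/-- `x ↦ y ↦ x ⊗ y`. -/
noncomputable def tmkHom (M : PreComplex.{u}) (N : PreComplex.{v}) : M →+ N →+ tensor M N :=
  biadd tmk tmk_add_left tmk_add_right

@[simp] theorem tmkHom_apply {M : PreComplex.{u}} {N : PreComplex.{v}} (x : M) (y : N) :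
    tmkHom M N x y = tmk x y := rfl

theorem tmk_deg {M : PreComplex.{u}} {N : PreComplex.{v}} {i j : ℤ} {x : M} {y : N}
    (hx : x ∈ M.deg i) (hy : y ∈ N.deg j) : tmk x y ∈ (tensor M N).deg (i + j) :=
  AddSubgroup.subset_closure ⟨i, j, x, y, hx, hy, rfl, rfl⟩

theorem tensor_d {M : PreComplex.{u}} {N : PreComplex.{v}} (x : M) (y : N) :
    (tensor M N).d (tmk x y) = tmk (M.d x) y + tmk (M.koszul 1 x) (N.d y) := rfl

theorem tensor_d_of_deg {M : PreComplex.{u}} {N : PreComplex.{v}}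
    (hM : DirectSum.IsInternal M.deg) {i : ℤ} {x : M} (hx : x ∈ M.deg i) (y : N) :
    (tensor M N).d (tmk x y) = tmk (M.d x) y + sgn i • tmk x (N.d y) := by
  rw [tensor_d, koszul_apply hM 1 hx, one_mul, tmk_zsmul_left]

theorem tmkHom_isPairing {M : PreComplex.{u}} {N : PreComplex.{v}} (hM : M.IsComplex) :
    IsPairing (tmkHom M N) where
  deg _ _ _ _ hx hy := tmk_deg hx hy
  d _ _ y hx := tensor_d_of_deg hM.internal hx y

theorem tensor_hom_induction {M : PreComplex.{u}} {N : PreComplex.{v}} (hM : M.IsComplex)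
    (hN : N.IsComplex) {p : tensor M N → Prop} (z : tensor M N)
    (tmul : ∀ i j x y, x ∈ M.deg i → y ∈ N.deg j → p (tmk x y))
    (add : ∀ x y, p x → p y → p (x + y)) : p z := by
  have h0 : p 0 := by
    have := tmul 0 0 0 0 (zero_mem _) (zero_mem _)
    rwa [tmk_zero_left] at this
  refine tensor_induction z (fun x y => ?_) add
  refine hom_induction hM.internal (p := fun x => p (tmk x y)) x (by rwa [tmk_zero_left])
    (fun x x' hx hx' => by rw [tmk_add_left]; exact add _ _ hx hx') fun i x hx => ?_
  refine hom_induction hN.internal (p := fun y => p (tmk x y)) y (by rwa [tmk_zero_right])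
    (fun x x' hx hx' => by rw [tmk_add_right]; exact add _ _ hx hx') fun j y hy => ?_
  exact tmul i j x y hx hy

theorem tensor_hom_ext_of_deg {M : PreComplex.{u}} {N : PreComplex.{v}} (hM : M.IsComplex)
    (hN : N.IsComplex) {P : Type w} [AddCommGroup P] {f g : tensor M N →+ P}
    (h : ∀ i j x y, x ∈ M.deg i → y ∈ N.deg j → f (tmk x y) = g (tmk x y)) (z) : f z = g z := by
  refine tensor_hom_induction hM hN (p := fun z => f z = g z) z h fun x y hx hy => ?_
  rw [map_add, map_add, hx, hy]

theorem tensor_deg_le {M : PreComplex.{u}} {N : PreComplex.{v}} {n : ℤ}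
    (S : AddSubgroup (tensor M N))
    (h : ∀ i j x y, x ∈ M.deg i → y ∈ N.deg j → i + j = n → tmk x y ∈ S) :
    (tensor M N).deg n ≤ S := by
  refine (AddSubgroup.closure_le S).2 ?_
  rintro _ ⟨i, j, x, y, hx, hy, hij, rfl⟩
  exact h i j x y hx hy hij

theorem tensor_isComplex {M : PreComplex.{u}} {N : PreComplex.{v}} (hM : M.IsComplex)
    (hN : N.IsComplex) : (tensor M N).IsComplex where
  internal := by
    apply PreComplex.internal_of_proj
    · intro z
      refine tensor_hom_induction hM hN z (fun i j x y hx hy => ?_) fun x y hx hy => add_mem hx hy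
      exact AddSubgroup.subset_closure ⟨_, tmk_deg hx hy⟩
    · intro n
      -- The projection onto total degree n keeps, for x of degree i, only the part of y of degree n
      -- - i. These maps are glued over i.
      let pr (j : ℤ) : N →+ N := N.scale (fun k => if k = j then 1 else 0)
      obtain ⟨e, he⟩ := exists_glue hM.internal (P := N →+ tensor M N) fun i =>
        ((tmkHom M N).compl₂ (pr (n - i)))
      have key : ∀ i j x y, x ∈ M.deg i → y ∈ N.deg j →
          onTensor e (tmk x y) = if i + j = n then tmk x y else 0 := by
        intro i j x y hx hy
        have h1 : pr (n - i) y = (if j = n - i then (1 : ℤ) else 0) • y :=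
          scale_apply hN.internal _ hy
        rw [onTensor_tmk, he i x hx]
        change tmk x (pr (n - i) y) = _
        rw [h1, tmk_zsmul_right]
        by_cases h : i + j = n
        · rw [if_pos h, if_pos (by omega), one_smul]
        · rw [if_neg h, if_neg (by omega), zero_smul]
      refine ⟨onTensor e, fun x hx => ?_, fun j hj x hx => ?_⟩
      · exact tensor_deg_le ((onTensor e).eqLocus (AddMonoidHom.id _))
          (fun i j x y hx hy h => (key i j x y hx hy).trans (if_pos h)) hx
      · exact tensor_deg_le (onTensor e).ker
          (fun i k x y hx hy h => (key i k x y hx hy).trans (if_neg (by omega))) hx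
  d_deg n z hz := by
    refine tensor_deg_le (((tensor M N).deg (n - 1)).comap (tensor M N).d) ?_ hz
    rintro i k x y hx hy rfl
    rw [AddSubgroup.mem_comap, tensor_d]
    refine add_mem ?_ ?_
    · have := tmk_deg (hM.d_deg _ _ hx) hy
      rwa [show i - 1 + k = i + k - 1 by ring] at this
    · have := tmk_deg (koszul_deg hM.internal 1 hx) (hN.d_deg _ _ hy)
      rwa [show i + (k - 1) = i + k - 1 by ring] at this
  d_d z := by
    refine tensor_induction (p := fun z => (tensor M N).d ((tensor M N).d z) = 0) z
      (fun x y => ?_) fun x y hx hy => by rw [map_add, map_add, hx, hy, add_zero]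
    rw [tensor_d, map_add, tensor_d, tensor_d, hM.d_d, hN.d_d, hM.koszul_d, tmk_zero_left,
      tmk_zero_right, sgn_one, tmk_zsmul_left]
    simp

theorem unitComplex_isComplex : unitComplex.{v}.IsComplex where
  internal := by
    apply PreComplex.internal_of_proj
    · intro x
      refine AddSubgroup.subset_closure ⟨0, ?_⟩
      exact (show x ∈ (if (0 : ℤ) = 0 then ⊤ else ⊥ : AddSubgroup (ULift.{v} ℤ)) by rw [if_pos rfl]; trivial)
    · intro i
      by_cases hi : i = 0
      · refine ⟨AddMonoidHom.id _, fun _ _ => rfl, fun j hj x hx => ?_⟩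
        have hx : x ∈ (if j = 0 then ⊤ else ⊥ : AddSubgroup (ULift.{v} ℤ)) := hx
        rw [if_neg (by omega)] at hx
        exact hx
      · refine ⟨0, fun x hx => ?_, fun _ _ _ _ => rfl⟩
        have hx : x ∈ (if i = 0 then ⊤ else ⊥ : AddSubgroup (ULift.{v} ℤ)) := hx
        rw [if_neg hi] at hx
        exact (show x = 0 from hx).symm
  d_deg _ _ _ := zero_mem _
  d_d _ := rfl

theorem IsPairing.isChainMap {M : PreComplex.{u}} {N : PreComplex.{v}} {P : PreComplex.{w}}
    {B : M →+ N →+ P} (h : IsPairing B) (hM : M.IsComplex) : IsChainMap (onTensor B) where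
  map_deg i z hz := by
    refine tensor_deg_le ((P.deg i).comap (onTensor B)) ?_ hz
    rintro i j x y hx hy rfl
    exact h.deg i j x y hx hy
  map_d z := by
    refine tensor_induction (p := fun z => onTensor B ((tensor M N).d z) = P.d (onTensor B z)) z
      (fun x y => ?_) fun x y hx hy => by rw [map_add, map_add, hx, hy, map_add, map_add]
    refine hom_ext hM.internal (f := ((onTensor B).comp (tensor M N).d).comp ((tmkHom M N).flip y))
      (g := (P.d.comp (onTensor B)).comp ((tmkHom M N).flip y)) (fun i x hx => ?_) x
    simp only [AddMonoidHom.comp_apply, AddMonoidHom.flip_apply, tmkHom_apply, onTensor_tmk]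
    rw [tensor_d_of_deg hM.internal hx, h.d i x y hx, map_add, map_zsmul]
    rfl

/-- The differential of a pairing, without homogeneity. -/
theorem IsPairing.d' {M : PreComplex.{u}} {N : PreComplex.{v}} {P : PreComplex.{w}}
    {B : M →+ N →+ P} (h : IsPairing B) (hM : DirectSum.IsInternal M.deg) (x : M) (y : N) :
    P.d (B x y) = B (M.d x) y + B (M.koszul 1 x) (N.d y) := by
  refine hom_ext hM (f := P.d.comp (B.flip y))
    (g := (B.flip y).comp M.d + (B.flip (N.d y)).comp (M.koszul 1)) (fun i x hx => ?_) x
  simp [koszul_apply hM 1 hx, h.d i x y hx]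

theorem IsPairing.koszul {M : PreComplex.{u}} {N : PreComplex.{v}} {P : PreComplex.{w}}
    {B : M →+ N →+ P} (h : IsPairing B) (hM : M.IsComplex) (hN : N.IsComplex) (hP : P.IsComplex)
    (n : ℤ) (x : M) (y : N) : P.koszul n (B x y) = B (M.koszul n x) (N.koszul n y) :=
  map_koszul_bi hM.internal hN.internal hP.internal (fun i j x hx y hy => h.deg i j x y hx hy) n x y

end HochschildAction
namespace HochschildAction

/-! ### Identities between objects that are equal -/

namespace DGCat

variable {O : Type} (D : DGCat.{u} O)

@[simp] theorem eqId_self (a : O) : D.eqId a a = D.one a := by simp [eqId]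

theorem eqId_comp_eqId {a b : O} (h : a = b) (c : O) :
    D.comp (D.eqId a b) (D.eqId b c) = D.eqId a c := by
  subst h; rw [eqId_self, D.one_comp]

theorem eqId_deg (a b : O) : D.eqId a b ∈ (D.Hom a b).deg 0 := by
  by_cases h : a = b
  · subst h; rw [eqId_self]; exact D.one_deg a
  · rw [eqId, dif_neg h]; exact zero_mem _

/-- The Leibniz rule for 1 · 1 = 1 reads d 1 = d 1 + d 1. -/
theorem one_d (a : O) : (D.Hom a a).d (D.one a) = 0 := by
  have := D.comp_d 0 (D.one a) (D.one a) (D.one_deg a)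
  rw [D.one_comp, D.comp_one, D.one_comp, sgn_zero, one_smul] at this
  simpa using this

theorem eqId_d (a b : O) : (D.Hom a b).d (D.eqId a b) = 0 := by
  by_cases h : a = b
  · subst h; rw [eqId_self]; exact D.one_d a
  · rw [eqId, dif_neg h, map_zero]

end DGCat

namespace MonDGCat

variable {O : Type} [AddMonoid O] (D : MonDGCat.{u} O)

/-- Only g and f' are exchanged, so if g has degree 0 there is no sign. The equation is then
additive in f' and holds without homogeneity. -/
theorem interchange_left {a b c a' b' c' : O} (f : D.Hom a b) {g : D.Hom b c} (f' : D.Hom a' b')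
    (g' : D.Hom b' c') (hg : g ∈ (D.Hom b c).deg 0) :
    D.comp (D.tens f f') (D.tens g g') = D.tens (D.comp f g) (D.comp f' g') := by
  refine hom_ext (D.isComplex a' b').internal
    (f := (D.comp.flip (D.tens g g')).comp (D.tens f))
    (g := (D.tens (D.comp f g)).comp (D.comp.flip g')) (fun j f' hf' => ?_) f'
  simpa [sgn_zero] using D.interchange 0 j f g f' g' hg hf'

theorem interchange_right {a b c a' b' c' : O} (f : D.Hom a b) (g : D.Hom b c) {f' : D.Hom a' b'}
    (g' : D.Hom b' c') (hf : f' ∈ (D.Hom a' b').deg 0) :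
    D.comp (D.tens f f') (D.tens g g') = D.tens (D.comp f g) (D.comp f' g') := by
  refine hom_ext (D.isComplex b c).internal
    (f := (D.comp (D.tens f f')).comp (D.tens.flip g'))
    (g := (D.tens.flip (D.comp f' g')).comp (D.comp f)) (fun j g hg => ?_) g
  simpa [sgn_zero] using D.interchange j 0 f g f' g' hg hf

end MonDGCat

theorem Symmetry.naturality_zero {O : Type} [AddMonoid O] {D : MonDGCat.{u} O} (τ : Symmetry D)
    {a a' b b' : O} (f : D.Hom a a') {g : D.Hom b b'} (hg : g ∈ (D.Hom b b').deg 0) :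
    D.comp (D.tens f g) (τ.braid a' b') = D.comp (τ.braid a b) (D.tens g f) := by
  refine hom_ext (D.isComplex a a').internal
    (f := (D.comp.flip (τ.braid a' b')).comp (D.tens.flip g))
    (g := (D.comp (τ.braid a b)).comp (D.tens g)) (fun i f hf => ?_) f
  simpa [sgn_zero] using τ.naturality i 0 f g hf hg

theorem Symmetry.naturality_zero_left {O : Type} [AddMonoid O] {D : MonDGCat.{u} O}
    (τ : Symmetry D) {a a' b b' : O} {f : D.Hom a a'} (g : D.Hom b b')
    (hf : f ∈ (D.Hom a a').deg 0) :
    D.comp (D.tens f g) (τ.braid a' b') = D.comp (τ.braid a b) (D.tens g f) := by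
  refine hom_ext (D.isComplex b b').internal
    (f := (D.comp.flip (τ.braid a' b')).comp (D.tens f))
    (g := (D.comp (τ.braid a b)).comp (D.tens.flip f)) (fun i g hg => ?_) g
  simpa [sgn_zero] using τ.naturality 0 i f g hf hg

/-! ### Morphisms without fixed source and target -/

/-- A morphism of `D`, with its source and target. -/
structure Arr {O : Type} (D : DGCat.{u} O) where
  src : O
  tgt : O
  hom : D.Hom src tgt

namespace Arr

section

variable {O : Type} {D : DGCat.{u} O}

/-- A morphism, as an element of `Arr D`. -/
def of {a b : O} (f : D.Hom a b) : Arr D := ⟨a, b, f⟩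

@[simp] theorem of_src {a b : O} (f : D.Hom a b) : (of f).src = a := rfl
@[simp] theorem of_tgt {a b : O} (f : D.Hom a b) : (of f).tgt = b := rfl

theorem of_injective {a b : O} {f g : D.Hom a b} (h : of f = of g) : f = g := by
  unfold of at h; simpa using h

/-- The strictness laws of a monoidal dg-category are stated with `eqId` on both sides. In `Arr`
they become genuine equalities. -/
theorem of_eq_of {a b a' b' : O} {f : D.Hom a b} {f' : D.Hom a' b'} (ha : a = a') (hb : b = b')
    (h : D.comp f (D.eqId b b') = D.comp (D.eqId a a') f') : of f = of f' := by
  subst ha hb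
  rw [DGCat.eqId_self, DGCat.eqId_self, D.one_comp, D.comp_one] at h
  rw [h]

/-- Composition, with the identification of the target of `F` with the source of `G` left out. -/
noncomputable def cmp (F G : Arr D) : Arr D :=
  ⟨F.src, G.tgt, D.comp (D.comp F.hom (D.eqId F.tgt G.src)) G.hom⟩

@[simp] theorem cmp_src (F G : Arr D) : (F.cmp G).src = F.src := rfl
@[simp] theorem cmp_tgt (F G : Arr D) : (F.cmp G).tgt = G.tgt := rfl

theorem of_comp {a b c : O} (f : D.Hom a b) (g : D.Hom b c) :
    of (D.comp f g) = (of f).cmp (of g) := by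
  change (⟨a, c, D.comp f g⟩ : Arr D) = ⟨a, c, D.comp (D.comp f (D.eqId b b)) g⟩
  rw [DGCat.eqId_self, D.comp_one]

theorem cmp_assoc (F G H : Arr D) : (F.cmp G).cmp H = F.cmp (G.cmp H) := by
  obtain ⟨a, b, f⟩ := F; obtain ⟨b', c, g⟩ := G; obtain ⟨c', e, h⟩ := H
  change (⟨a, e, D.comp (D.comp (D.comp (D.comp f (D.eqId b b')) g) (D.eqId c c')) h⟩ : Arr D) =
    ⟨a, e, D.comp (D.comp f (D.eqId b b')) (D.comp (D.comp g (D.eqId c c')) h)⟩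
  simp only [D.comp_assoc]

/-- The identity of `a`. -/
def I (D : DGCat.{u} O) (a : O) : Arr D := of (D.one a)

@[simp] theorem I_src (a : O) : (I D a).src = a := rfl
@[simp] theorem I_tgt (a : O) : (I D a).tgt = a := rfl

theorem of_one (a : O) : of (D.one a) = I D a := rfl

theorem of_eqId {a b : O} (h : a = b) : of (D.eqId a b) = I D a := by
  subst h; rw [DGCat.eqId_self]; rfl

theorem I_cmp {a : O} {F : Arr D} (h : F.src = a) : (I D a).cmp F = F := by
  subst h
  obtain ⟨a, b, f⟩ := F
  exact (of_comp (D.one a) f).symm.trans (by rw [D.one_comp]; rfl)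

theorem cmp_I {a : O} {F : Arr D} (h : F.tgt = a) : F.cmp (I D a) = F := by
  subst h
  obtain ⟨a, b, f⟩ := F
  exact (of_comp f (D.one b)).symm.trans (by rw [D.comp_one]; rfl)

/-- `F` is homogeneous of degree `0`. -/
def Zero (F : Arr D) : Prop := F.hom ∈ (D.Hom F.src F.tgt).deg 0

theorem zero_I (a : O) : (I D a).Zero := D.one_deg a

/-- The way back from `Arr`: a factorization found there, where objects agree only up to arithmetic,
is one between the actual morphism groups. -/
theorem exists_comp {a b c : O} {f : D.Hom a c} {g : D.Hom b c} {H : Arr D} (hs : H.src = a)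
    (ht : H.tgt = b) (h : of f = H.cmp (of g)) : ∃ k : D.Hom a b, f = D.comp k g := by
  obtain ⟨s, t, k⟩ := H
  dsimp at hs ht
  subst hs ht
  exact ⟨k, of_injective (h.trans (of_comp k g).symm)⟩

end

section Mon

variable {O : Type} [AddMonoid O] {D : MonDGCat.{u} O}

/-- The tensor product of morphisms is strictly associative and unital once sources and targets are
part of the element. Rebracketing a tensor product of morphisms is then `mul_assoc`, without any
transport along equalities of objects. -/
noncomputable instance : Monoid (Arr D.toDGCat) where
  one := I D.toDGCat 0
  mul F G := ⟨F.src + G.src, F.tgt + G.tgt, D.tens F.hom G.hom⟩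
  mul_assoc F G H := of_eq_of (add_assoc _ _ _) (add_assoc _ _ _) (D.tens_assoc _ _ _)
  one_mul F := of_eq_of (zero_add _) (zero_add _) (D.zero_tens F.hom)
  mul_one F := of_eq_of (add_zero _) (add_zero _) (D.tens_zero F.hom)

@[simp] theorem mul_src (F G : Arr D.toDGCat) : (F * G).src = F.src + G.src := rfl
@[simp] theorem mul_tgt (F G : Arr D.toDGCat) : (F * G).tgt = F.tgt + G.tgt := rfl

theorem of_tens {a b c e : O} (f : D.Hom a b) (g : D.Hom c e) :
    of (D.tens f g) = of f * of g := rfl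

theorem I_zero : I D.toDGCat 0 = 1 := rfl

theorem I_add (a b : O) : I D.toDGCat (a + b) = I D.toDGCat a * I D.toDGCat b := by
  rw [← of_one, ← of_one, ← of_one, ← of_tens, D.tens_one]

theorem Zero.mul {F G : Arr D.toDGCat} (hF : F.Zero) (hG : G.Zero) : (F * G).Zero :=
  D.tens_deg 0 0 _ _ hF hG

theorem mul_cmp_mul {F G F' G' : Arr D.toDGCat} (h : F.tgt = G.src) (h' : F'.tgt = G'.src)
    (hG : G.Zero) : (F * F').cmp (G * G') = F.cmp G * F'.cmp G' := by
  obtain ⟨a, b, f⟩ := F; obtain ⟨b₁, c, g⟩ := G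
  obtain ⟨a', b', f'⟩ := F'; obtain ⟨b₁', c', g'⟩ := G'
  dsimp at h h'
  subst h h'
  change (of f * of f').cmp (of g * of g') = (of f).cmp (of g) * (of f').cmp (of g')
  rw [← of_tens, ← of_tens, ← of_comp, ← of_comp, ← of_comp, ← of_tens,
    D.interchange_left f f' g' hG]

theorem mul_cmp_mul' {F G F' G' : Arr D.toDGCat} (h : F.tgt = G.src) (h' : F'.tgt = G'.src)
    (hF : F'.Zero) : (F * F').cmp (G * G') = F.cmp G * F'.cmp G' := by
  obtain ⟨a, b, f⟩ := F; obtain ⟨b₁, c, g⟩ := G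
  obtain ⟨a', b', f'⟩ := F'; obtain ⟨b₁', c', g'⟩ := G'
  dsimp at h h'
  subst h h'
  change (of f * of f').cmp (of g * of g') = (of f).cmp (of g) * (of f').cmp (of g')
  rw [← of_tens, ← of_tens, ← of_comp, ← of_comp, ← of_comp, ← of_tens,
    D.interchange_right f g g' hF]

theorem mul_cmp_braid (τ : Symmetry D) {F G : Arr D.toDGCat} {a b : O} (ha : F.tgt = a)
    (hb : G.tgt = b) (h : F.Zero ∨ G.Zero) :
    (F * G).cmp (of (τ.braid a b)) = (of (τ.braid F.src G.src)).cmp (G * F) := by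
  obtain ⟨a, a', f⟩ := F; obtain ⟨b, b', g⟩ := G
  dsimp at ha hb
  subst ha hb
  change (of f * of g).cmp (of (τ.braid a' b')) = (of (τ.braid a b)).cmp (of g * of f)
  rw [← of_tens, ← of_tens, ← of_comp, ← of_comp]
  rcases h with h | h
  · rw [τ.naturality_zero_left g h]
  · rw [τ.naturality_zero f h]

end Mon

end Arr

/-! ### The symmetry and the unit object -/

/-- The hexagon for (a, 0, 0) shows that the symmetry of a and 0 is idempotent. Being invertible, it
is the identity. -/
theorem Symmetry.of_braid_zero_right {O : Type} [AddMonoid O] {D : MonDGCat.{u} O}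
    (τ : Symmetry D) (a : O) : Arr.of (τ.braid a 0) = Arr.I D.toDGCat a := by
  have h := congrArg Arr.of (τ.hexagon a 0 0)
  simp only [Arr.of_comp, Arr.of_tens, Arr.of_one] at h
  rw [Arr.of_eqId (by simp), Arr.of_eqId (by simp),
    Arr.of_eqId (by simp), Arr.I_zero, mul_one, one_mul] at h
  rw [Arr.I_cmp (by simp), Arr.cmp_I (by simp), Arr.cmp_I (by simp)] at h
  have h0 : Arr.of (τ.braid a (0 + 0)) = Arr.of (τ.braid a 0) := by rw [zero_add]
  rw [h0] at h
  have h1 := congrArg (fun F => F.cmp (Arr.of (τ.braid 0 a))) h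
  simp only [Arr.cmp_assoc] at h1
  rw [← Arr.of_comp, τ.braid_braid, Arr.of_one, Arr.cmp_I (by simp)] at h1
  rw [← h1]
  simp

theorem Symmetry.of_braid_zero_left {O : Type} [AddMonoid O] {D : MonDGCat.{u} O}
    (τ : Symmetry D) (a : O) : Arr.of (τ.braid 0 a) = Arr.I D.toDGCat a := by
  have h := congrArg Arr.of (τ.braid_braid 0 a)
  rw [Arr.of_comp, τ.of_braid_zero_right, Arr.cmp_I (by simp), Arr.of_one] at h
  rw [h, zero_add]

/-! ### Units and the differential of the Hochschild complex -/

section Unit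

open Arr

variable {E : DGProp.{u}}

theorem of_ins (a : ℕ) {x y : ℕ} (f : E.Hom x y) (c : ℕ) :
    of (E.ins a f c) = I E.toDGCat a * of f * I E.toDGCat c := rfl

/-- Operations on disjoint inputs commute, without sign because the unit has degree 0. The block of
f starts one place later when the unit has been inserted first. -/
theorem unit_before (U : E.Hom 0 1) (hU : U ∈ (E.Hom 0 1).deg 0) {r : ℕ} (f : E.Hom r 1)
    (p s c : ℕ) :
    (I E.toDGCat p * of U * I E.toDGCat (s + r + c)).cmp
        (I E.toDGCat (p + 1 + s) * of f * I E.toDGCat c) =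
      (I E.toDGCat (p + s) * of f * I E.toDGCat c).cmp
        (I E.toDGCat p * of U * I E.toDGCat (s + 1 + c)) := by
  have e1 : I E.toDGCat (p + 1 + s) * of f * I E.toDGCat c =
      I E.toDGCat p * (I E.toDGCat 1 * (I E.toDGCat s * of f * I E.toDGCat c)) := by
    simp only [I_add, mul_assoc]
  -- The factor `I 0` is the empty source of the unit. It makes the blocks of the two factors match,
  -- so that the interchange law applies block by block.
  have e2 : I E.toDGCat (p + s) * of f * I E.toDGCat c =
      I E.toDGCat p * (I E.toDGCat 0 * (I E.toDGCat s * of f * I E.toDGCat c)) := by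
    simp only [I_add, mul_assoc, I_zero, one_mul]
  have z := zero_I (D := E.toDGCat)
  have zU : (of U).Zero := hU
  rw [e1, e2, mul_assoc, mul_assoc (I _ p),
    mul_cmp_mul (by simp) (by simp) (z p),
    mul_cmp_mul (by simp) (by simp) (z 1), mul_cmp_mul (by simp) (by simp) (z p),
    mul_cmp_mul (by simp) (by simp) zU, cmp_I (by simp), cmp_I (by simp), I_cmp (by simp),
    I_cmp (by simp), cmp_I (by simp)]

theorem unit_after (U : E.Hom 0 1) (hU : U ∈ (E.Hom 0 1).deg 0) {r : ℕ} (f : E.Hom r 1)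
    (a s q : ℕ) :
    (I E.toDGCat (a + r + s) * of U * I E.toDGCat q).cmp
        (I E.toDGCat a * of f * I E.toDGCat (s + 1 + q)) =
      (I E.toDGCat a * of f * I E.toDGCat (s + q)).cmp
        (I E.toDGCat (a + 1 + s) * of U * I E.toDGCat q) := by
  have e1 : I E.toDGCat (a + r + s) * of U * I E.toDGCat q =
      (I E.toDGCat (a + r)) * (I E.toDGCat s * of U * I E.toDGCat q) := by
    simp only [I_add, mul_assoc]
  have e2 : I E.toDGCat (a + 1 + s) * of U * I E.toDGCat q =
      (I E.toDGCat (a + 1)) * (I E.toDGCat s * of U * I E.toDGCat q) := by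
    simp only [I_add, mul_assoc]
  have z := zero_I (D := E.toDGCat)
  have zU : (I E.toDGCat s * of U * I E.toDGCat q).Zero :=
    Zero.mul (D := E.toMonDGCat) (Zero.mul (D := E.toMonDGCat) (z s) (G := of U) hU) (z q)
  rw [e1, e2, mul_cmp_mul' (by simp) (by simp) zU, mul_cmp_mul' (by simp) (by simp) (z _),
    cmp_I (by simp), cmp_I (by simp), I_cmp (by simp), I_cmp (by simp)]

theorem unit_inside (U : E.Hom 0 1) {r : ℕ} (f : E.Hom r 1) (a i j c : ℕ) (hr : i + 1 + j = r) :
    (I E.toDGCat (a + i) * of U * I E.toDGCat (j + c)).cmp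
        (I E.toDGCat a * of f * I E.toDGCat c) =
      I E.toDGCat a * ((I E.toDGCat i * of U * I E.toDGCat j).cmp (of f)) * I E.toDGCat c := by
  subst hr
  have e1 : I E.toDGCat (a + i) * of U * I E.toDGCat (j + c) =
      I E.toDGCat a * ((I E.toDGCat i * of U * I E.toDGCat j) * I E.toDGCat c) := by
    simp only [I_add, mul_assoc]
  have z := zero_I (D := E.toDGCat)
  rw [e1, mul_assoc (I _ a) (of f), mul_cmp_mul (by simp) (by simp) (z a),
    mul_cmp_mul' (by simp) (by simp) (z c), cmp_I (by simp), cmp_I (by simp), ← mul_assoc]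

/-- Naturality of the symmetry: a unit in the first block is carried behind the t inputs that move
to the front. The next lemma is the case of a unit in the second block. -/
theorem unit_braid_left (U : E.Hom 0 1) (p s t : ℕ) :
    (I E.toDGCat p * of U * I E.toDGCat (s + t)).cmp (of (E.sym.braid (p + 1 + s) t)) =
      (of (E.sym.braid (p + s) t)).cmp (I E.toDGCat (t + p) * of U * I E.toDGCat s) := by
  have z := zero_I (D := E.toDGCat)
  have e1 : I E.toDGCat p * of U * I E.toDGCat (s + t) =
      (I E.toDGCat p * of U * I E.toDGCat s) * I E.toDGCat t := by
    simp only [I_add, mul_assoc]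
  rw [e1, mul_cmp_braid E.sym (by simp) (by simp) (.inr (z t))]
  simp only [I_add, mul_assoc]
  rfl

theorem unit_braid_right (U : E.Hom 0 1) (q i j : ℕ) :
    (I E.toDGCat (q + i) * of U * I E.toDGCat j).cmp (of (E.sym.braid q (i + 1 + j))) =
      (of (E.sym.braid q (i + j))).cmp (I E.toDGCat i * of U * I E.toDGCat (j + q)) := by
  have z := zero_I (D := E.toDGCat)
  have e1 : I E.toDGCat (q + i) * of U * I E.toDGCat j =
      I E.toDGCat q * (I E.toDGCat i * of U * I E.toDGCat j) := by
    simp only [I_add, mul_assoc]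
  rw [e1, mul_cmp_braid E.sym (by simp) (by simp) (.inl (z q))]
  simp only [I_add, mul_assoc]
  rfl

variable {A : AInfMult E} (U : StrictUnit A)

theorem of_insert {n a : ℕ} (h : a < n) :
    of (U.insert n a) = I E.toDGCat (a + 1) * of U.u * I E.toDGCat (n - 1 - a) := by
  unfold StrictUnit.insert
  rw [of_comp, of_comp, of_ins, of_eqId (by omega), of_eqId (by omega), I_cmp (by simp; omega),
    cmp_I (by simp)]

theorem insert_deg (n a : ℕ) : U.insert n a ∈ (E.Hom n (n + 1)).deg 0 := by
  have h1 : E.ins (a + 1) U.u (n - 1 - a) ∈ (E.Hom _ _).deg 0 :=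
    E.tens_deg 0 0 _ _ (E.tens_deg 0 0 _ _ (E.one_deg _) U.u_deg) (E.one_deg _)
  exact E.comp_deg 0 0 _ _ (E.comp_deg 0 0 _ _ (E.eqId_deg _ _) h1) (E.eqId_deg _ _)

theorem insert_d (n a : ℕ) : (E.Hom n (n + 1)).d (U.insert n a) = 0 := by
  have h0 : E.tens (E.one (a + 1)) U.u ∈ (E.Hom _ _).deg 0 :=
    E.tens_deg 0 0 _ _ (E.one_deg _) U.u_deg
  have h1 : E.ins (a + 1) U.u (n - 1 - a) ∈ (E.Hom _ _).deg 0 :=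
    E.tens_deg 0 0 _ _ h0 (E.one_deg _)
  have h2 : (E.Hom _ _).d (E.ins (a + 1) U.u (n - 1 - a)) = 0 := by
    unfold DGProp.ins
    rw [E.tens_d 0 _ _ h0, E.tens_d 0 _ _ (E.one_deg _), E.one_d, U.u_d, E.one_d]
    simp
  unfold StrictUnit.insert
  rw [E.comp_d 0 _ _ (E.comp_deg 0 0 _ _ (E.eqId_deg _ _) h1),
    E.comp_d 0 _ _ (E.eqId_deg _ _), E.eqId_d, E.eqId_d, h2]
  simp

/-- The value of `m_r` on a unit, for `r ≥ 3`. -/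
theorem unit_m_eq_zero (i j : ℕ) (h : 3 ≤ i + 1 + j) :
    (I E.toDGCat i * of U.u * I E.toDGCat j).cmp (of (A.m (i + 1 + j))) =
      of (0 : E.Hom (i + 0 + j) 1) := by
  rw [← of_ins, ← of_comp, U.unit_higher i j h]

theorem unit_m_eq_one (i j : ℕ) (h : i + 1 + j = 2) :
    (I E.toDGCat i * of U.u * I E.toDGCat j).cmp (of (A.m 2)) = I E.toDGCat 1 := by
  obtain ⟨rfl, rfl⟩ | ⟨rfl, rfl⟩ : (i = 0 ∧ j = 1) ∨ (i = 1 ∧ j = 0) := by omega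
  · rw [I_zero, one_mul]
    have := congrArg of U.unit_left
    rw [of_comp, of_eqId (by simp), of_tens] at this
    exact this
  · rw [I_zero, mul_one]
    have := congrArg of U.unit_right
    rw [of_comp, of_eqId (by simp), of_tens] at this
    exact this

/-- The morphisms `n ⟶ k` that end with the insertion of a unit in one of the positions
`2, …, k`. -/
def insSpan (n k : ℕ) : AddSubgroup (E.Hom n (k + 1)) :=
  AddSubgroup.closure {w | ∃ a < k, ∃ h : E.Hom n k, w = E.comp h (U.insert k a)}

/-- It suffices to exhibit in `Arr` a factorization of w that ends with the insertion. -/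
theorem mem_insSpan {n k a : ℕ} (ha : a < k) {w : E.Hom n (k + 1)} {H : Arr E.toDGCat}
    (hs : H.src = n) (ht : H.tgt = k)
    (h : of w = H.cmp (I E.toDGCat (a + 1) * of U.u * I E.toDGCat (k - 1 - a))) :
    w ∈ insSpan U n k := by
  rw [← of_insert U ha] at h
  obtain ⟨k, hk⟩ := exists_comp hs ht h
  exact AddSubgroup.subset_closure ⟨a, ha, k, hk⟩

variable (A) in
/-- The summand of `f_{N,K}` without cyclic permutation. -/
noncomputable def hochPlain (N K a : ℕ) : E.Hom N K :=
  E.comp (E.comp (E.eqId N (a + (N + 1 - K) + (K - 1 - a)))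
    (E.ins a (A.m (N + 1 - K)) (K - 1 - a))) (E.eqId (a + 1 + (K - 1 - a)) K)

variable (A) in
/-- The summand of `f_{N,K}` with cyclic permutation. -/
noncomputable def hochWrap (N K t : ℕ) : E.Hom N K :=
  E.comp (E.comp (E.comp (E.comp (E.eqId N (N - t + t)) (E.sym.braid (N - t) t))
      (E.eqId (t + (N - t)) ((N + 1 - K) + (K - 1)))) (E.tens (A.m (N + 1 - K)) (E.one (K - 1))))
      (E.eqId (1 + (K - 1)) K)

theorem hoch_eq (N K : ℕ) : A.hoch N K =
    (∑ a ∈ Finset.range K, sgn ((a + 1) * ((N + 1 - K : ℕ) + 1)) • hochPlain A N K a) +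
    ∑ t ∈ Finset.Ico 1 (N + 1 - K), sgn ((N + 1 - K : ℕ) + 1 + t * (N - t)) • hochWrap A N K t :=
  rfl

theorem of_hochPlain {N K a : ℕ} (hK : K ≤ N) (ha : a < K) : of (hochPlain A N K a) =
    I E.toDGCat a * of (A.m (N + 1 - K)) * I E.toDGCat (K - 1 - a) := by
  unfold hochPlain
  rw [of_comp, of_comp, of_ins, of_eqId (by omega), of_eqId (by omega), I_cmp (by simp; omega),
    cmp_I (by simp)]

theorem of_hochWrap {N K t : ℕ} (hK : K ≤ N) (hK' : 1 ≤ K) (ht : t < N + 1 - K) :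
    of (hochWrap A N K t) = (of (E.sym.braid (N - t) t)).cmp
      (of (A.m (N + 1 - K)) * I E.toDGCat (K - 1)) := by
  unfold hochWrap
  rw [of_comp, of_comp, of_comp, of_comp, of_tens, of_eqId (by omega), of_eqId (by omega),
    of_eqId (by omega), I_cmp (by simp; omega), cmp_I (by simp), cmp_I (by simp)]
  rfl

theorem eq_zero_of_of_eq {a b a' b' : ℕ} {w : E.Hom a b} (ha : a = a') (hb : b = b')
    (h : of w = of (0 : E.Hom a' b')) : w = 0 := by
  subst ha hb
  exact of_injective h

/-- Counted from 0 the unit is input a + 1, and m_r consumes the inputs from b on. Here the unit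
lies to the left of them, so it is inserted after m_r at the same place. -/
theorem insert_hochPlain_before {n k a b : ℕ} (ha : a < n) (hk : k < n) (hb : b < k + 1)
    (h : a + 1 < b) :
    E.comp (U.insert n a) (hochPlain A (n + 1) (k + 1) b) ∈ insSpan U n k := by
  obtain ⟨s, rfl⟩ : ∃ s, b = a + 1 + 1 + s := ⟨b - (a + 2), by omega⟩
  obtain ⟨c, rfl⟩ : ∃ c, k = a + 1 + 1 + s + c := ⟨k - (a + 1 + 1 + s), by omega⟩
  obtain ⟨r, hr⟩ : ∃ r, n + 1 + 1 - (a + 1 + 1 + s + c + 1) = r := ⟨_, rfl⟩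
  refine mem_insSpan U (a := a) (by omega) (H := I E.toDGCat (a + 1 + s) *
    of (A.m (n + 1 + 1 - (a + 1 + 1 + s + c + 1))) * I E.toDGCat c)
    (by simp; omega) (by simp; omega) ?_
  rw [of_comp, of_insert U ha, of_hochPlain (by omega) hb]
  have := unit_before U.u U.u_deg (A.m (n + 1 + 1 - (a + 1 + 1 + s + c + 1))) (a + 1) s c
  rw [show n - 1 - a = s + (n + 1 + 1 - (a + 1 + 1 + s + c + 1)) + c by omega,
    show a + 1 + 1 + s + c + 1 - 1 - (a + 1 + 1 + s) = c by omega,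
    show a + 1 + 1 + s + c - 1 - a = s + 1 + c by omega]
  exact this

/-- The unit lies to the right of the inputs of m_r. The output of m_r stays in front of it, so it
does not end up in the forbidden first position. -/
theorem insert_hochPlain_after {n k a b : ℕ} (ha : a < n) (hk : k < n) (hb : b < k + 1)
    (h : b + (n + 1 - k) ≤ a + 1) :
    E.comp (U.insert n a) (hochPlain A (n + 1) (k + 1) b) ∈ insSpan U n k := by
  obtain ⟨s, hs⟩ : ∃ s, a + 1 = b + (n + 1 + 1 - (k + 1)) + s :=
    ⟨a + 1 - (b + (n + 1 + 1 - (k + 1))), by omega⟩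
  obtain ⟨q, hq⟩ : ∃ q, q = n - 1 - a := ⟨_, rfl⟩
  refine mem_insSpan U (a := b + s) (by omega) (H := I E.toDGCat b *
    of (A.m (n + 1 + 1 - (k + 1))) * I E.toDGCat (s + q))
    (by simp; omega) (by simp; omega) ?_
  rw [of_comp, of_insert U ha, of_hochPlain (by omega) hb]
  have := unit_after U.u U.u_deg (A.m (n + 1 + 1 - (k + 1))) b s q
  rw [← hs, ← show k + 1 - 1 - b = s + 1 + q by omega] at this
  rw [← hq, this, show b + 1 + s = b + s + 1 by omega, show k - 1 - (b + s) = q by omega]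

theorem insert_hochPlain_inside {n k a b : ℕ} (ha : a < n) (hk : k < n) (hb : b < k + 1)
    (h₁ : b ≤ a + 1) (h₂ : a + 1 < b + (n + 1 - k)) :
    of (E.comp (U.insert n a) (hochPlain A (n + 1) (k + 1) b)) =
      I E.toDGCat b * ((I E.toDGCat (a + 1 - b) * of U.u * I E.toDGCat (n - k - (a + 1 - b))).cmp
        (of (A.m (a + 1 - b + 1 + (n - k - (a + 1 - b)))))) * I E.toDGCat (k - b) := by
  rw [of_comp, of_insert U ha, of_hochPlain (by omega) hb]
  have := unit_inside U.u (A.m (a + 1 - b + 1 + (n - k - (a + 1 - b)))) b (a + 1 - b)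
    (n - k - (a + 1 - b)) (k - b) rfl
  rw [← this, show b + (a + 1 - b) = a + 1 by omega,
    show n - k - (a + 1 - b) + (k - b) = n - 1 - a by omega,
    show a + 1 - b + 1 + (n - k - (a + 1 - b)) = n + 1 + 1 - (k + 1) by omega,
    show k + 1 - 1 - b = k - b by omega]

theorem of_zero_congr {a b a' b' : ℕ} (ha : a = a') (hb : b = b') :
    of (0 : E.Hom a b) = of (0 : E.Hom a' b') := by
  subst ha hb; rfl

theorem of_mul_zero {a b : ℕ} (F : Arr E.toDGCat) : F * of (0 : E.Hom a b) =
    of (0 : E.Hom (F.src + a) (F.tgt + b)) := by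
  obtain ⟨s, t, f⟩ := F
  change of (E.tens f 0) = _
  rw [map_zero]
  rfl

theorem of_zero_mul {a b : ℕ} (F : Arr E.toDGCat) : of (0 : E.Hom a b) * F =
    of (0 : E.Hom (a + F.src) (b + F.tgt)) := by
  obtain ⟨s, t, f⟩ := F
  change of (E.tens 0 f) = _
  rw [map_zero]
  rfl

theorem of_cmp_zero {a b : ℕ} (F : Arr E.toDGCat) : F.cmp (of (0 : E.Hom a b)) =
    of (0 : E.Hom F.src b) := by
  obtain ⟨s, t, f⟩ := F
  change of (E.comp (E.comp f (E.eqId t a)) 0) = _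
  rw [map_zero]
  rfl

/-- The unit is an input of m_r, and r = n + 1 - k ≥ 3. -/
theorem insert_hochPlain_eq_zero {n k a b : ℕ} (ha : a < n) (hk : k + 1 < n) (hb : b < k + 1)
    (h₁ : b ≤ a + 1) (h₂ : a + 1 < b + (n + 1 - k)) :
    E.comp (U.insert n a) (hochPlain A (n + 1) (k + 1) b) = 0 := by
  have h := insert_hochPlain_inside U (A := A) ha (by omega) hb h₁ h₂
  rw [unit_m_eq_zero U _ _ (by omega), of_mul_zero, of_zero_mul] at h
  exact eq_zero_of_of_eq (by simp; omega) (by simp; omega) h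

/-- Here r = 2, and the unit is the second input of m₂ (b = a) or the first one (b = a + 1). -/
theorem insert_hochPlain_eq_one {n a b : ℕ} (ha : a < n + 1) (hb : b < n + 1)
    (h : b = a ∨ b = a + 1) :
    of (E.comp (U.insert (n + 1) a) (hochPlain A (n + 1 + 1) (n + 1) b)) = I E.toDGCat (n + 1) := by
  have h := insert_hochPlain_inside U (A := A) ha (by omega) hb (by omega) (by omega)
  have e : a + 1 - b + 1 + (n + 1 - n - (a + 1 - b)) = 2 := by omega
  have h' := unit_m_eq_one U _ _ e
  rw [← e] at h'
  rw [h, h', ← I_add, ← I_add]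
  congr 1
  omega

/-- The unit is among the inputs that do not wrap around. The rotation carries it from place a + 1
to place t + (a + 1), counted from 0. -/
theorem insert_hochWrap_left {n k a t : ℕ} (ht' : t < n + 1 - k) (h : a + 1 < n + 1 - t)
    (hk : k < n) :
    of (E.comp (U.insert n a) (hochWrap A (n + 1) (k + 1) t)) =
      (of (E.sym.braid (n - t) t)).cmp
        ((I E.toDGCat (t + (a + 1)) * of U.u * I E.toDGCat (n - 1 - a - t)).cmp
          (of (A.m (n + 1 - k)) * I E.toDGCat k)) := by
  rw [of_comp, of_insert U (by omega), of_hochWrap (by omega) (by omega) (by omega),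
    ← Arr.cmp_assoc, ← Arr.cmp_assoc]
  have := unit_braid_left U.u (a + 1) (n - 1 - a - t) t
  rw [show n - 1 - a - t + t = n - 1 - a by omega,
    show a + 1 + 1 + (n - 1 - a - t) = n + 1 - t by omega,
    show a + 1 + (n - 1 - a - t) = n - t by omega] at this
  rw [this, show n + 1 + 1 - (k + 1) = n + 1 - k by omega]
  rfl

/-- The unit is one of the last t inputs, which are rotated to the front. Without the unit only t -
1 inputs wrap around. -/
theorem insert_hochWrap_right {n k a t : ℕ} (ha : a < n) (ht' : t < n + 1 - k)
    (h : n + 1 - t ≤ a + 1) (hk : k < n) :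
    of (E.comp (U.insert n a) (hochWrap A (n + 1) (k + 1) t)) =
      (of (E.sym.braid (n + 1 - t) (t - 1))).cmp
        ((I E.toDGCat (a + t - n) * of U.u * I E.toDGCat (n - 1 - a + (n + 1 - t))).cmp
          (of (A.m (n + 1 - k)) * I E.toDGCat k)) := by
  rw [of_comp, of_insert U (by omega), of_hochWrap (by omega) (by omega) (by omega),
    ← Arr.cmp_assoc, ← Arr.cmp_assoc]
  have := unit_braid_right U.u (n + 1 - t) (a + t - n) (n - 1 - a)
  rw [show n + 1 - t + (a + t - n) = a + 1 by omega,
    show a + t - n + 1 + (n - 1 - a) = t by omega,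
    show a + t - n + (n - 1 - a) = t - 1 by omega] at this
  rw [this, show n + 1 + 1 - (k + 1) = n + 1 - k by omega]
  rfl

theorem unit_m_tens_eq_zero {i r k : ℕ} (hi : i < r) (hr : 3 ≤ r) {q : ℕ} (hq : i + 1 + q = r + k) :
    (I E.toDGCat i * of U.u * I E.toDGCat q).cmp (of (A.m r) * I E.toDGCat k) =
      of (0 : E.Hom (r - 1 + k) (1 + k)) := by
  obtain ⟨j, rfl⟩ : ∃ j, r = i + 1 + j := ⟨r - (i + 1), by omega⟩
  have := unit_inside U.u (A.m (i + 1 + j)) 0 i j k rfl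
  rw [unit_m_eq_zero U _ _ hr, I_zero, one_mul, one_mul, zero_add, of_zero_mul] at this
  obtain rfl : q = j + k := by omega
  rw [this]
  exact of_zero_congr (by simp) (by simp)

/-- The alternatives in `h` say that m_r, with r ≥ 3, consumes the unit: it wraps around, or after
the rotation it is still among the first r inputs. -/
theorem insert_hochWrap_eq_zero {n k a t : ℕ} (ha : a < n) (hk : k + 1 < n) (ht : 1 ≤ t)
    (ht' : t < n + 1 - k) (h : n + 1 - t ≤ a + 1 ∨ t + (a + 1) < n + 1 - k) :
    E.comp (U.insert n a) (hochWrap A (n + 1) (k + 1) t) = 0 := by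
  by_cases h' : a + 1 < n + 1 - t
  · have e := insert_hochWrap_left U (A := A) ht' h' (by omega)
    rw [unit_m_tens_eq_zero U (by omega) (by omega) (by omega), of_cmp_zero] at e
    exact eq_zero_of_of_eq (by simp; omega) (by omega) e
  · have e := insert_hochWrap_right U (A := A) ha ht' (by omega) (by omega)
    rw [unit_m_tens_eq_zero U (by omega) (by omega) (by omega), of_cmp_zero] at e
    exact eq_zero_of_of_eq (by simp; omega) (by omega) e

/-- After the rotation the unit is behind the r inputs of m_r. The output of m_r takes the first
place, so the unit is inserted in a later one. -/
theorem insert_hochWrap_mem {n k a t : ℕ} (hk : k < n) (ht' : t < n + 1 - k)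
    (h : a + 1 < n + 1 - t) (h' : n + 1 - k ≤ t + (a + 1)) :
    E.comp (U.insert n a) (hochWrap A (n + 1) (k + 1) t) ∈ insSpan U n k := by
  obtain ⟨s, hs⟩ : ∃ s, t + (a + 1) = n + 1 - k + s := ⟨t + (a + 1) - (n + 1 - k), by omega⟩
  obtain ⟨q, hq⟩ : ∃ q, q = n - 1 - a - t := ⟨_, rfl⟩
  have := unit_after U.u U.u_deg (A.m (n + 1 - k)) 0 s q
  rw [zero_add, ← hs, I_zero, one_mul, show s + 1 + q = k by omega] at this
  refine mem_insSpan U (a := s) (by omega) (H := (of (E.sym.braid (n - t) t)).cmp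
    (of (A.m (n + 1 - k)) * I E.toDGCat (s + q))) (by simp; omega) (by simp; omega) ?_
  rw [insert_hochWrap_left U ht' h hk, ← hq, this, Arr.cmp_assoc, show 0 + 1 + s = s + 1 by omega,
    show k - 1 - s = q by omega]

/-- The unit is the last input and the only one that wraps around, so it becomes the left argument
of m₂. What remains of the rotation exchanges with an empty block. -/
theorem insert_hochWrap_eq_one (n : ℕ) :
    of (E.comp (U.insert (n + 1) n) (hochWrap A (n + 1 + 1) (n + 1) 1)) = I E.toDGCat (n + 1) := by
  have e := insert_hochWrap_right U (A := A) (n := n + 1) (k := n) (a := n) (t := 1)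
    (by omega) (by omega) (by omega) (by omega)
  have h := unit_inside U.u (A.m 2) 0 0 1 n rfl
  rw [unit_m_eq_one U _ _ rfl, I_zero, one_mul, one_mul, ← I_add, zero_add, I_zero, one_mul] at h
  rw [e, show n + 1 + 1 - 1 = n + 1 by omega, show n + 1 - (n + 1) = 0 by omega, I_zero, one_mul,
    show n + 1 - 1 - n + (n + 1) = 1 + n by omega, show n + 1 + 1 - n = 2 by omega, h,
    show (1 - 1 : ℕ) = 0 by omega, E.sym.of_braid_zero_right, I_cmp (by simp; omega), add_comm]

/-- The reason why the degenerate part is a subcomplex. A term of f_{n+1,k+1} in which the unit is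
not consumed still ends with a unit outside the first position. A term in which m_r consumes the
unit vanishes if r ≥ 3. For r = 2 there are exactly two such terms, both equal to the identity, with
opposite signs. -/
theorem insert_hoch_mem {n k a : ℕ} (ha : a < n) (hk : k < n) :
    E.comp (U.insert n a) (A.hoch (n + 1) (k + 1)) ∈ insSpan U n k := by
  rw [hoch_eq, map_add, map_sum, map_sum]
  simp only [map_zsmul]
  by_cases hr : k + 1 < n
  · refine add_mem (sum_mem fun b hb => AddSubgroup.zsmul_mem _ ?_ _)
      (sum_mem fun t ht => AddSubgroup.zsmul_mem _ ?_ _)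
    · rw [Finset.mem_range] at hb
      by_cases h1 : a + 1 < b
      · exact insert_hochPlain_before U ha hk hb h1
      by_cases h2 : b + (n + 1 - k) ≤ a + 1
      · exact insert_hochPlain_after U ha hk hb h2
      rw [insert_hochPlain_eq_zero U ha hr hb (by omega) (by omega)]
      exact zero_mem _
    · rw [Finset.mem_Ico] at ht
      by_cases h : a + 1 < n + 1 - t ∧ n + 1 - k ≤ t + (a + 1)
      · exact insert_hochWrap_mem U hk (by omega) h.1 h.2
      · rw [insert_hochWrap_eq_zero U ha hr (by omega) (by omega) (by omega)]
        exact zero_mem _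
  · obtain rfl : n = k + 1 := by omega
    -- the two terms that apply `m₂` to the unit cancel
    have hJ : of (E.eqId (k + 1) (k + 1)) = I E.toDGCat (k + 1) := of_eqId rfl
    have hone : ∀ b, b < k + 1 → (b = a ∨ b = a + 1) →
        E.comp (U.insert (k + 1) a) (hochPlain A (k + 1 + 1) (k + 1) b) =
          E.eqId (k + 1) (k + 1) := fun b hb h =>
      of_injective ((insert_hochPlain_eq_one U ha hb h).trans hJ.symm)
    have hrest : ∀ b, b < k + 1 → b ≠ a → b ≠ a + 1 →
        E.comp (U.insert (k + 1) a) (hochPlain A (k + 1 + 1) (k + 1) b) ∈ insSpan U (k + 1) k := by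
      intro b hb h1 h2
      by_cases h : a + 1 < b
      · exact insert_hochPlain_before U ha hk hb h
      · exact insert_hochPlain_after U ha hk hb (by omega)
    rw [show k + 1 + 1 + 1 - (k + 1) = 2 by omega,
      show Finset.Ico 1 2 = {1} from rfl, Finset.sum_singleton]
    rw [← Finset.add_sum_erase _ _ (Finset.mem_range.2 ha), hone a ha (.inl rfl)]
    -- If the unit is the last input, its right neighbour in the cyclic order is the first input,
    -- and the term that cancels is the one with cyclic permutation.
    by_cases hak : a = k
    · subst hak
      have hw : E.comp (U.insert (a + 1) a) (hochWrap A (a + 1 + 1) (a + 1) 1) =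
          E.eqId (a + 1) (a + 1) := of_injective ((insert_hochWrap_eq_one U a).trans hJ.symm)
      rw [hw, add_right_comm, ← add_smul]
      refine add_mem ?_ (sum_mem fun b hb => AddSubgroup.zsmul_mem _ ?_ _)
      · have : sgn (((a : ℤ) + 1) * ((2 : ℕ) + 1)) = - sgn (((2 : ℕ) : ℤ) + 1 + (1 : ℕ) * ((a + 1 + 1 : ℕ) - (1 : ℕ))) := by
          rw [← neg_one_mul, ← sgn_one, ← sgn_add]
          exact sgn_congr ⟨a - 1, by push_cast; ring⟩
        rw [this, neg_add_cancel, zero_smul]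
        exact zero_mem _
      · rw [Finset.mem_erase, Finset.mem_range] at hb
        exact hrest b hb.2 hb.1 (by omega)
    · have ha1 : a + 1 ∈ (Finset.range (k + 1)).erase a := by
        rw [Finset.mem_erase, Finset.mem_range]; omega
      rw [← Finset.add_sum_erase _ _ ha1, hone (a + 1) (by omega) (.inr rfl), ← add_assoc,
        ← add_smul]
      refine add_mem (add_mem ?_ (sum_mem fun b hb => AddSubgroup.zsmul_mem _ ?_ _))
        (AddSubgroup.zsmul_mem _ ?_ _)
      · have : sgn (((a : ℤ) + 1) * ((2 : ℕ) + 1)) = - sgn (((a + 1 : ℕ) + 1 : ℤ) * ((2 : ℕ) + 1)) := by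
          rw [← neg_one_mul, ← sgn_one, ← sgn_add]
          exact sgn_congr ⟨-2, by push_cast; ring⟩
        rw [this, neg_add_cancel, zero_smul]
        exact zero_mem _
      · simp only [Finset.mem_erase, Finset.mem_range] at hb
        exact hrest b (by omega) (by omega) (by omega)
      · exact insert_hochWrap_mem U hk (by omega) (by omega) (by omega)

end Unit

end HochschildAction
namespace HochschildAction

/-! ### dg-functors -/

namespace PreFunctor.IsDGFunctor

variable {O : Type} {D : DGCat.{u} O} {F : PreFunctor.{u, v} D} (hF : F.IsDGFunctor)
include hF

theorem pairing (a b : O) : IsPairing (F.act (a := a) (b := b)) where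
  deg i j x f hx hf := hF.act_deg i j x f hx hf
  d i x f hx := hF.act_d i x f hx

theorem act_koszul {a b : O} (n : ℤ) (x : F.obj a) (f : D.Hom a b) :
    (F.obj b).koszul n (F.act x f) = F.act ((F.obj a).koszul n x) ((D.Hom a b).koszul n f) :=
  (hF.pairing a b).koszul (hF.isComplex a) (D.isComplex a b) (hF.isComplex b) n x f

theorem act_koszul_zero {a b : O} (n : ℤ) (x : F.obj a) {f : D.Hom a b}
    (hf : f ∈ (D.Hom a b).deg 0) :
    (F.obj b).koszul n (F.act x f) = F.act ((F.obj a).koszul n x) f := by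
  rw [hF.act_koszul, koszul_apply (D.isComplex a b).internal n hf, mul_zero, sgn_zero, one_smul]

theorem act_d_zero {a b : O} (x : F.obj a) {f : D.Hom a b} (hf : (D.Hom a b).d f = 0) :
    (F.obj b).d (F.act x f) = F.act ((F.obj a).d x) f := by
  rw [(hF.pairing a b).d' (hF.isComplex a).internal, hf, map_zero, add_zero]

theorem act_zero_deg {a b : O} {i : ℤ} {x : F.obj a} {f : D.Hom a b} (hx : x ∈ (F.obj a).deg i)
    (hf : f ∈ (D.Hom a b).deg 0) : F.act x f ∈ (F.obj b).deg i := by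
  simpa using hF.act_deg i 0 x f hx hf

end PreFunctor.IsDGFunctor

theorem rep_isDGFunctor {O : Type} (D : DGCat.{u} O) (a : O) : (rep D a).IsDGFunctor where
  isComplex := D.isComplex a
  act_deg i j x f hx hf := D.comp_deg i j x f hx hf
  act_d i x f hx := D.comp_d i x f hx
  act_one x := D.comp_one x
  act_comp x f g := (D.comp_assoc x f g).symm

/-! ### The operators `C` and its reduced variant -/

section Hochschild

variable {E : DGProp.{u}} {A : AInfMult E} (Φ : PreFunctor.{u, v} E.toDGCat)

variable (A) in
/-- `x ↦ x ⊗ l_{n+1}`, in the unreduced complex. -/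
noncomputable def hof (m n : ℕ) : Φ.obj (n + 1 + m) →+ (hochschild A Φ).obj m :=
  DirectSum.of (fun n : ℕ => Φ.obj (n + 1 + m)) n

variable (A) in
/-- The coefficient of `l_{n+1}`. -/
noncomputable def hcoeff (m n : ℕ) : (hochschild A Φ).obj m →+ Φ.obj (n + 1 + m) :=
  (DFinsupp.evalAddMonoidHom n : (⨁ n : ℕ, Φ.obj (n + 1 + m)) →+ Φ.obj (n + 1 + m))

theorem hcoeff_hof_same (m n : ℕ) (x : Φ.obj (n + 1 + m)) : hcoeff A Φ m n (hof A Φ m n x) = x :=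
  DirectSum.of_eq_same (β := fun n : ℕ => (Φ.obj (n + 1 + m)).carrier) n x

theorem hcoeff_hof_ne (m : ℕ) {n k : ℕ} (h : k ≠ n) (x : Φ.obj (n + 1 + m)) :
    hcoeff A Φ m k (hof A Φ m n x) = 0 :=
  DirectSum.of_eq_of_ne (β := fun n : ℕ => (Φ.obj (n + 1 + m)).carrier) n k x h

theorem hoch_induction {m : ℕ} {p : (hochschild A Φ).obj m → Prop} (x : (hochschild A Φ).obj m)
    (gen : ∀ n x, p (hof A Φ m n x)) (add : ∀ x y, p x → p y → p (x + y)) : p x := by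
  have h0 : p 0 := by simpa using gen 0 0
  exact DirectSum.induction_on (motive := p) x h0 gen add

theorem hoch_mem_closure {m : ℕ} (S : AddSubgroup ((hochschild A Φ).obj m))
    (x : (hochschild A Φ).obj m) (h : ∀ n, hof A Φ m n (hcoeff A Φ m n x) ∈ S) : x ∈ S := by
  classical
  have e : x = ∑ n ∈ DFinsupp.support (β := fun n : ℕ => Φ.obj (n + 1 + m)) x,
      hof A Φ m n (hcoeff A Φ m n x) :=
    (DirectSum.sum_support_of (β := fun n : ℕ => Φ.obj (n + 1 + m)) x).symm
  rw [e]
  exact sum_mem fun n _ => h n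

theorem mem_hoch_deg {m : ℕ} {i : ℤ} {x : (hochschild A Φ).obj m} :
    x ∈ ((hochschild A Φ).obj m).deg i ↔
      ∀ n : ℕ, hcoeff A Φ m n x ∈ (Φ.obj (n + 1 + m)).deg (i - n) := by
  exact AddSubgroup.mem_iInf (S := fun n : ℕ => ((Φ.obj (n + 1 + m)).deg (i - n)).comap
    (hcoeff A Φ m n))

theorem hof_deg {m n : ℕ} {i : ℤ} {x : Φ.obj (n + 1 + m)} (hx : x ∈ (Φ.obj (n + 1 + m)).deg i) :
    hof A Φ m n x ∈ ((hochschild A Φ).obj m).deg (i + n) := by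
  rw [mem_hoch_deg]
  intro k
  by_cases h : k = n
  · subst h; rw [hcoeff_hof_same, add_sub_cancel_right]; exact hx
  · rw [hcoeff_hof_ne _ _ h]; exact zero_mem _

theorem hoch_d_hof {m n : ℕ} (x : Φ.obj (n + 1 + m)) :
    ((hochschild A Φ).obj m).d (hof A Φ m n x) = hof A Φ m n ((Φ.obj (n + 1 + m)).d x) +
      ∑ k ∈ Finset.range n, hof A Φ m k (Φ.act ((Φ.obj (n + 1 + m)).koszul 1 x)
        (E.tens (A.hoch (n + 1) (k + 1)) (E.one m))) := by
  have h : ((hochschild A Φ).obj m).d (hof A Φ m n x) =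
      ((hof A Φ m n).comp (Φ.obj (n + 1 + m)).d + ∑ k ∈ Finset.range n, (hof A Φ m k).comp
        ((Φ.act.flip (E.tens (A.hoch (n + 1) (k + 1)) (E.one m))).comp
          ((Φ.obj (n + 1 + m)).koszul 1))) x :=
    DirectSum.toAddMonoid_of (β := fun n : ℕ => (Φ.obj (n + 1 + m)).carrier) _ n x
  rw [h, AddMonoidHom.add_apply, AddMonoidHom.finsetSum_apply]
  rfl

theorem hoch_act_hof {m m' n : ℕ} (x : Φ.obj (n + 1 + m)) (f : E.Hom m m') :
    (hochschild A Φ).act (hof A Φ m n x) f =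
      hof A Φ m' n (Φ.act x (E.tens (E.one (n + 1)) ((E.Hom m m').koszul n f))) := by
  exact DFunLike.congr_fun (DirectSum.toAddMonoid_of (β := fun n : ℕ => (Φ.obj (n + 1 + m)).carrier) _ n x) f

/-- In degree i the coefficient of l_{n+1} has degree i - n, so the projections can be taken
coefficientwise. Their explicit form is recorded because in the reduced case they have to be shown
to preserve the degenerate part. -/
theorem hoch_internal (hΦ : ∀ a, DirectSum.IsInternal (Φ.obj a).deg) (m : ℕ) :
    DirectSum.IsInternal ((hochschild A Φ).obj m).deg ∧
    ∀ i, ∃ π : (hochschild A Φ).obj m →+ (hochschild A Φ).obj m,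
      (∀ x ∈ ((hochschild A Φ).obj m).deg i, π x = x) ∧
      (∀ j, j ≠ i → ∀ x ∈ ((hochschild A Φ).obj m).deg j, π x = 0) ∧
      ∀ n x, π (hof A Φ m n x) =
        hof A Φ m n ((Φ.obj (n + 1 + m)).scale (fun j => if j = i - n then 1 else 0) x) := by
  suffices h : ∀ i, ∃ π : (hochschild A Φ).obj m →+ (hochschild A Φ).obj m,
      (∀ x ∈ ((hochschild A Φ).obj m).deg i, π x = x) ∧
      (∀ j, j ≠ i → ∀ x ∈ ((hochschild A Φ).obj m).deg j, π x = 0) ∧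
      ∀ n x, π (hof A Φ m n x) =
        hof A Φ m n ((Φ.obj (n + 1 + m)).scale (fun j => if j = i - n then 1 else 0) x) by
    refine ⟨PreComplex.internal_of_proj _ (fun x => ?_) (fun i => ?_), h⟩
    · refine hoch_induction (A := A) Φ x (fun n x => ?_) fun x y hx hy => add_mem hx hy
      refine hom_induction (hΦ _) (p := fun x => hof A Φ m n x ∈ _) x (by simp)
        (fun x y hx hy => by rw [map_add]; exact add_mem hx hy) fun i x hx => ?_
      exact AddSubgroup.subset_closure ⟨_, hof_deg Φ hx⟩
    · obtain ⟨π, h1, h2, _⟩ := h i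
      exact ⟨π, h1, h2⟩
  intro i
  let π : (hochschild A Φ).obj m →+ (hochschild A Φ).obj m := DirectSum.toAddMonoid fun n =>
    (hof A Φ m n).comp ((Φ.obj (n + 1 + m)).scale (fun j => if j = i - n then 1 else 0))
  have hπ : ∀ n x, π (hof A Φ m n x) =
      hof A Φ m n ((Φ.obj (n + 1 + m)).scale (fun j => if j = i - n then 1 else 0) x) :=
    fun n x => DirectSum.toAddMonoid_of (β := fun n : ℕ => (Φ.obj (n + 1 + m)).carrier) _ n x
  have hc : ∀ n x, hcoeff A Φ m n (π x) =
      (Φ.obj (n + 1 + m)).scale (fun j => if j = i - n then 1 else 0) (hcoeff A Φ m n x) := by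
    intro n x
    refine hoch_induction (A := A) Φ (p := fun x => hcoeff A Φ m n (π x) =
      (Φ.obj (n + 1 + m)).scale (fun j => if j = i - n then 1 else 0) (hcoeff A Φ m n x)) x
      (fun k x => ?_) fun x y hx hy => by rw [map_add, map_add, map_add, map_add, hx, hy]
    rw [hπ]
    by_cases h : n = k
    · subst h; rw [hcoeff_hof_same, hcoeff_hof_same]
    · rw [hcoeff_hof_ne _ _ h, hcoeff_hof_ne _ _ h, map_zero]
  have hext : ∀ x y : (hochschild A Φ).obj m, (∀ n, hcoeff A Φ m n x = hcoeff A Φ m n y) → x = y :=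
    fun x y h => DFinsupp.ext h
  refine ⟨π, fun x hx => hext _ _ fun n => ?_, fun j hj x hx => hext _ _ fun n => ?_, hπ⟩
  · rw [hc, scale_apply (hΦ _) _ ((mem_hoch_deg Φ).1 hx n), if_pos rfl, one_smul]
  · rw [hc, scale_apply (hΦ _) _ ((mem_hoch_deg Φ).1 hx n), if_neg (by omega), zero_smul, map_zero]

variable (U : StrictUnit A)

/-- The degenerate part is defined by conditions on the coefficients. An element is the sum of its
coefficients times the l_{n+1}, so the degenerate part is also generated by the images of the
insertions. -/
theorem degenerate_le {m : ℕ} (S : AddSubgroup ((hochschild A Φ).obj m))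
    (h : ∀ n a, a < n → ∀ y : Φ.obj (n + m),
      hof A Φ m n (Φ.act y (E.tens (U.insert n a) (E.one m))) ∈ S) :
    U.degenerate Φ m ≤ S := by
  intro x hx
  refine hoch_mem_closure Φ S x fun n => ?_
  have hn : hcoeff A Φ m n x ∈ AddSubgroup.closure {x : Φ.obj (n + 1 + m) |
      ∃ a < n, ∃ y : Φ.obj (n + m), x = Φ.act y (E.tens (U.insert n a) (E.one m))} :=
    AddSubgroup.mem_iInf.1 hx n
  refine (AddSubgroup.closure_le (S.comap (hof A Φ m n))).2 ?_ hn
  rintro _ ⟨a, ha, y, rfl⟩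
  exact h n a ha y

theorem mem_degenerate {m n a : ℕ} (ha : a < n) (y : Φ.obj (n + m)) :
    hof A Φ m n (Φ.act y (E.tens (U.insert n a) (E.one m))) ∈ U.degenerate Φ m := by
  refine AddSubgroup.mem_iInf.2 fun k => ?_
  change hcoeff A Φ m k _ ∈ AddSubgroup.closure {x : Φ.obj (k + 1 + m) |
      ∃ a < k, ∃ y : Φ.obj (k + m), x = Φ.act y (E.tens (U.insert k a) (E.one m))}
  by_cases h : k = n
  · subst h
    rw [hcoeff_hof_same]
    exact AddSubgroup.subset_closure ⟨a, ha, y, rfl⟩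
  · rw [hcoeff_hof_ne _ _ h]; exact zero_mem _

/-- For a map that kills the unit insertions, the default value in `descend` is not taken. -/
theorem descend_mk {m : ℕ} {P : Type w} [AddCommGroup P] (T : (hochschild A Φ).obj m →+ P)
    (h : ∀ n a, a < n → ∀ y : Φ.obj (n + m),
      T (hof A Φ m n (Φ.act y (E.tens (U.insert n a) (E.one m)))) = 0)
    (x : (hochschild A Φ).obj m) :
    descend (U.degenerate Φ m) T (QuotientAddGroup.mk' (U.degenerate Φ m) x) = T x := by
  have h' : ∀ x ∈ U.degenerate Φ m, T x = 0 := degenerate_le Φ U T.ker h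
  rw [descend, dif_pos h']
  rfl

variable {Φ}

/-- Units are inserted among the inputs that belong to l, and f acts on the others. So the action
descends to the quotient. -/
theorem comp_insert_tens {n m m' : ℕ} (a : ℕ) (f : E.Hom m m') :
    E.comp (E.tens (U.insert n a) (E.one m)) (E.tens (E.one (n + 1)) f) =
      E.comp (E.tens (E.one n) f) (E.tens (U.insert n a) (E.one m')) := by
  rw [E.interchange_left _ _ _ (E.one_deg _), E.interchange_left _ _ _ (insert_deg U n a),
    E.comp_one, E.one_comp, E.one_comp, E.comp_one]

theorem act_face_act (hΦ : Φ.IsDGFunctor) {n m m' : ℕ} (a : ℕ) (y : Φ.obj (n + m))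
    (f : E.Hom m m') :
    Φ.act (Φ.act y (E.tens (U.insert n a) (E.one m))) (E.tens (E.one (n + 1)) f) =
      Φ.act (Φ.act y (E.tens (E.one n) f)) (E.tens (U.insert n a) (E.one m')) := by
  rw [← hΦ.act_comp, ← hΦ.act_comp, comp_insert_tens]

theorem face_deg (n a m : ℕ) : E.tens (U.insert n a) (E.one m) ∈ (E.Hom (n + m) (n + 1 + m)).deg 0 :=
  E.tens_deg 0 0 _ _ (insert_deg U n a) (E.one_deg m)

theorem face_d (n a m : ℕ) :
    (E.Hom (n + m) (n + 1 + m)).d (E.tens (U.insert n a) (E.one m)) = 0 := by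
  rw [E.tens_d 0 _ _ (insert_deg U n a), insert_d, E.one_d]; simp

theorem hof_act_hoch_mem (hΦ : Φ.IsDGFunctor) {n k a m : ℕ} (ha : a < n) (hk : k < n)
    (y : Φ.obj (n + m)) :
    hof A Φ m k (Φ.act (Φ.act y (E.tens (U.insert n a) (E.one m)))
      (E.tens (A.hoch (n + 1) (k + 1)) (E.one m))) ∈ U.degenerate Φ m := by
  rw [← hΦ.act_comp, E.interchange_right _ _ _ (E.one_deg m), E.comp_one]
  have h := insert_hoch_mem U (A := A) ha hk
  suffices hS : insSpan U n k ≤ (U.degenerate Φ m).comap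
      ((hof A Φ m k).comp ((Φ.act y).comp (E.tens.flip (E.one m)))) from hS h
  refine (AddSubgroup.closure_le _).2 ?_
  rintro _ ⟨b, hb, g, rfl⟩
  change hof A Φ m k (Φ.act y (E.tens (E.comp g (U.insert k b)) (E.one m))) ∈ U.degenerate Φ m
  have e : E.tens (E.comp g (U.insert k b)) (E.one m) =
      E.comp (E.tens g (E.one m)) (E.tens (U.insert k b) (E.one m)) := by
    rw [E.interchange_right _ _ _ (E.one_deg m), E.comp_one]
  rw [e, hΦ.act_comp]
  exact mem_degenerate Φ U hb _

/-- The class of `x` in the reduced complex. -/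
noncomputable def hmk (m : ℕ) : (hochschild A Φ).obj m →+ (U.reducedHochschild Φ).obj m :=
  QuotientAddGroup.mk' (U.degenerate Φ m)

theorem hmk_surjective (m : ℕ) : Function.Surjective (hmk (Φ := Φ) U m) :=
  QuotientAddGroup.mk'_surjective _

theorem hmk_eq_zero {m : ℕ} {x : (hochschild A Φ).obj m} (h : x ∈ U.degenerate Φ m) :
    hmk U m x = 0 := (QuotientAddGroup.eq_zero_iff x).2 h

theorem hmk_d (hΦ : Φ.IsDGFunctor) {m : ℕ} (x : (hochschild A Φ).obj m) :
    ((U.reducedHochschild Φ).obj m).d (hmk U m x) = hmk U m (((hochschild A Φ).obj m).d x) := by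
  refine descend_mk Φ U ((hmk U m).comp ((hochschild A Φ).obj m).d) (fun n a ha y => ?_) x
  refine hmk_eq_zero U ?_
  rw [hoch_d_hof, hΦ.act_d_zero _ (face_d U n a m), hΦ.act_koszul_zero _ _ (face_deg U n a m)]
  exact add_mem (mem_degenerate Φ U ha _)
    (sum_mem fun k hk => hof_act_hoch_mem U hΦ ha (Finset.mem_range.1 hk) _)

theorem hmk_act (hΦ : Φ.IsDGFunctor) {m m' : ℕ} (x : (hochschild A Φ).obj m) (f : E.Hom m m') :
    (U.reducedHochschild Φ).act (hmk U m x) f = hmk U m' ((hochschild A Φ).act x f) := by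
  refine DFunLike.congr_fun (descend_mk Φ U ((hochschild A Φ).act.compr₂ (hmk U m'))
    (fun n a ha y => ?_) x) f
  ext f
  refine hmk_eq_zero U ?_
  rw [hoch_act_hof, act_face_act U hΦ]
  exact mem_degenerate Φ U ha _

theorem hmk_mem_deg {m : ℕ} {i : ℤ} {x : (hochschild A Φ).obj m}
    (hx : x ∈ ((hochschild A Φ).obj m).deg i) :
    hmk U m x ∈ ((U.reducedHochschild Φ).obj m).deg i := ⟨x, hx, rfl⟩

theorem reduced_internal (hΦ : Φ.IsDGFunctor) (m : ℕ) :
    DirectSum.IsInternal ((U.reducedHochschild Φ).obj m).deg := by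
  obtain ⟨hint, hproj⟩ := hoch_internal (A := A) Φ (fun a => (hΦ.isComplex a).internal) m
  apply PreComplex.internal_of_proj
  · intro x
    obtain ⟨x, rfl⟩ := hmk_surjective U m x
    refine hom_induction hint (p := fun x => hmk U m x ∈ _) x (by simp)
      (fun x y hx hy => by rw [map_add]; exact add_mem hx hy) fun i x hx => ?_
    exact AddSubgroup.subset_closure ⟨i, hmk_mem_deg U hx⟩
  · intro i
    obtain ⟨π, h1, h2, h3⟩ := hproj i
    have hU : U.degenerate Φ m ≤ ((hmk U m).comp π).ker := by
      refine degenerate_le Φ U _ fun n a ha y => ?_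
      refine hmk_eq_zero U ?_
      rw [h3]
      -- Insertions have degree 0, so they commute with the projections, and these preserve the
      -- degenerate part.
      have e : (Φ.obj (n + 1 + m)).scale (fun j => if j = i - n then 1 else 0)
          (Φ.act y (E.tens (U.insert n a) (E.one m))) =
          Φ.act ((Φ.obj (n + m)).scale (fun j => if j = i - n then 1 else 0) y)
            (E.tens (U.insert n a) (E.one m)) := by
        refine hom_ext (hΦ.isComplex (n + m)).internal
          (f := ((Φ.obj (n + 1 + m)).scale (fun j => if j = i - n then 1 else 0)).comp
            (Φ.act.flip (E.tens (U.insert n a) (E.one m))))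
          (g := (Φ.act.flip (E.tens (U.insert n a) (E.one m))).comp
            ((Φ.obj (n + m)).scale (fun j => if j = i - n then 1 else 0))) (fun j y hy => ?_) y
        simp only [AddMonoidHom.comp_apply, AddMonoidHom.flip_apply]
        rw [scale_apply (hΦ.isComplex _).internal _ (hΦ.act_zero_deg hy (face_deg U n a m)),
          scale_apply (hΦ.isComplex _).internal _ hy, map_zsmul, AddMonoidHom.smul_apply]
      rw [e]
      exact mem_degenerate Φ U ha _
    refine ⟨QuotientAddGroup.lift (U.degenerate Φ m) ((hmk U m).comp π) hU, ?_, ?_⟩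
    · rintro _ ⟨x, hx, rfl⟩
      exact congrArg (hmk U m) (h1 x hx)
    · rintro j hj _ ⟨x, hx, rfl⟩
      exact (congrArg (hmk U m) (h2 j hj x hx)).trans (map_zero _)

end Hochschild

/-! ### Rules common to the two variants of the Hochschild complex -/

namespace Variant

variable {E : DGProp.{u}} {A : AInfMult E} (H : Variant A) {Φ : PreFunctor.{u, v} E.toDGCat}

/-- The morphisms `n ⟶ n + 1` whose images are divided out in the coefficients of `l_{n+1}`. -/
def IsFace (n : ℕ) (g : E.Hom n (n + 1)) : Prop :=
  match H with
  | unreduced => False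
  | reduced U => ∃ a < n, g = U.insert n a

variable {H}

theorem IsFace.deg {n : ℕ} {g : E.Hom n (n + 1)} (hg : H.IsFace n g) :
    g ∈ (E.Hom n (n + 1)).deg 0 := by
  cases H with
  | unreduced => exact hg.elim
  | reduced U => obtain ⟨a, _, rfl⟩ := hg; exact insert_deg U n a

theorem IsFace.tens_deg {n : ℕ} {g : E.Hom n (n + 1)} (hg : H.IsFace n g) (m : ℕ) :
    E.tens g (E.one m) ∈ (E.Hom (n + m) (n + 1 + m)).deg 0 :=
  E.tens_deg 0 0 _ _ hg.deg (E.one_deg m)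

variable (H)

theorem op_induction {m : ℕ} {p : (H.op Φ).obj m → Prop} (x : (H.op Φ).obj m)
    (gen : ∀ n x, p (H.gen Φ m n x)) (add : ∀ x y, p x → p y → p (x + y)) : p x := by
  cases H with
  | unreduced => exact hoch_induction (A := A) Φ x gen add
  | reduced U =>
    obtain ⟨x, rfl⟩ := hmk_surjective U m x
    exact hoch_induction (A := A) Φ (p := fun x => p (hmk U m x)) x gen
      fun x y hx hy => by rw [map_add]; exact add _ _ hx hy

theorem op_hom_ext {m : ℕ} {P : Type w} [AddCommGroup P] {f g : (H.op Φ).obj m →+ P}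
    (h : ∀ n x, f (H.gen Φ m n x) = g (H.gen Φ m n x)) (x : (H.op Φ).obj m) : f x = g x :=
  H.op_induction (p := fun x => f x = g x) x h fun x y hx hy => by rw [map_add, map_add, hx, hy]

/-- The universal property on which all later constructions rely. For the unreduced complex the
condition on faces is empty; for the reduced one it says that T vanishes on degenerate elements. -/
theorem lift_gen {m : ℕ} {P : Type w} [AddCommGroup P] (T : ∀ n : ℕ, Φ.obj (n + 1 + m) →+ P)
    (h : ∀ n g, H.IsFace n g → ∀ y : Φ.obj (n + m), T n (Φ.act y (E.tens g (E.one m))) = 0)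
    (n : ℕ) (x : Φ.obj (n + 1 + m)) : H.lift Φ m T (H.gen Φ m n x) = T n x := by
  cases H with
  | unreduced =>
    exact DirectSum.toAddMonoid_of (β := fun n : ℕ => (Φ.obj (n + 1 + m)).carrier) _ n x
  | reduced U =>
    have hT : ∀ n x, (DirectSum.toAddMonoid T : (hochschild A Φ).obj m →+ P) (hof A Φ m n x) =
      T n x := fun n x =>
        DirectSum.toAddMonoid_of (β := fun n : ℕ => (Φ.obj (n + 1 + m)).carrier) _ n x
    refine (descend_mk Φ U (DirectSum.toAddMonoid T) (fun n a ha y => ?_) (hof A Φ m n x)).trans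
      (hT n x)
    exact (hT _ _).trans (h n _ ⟨a, ha, rfl⟩ y)

theorem gen_face {n m : ℕ} {g : E.Hom n (n + 1)} (hg : H.IsFace n g) (y : Φ.obj (n + m)) :
    H.gen Φ m n (Φ.act y (E.tens g (E.one m))) = 0 := by
  cases H with
  | unreduced => exact hg.elim
  | reduced U =>
    obtain ⟨a, ha, rfl⟩ := hg
    exact hmk_eq_zero U (mem_degenerate Φ U ha y)

theorem gen_deg {m n : ℕ} {i : ℤ} {x : Φ.obj (n + 1 + m)} (hx : x ∈ (Φ.obj (n + 1 + m)).deg i) :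
    H.gen Φ m n x ∈ ((H.op Φ).obj m).deg (i + n) := by
  cases H with
  | unreduced => exact hof_deg Φ hx
  | reduced U => exact hmk_mem_deg U (hof_deg Φ hx)

theorem op_deg_le {m : ℕ} {i : ℤ} (S : AddSubgroup ((H.op Φ).obj m))
    (h : ∀ (n : ℕ) (j : ℤ) (x : Φ.obj (n + 1 + m)), x ∈ (Φ.obj (n + 1 + m)).deg j → j + n = i →
      H.gen Φ m n x ∈ S) : ((H.op Φ).obj m).deg i ≤ S := by
  cases H with
  | unreduced =>
    intro x hx
    exact hoch_mem_closure Φ S x fun n => h n (i - n) _ ((mem_hoch_deg Φ).1 hx n) (by omega)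
  | reduced U =>
    rintro _ ⟨x, hx, rfl⟩
    exact hoch_mem_closure Φ (S.comap (hmk U m)) x
      fun n => h n (i - n) _ ((mem_hoch_deg Φ).1 hx n) (by omega)

theorem d_gen (hΦ : Φ.IsDGFunctor) {m n : ℕ} (x : Φ.obj (n + 1 + m)) :
    ((H.op Φ).obj m).d (H.gen Φ m n x) = H.gen Φ m n ((Φ.obj (n + 1 + m)).d x) +
      ∑ k ∈ Finset.range n, H.gen Φ m k (Φ.act ((Φ.obj (n + 1 + m)).koszul 1 x)
        (E.tens (A.hoch (n + 1) (k + 1)) (E.one m))) := by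
  cases H with
  | unreduced => exact hoch_d_hof Φ x
  | reduced U =>
    refine (hmk_d U hΦ (hof A Φ m n x)).trans ?_
    rw [hoch_d_hof, map_add, map_sum]
    rfl

theorem act_gen (hΦ : Φ.IsDGFunctor) {m m' n : ℕ} (x : Φ.obj (n + 1 + m)) (f : E.Hom m m') :
    (H.op Φ).act (H.gen Φ m n x) f =
      H.gen Φ m' n (Φ.act x (E.tens (E.one (n + 1)) ((E.Hom m m').koszul n f))) := by
  cases H with
  | unreduced => exact hoch_act_hof Φ x f
  | reduced U =>
    refine (hmk_act U hΦ (hof A Φ m n x) f).trans ?_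
    rw [hoch_act_hof]
    rfl

theorem op_internal (hΦ : Φ.IsDGFunctor) (m : ℕ) :
    DirectSum.IsInternal ((H.op Φ).obj m).deg := by
  cases H with
  | unreduced => exact (hoch_internal (A := A) Φ (fun a => (hΦ.isComplex a).internal) m).1
  | reduced U => exact reduced_internal U hΦ m

theorem act_gen_zero (hΦ : Φ.IsDGFunctor) {m m' n : ℕ} (x : Φ.obj (n + 1 + m)) {f : E.Hom m m'}
    (hf : f ∈ (E.Hom m m').deg 0) :
    (H.op Φ).act (H.gen Φ m n x) f =
      H.gen Φ m' n (Φ.act x (E.tens (E.one (n + 1)) f)) := by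
  rw [H.act_gen hΦ, koszul_apply (E.isComplex m m').internal _ hf, mul_zero, sgn_zero, one_smul]

/-- Each term applies one m_r, of degree r - 2 = N - K - 1. Together with the drop from N - 1 to K -
1 in the degree of l this makes the differential of degree -1. -/
theorem hoch_mem_deg {N K : ℕ} (hK : K < N) :
    A.hoch N K ∈ (E.Hom N K).deg ((N : ℤ) - K - 1) := by
  have hr : 2 ≤ N + 1 - K := by omega
  have hm := A.m_deg (N + 1 - K) hr
  have hd : ((N + 1 - K : ℕ) : ℤ) - 2 = N - K - 1 := by omega
  rw [hd] at hm
  have d0 : ∀ {a b c : ℕ} {i : ℤ} {f : E.Hom a b} {g : E.Hom b c}, f ∈ (E.Hom a b).deg 0 →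
      g ∈ (E.Hom b c).deg i → E.comp f g ∈ (E.Hom a c).deg i := fun hf hg => by
    simpa using E.comp_deg _ _ _ _ hf hg
  have d0' : ∀ {a b c : ℕ} {i : ℤ} {f : E.Hom a b} {g : E.Hom b c}, f ∈ (E.Hom a b).deg i →
      g ∈ (E.Hom b c).deg 0 → E.comp f g ∈ (E.Hom a c).deg i := fun hf hg => by
    simpa using E.comp_deg _ _ _ _ hf hg
  rw [hoch_eq]
  refine add_mem (sum_mem fun a _ => AddSubgroup.zsmul_mem _ ?_ _)
    (sum_mem fun t _ => AddSubgroup.zsmul_mem _ ?_ _)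
  · refine d0' (d0 (E.eqId_deg _ _) ?_) (E.eqId_deg _ _)
    unfold DGProp.ins
    simpa using E.tens_deg _ _ _ _ (E.tens_deg _ _ _ _ (E.one_deg a) hm) (E.one_deg (K - 1 - a))
  · refine d0' (d0 (d0 (d0 (E.eqId_deg _ _) (E.sym.braid_deg _ _)) (E.eqId_deg _ _)) ?_)
      (E.eqId_deg _ _)
    simpa using E.tens_deg _ _ _ _ hm (E.one_deg (K - 1))

theorem op_act_deg (hΦ : Φ.IsDGFunctor) {a b : ℕ} (i j : ℤ) (z : (H.op Φ).obj a) (f : E.Hom a b)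
    (hz : z ∈ ((H.op Φ).obj a).deg i) (hf : f ∈ (E.Hom a b).deg j) :
    (H.op Φ).act z f ∈ ((H.op Φ).obj b).deg (i + j) := by
  refine H.op_deg_le ((((H.op Φ).obj b).deg (i + j)).comap ((H.op Φ).act.flip f)) ?_ hz
  rintro n k x hx rfl
  change (H.op Φ).act (H.gen Φ a n x) f ∈ ((H.op Φ).obj b).deg (k + n + j)
  rw [H.act_gen hΦ]
  have := H.gen_deg (m := b) (hΦ.act_deg _ _ _ _ hx (E.tens_deg _ _ _ _ (E.one_deg (n + 1))
    (koszul_deg (E.isComplex a b).internal n hf)))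
  rwa [show k + (0 + j) + (n : ℤ) = k + n + j by ring] at this

theorem op_d_deg (hΦ : Φ.IsDGFunctor) {a : ℕ} (i : ℤ) (z : (H.op Φ).obj a)
    (hz : z ∈ ((H.op Φ).obj a).deg i) : ((H.op Φ).obj a).d z ∈ ((H.op Φ).obj a).deg (i - 1) := by
  refine H.op_deg_le ((((H.op Φ).obj a).deg (i - 1)).comap ((H.op Φ).obj a).d) ?_ hz
  rintro n k x hx rfl
  rw [AddSubgroup.mem_comap, H.d_gen hΦ]
  refine add_mem ?_ (sum_mem fun l hl => ?_)
  · have := H.gen_deg ((hΦ.isComplex _).d_deg _ _ hx)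
    rwa [show k - 1 + (n : ℤ) = k + n - 1 by ring] at this
  · rw [Finset.mem_range] at hl
    have := H.gen_deg (m := a) (hΦ.act_deg _ _ _ _ (koszul_deg (hΦ.isComplex _).internal 1 hx)
      (E.tens_deg _ _ _ _ (hoch_mem_deg (A := A) (N := n + 1) (K := l + 1) (by omega))
        (E.one_deg a)))
    rwa [show k + (((n + 1 : ℕ) : ℤ) - ((l + 1 : ℕ) : ℤ) - 1 + 0) + (l : ℤ) = k + n - 1 by
      push_cast; ring] at this

/-- The diagonal part is the Leibniz rule for Φ. In the component from l_{n+1} to l_{l+1} the Koszul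
sign of the action changes by (-1)^((n-l)|f|). The interchange of f with f_{n+1,l+1}, of degree n -
l - 1, accounts for all of it but (-1)^|f|, and this is the sign in the differential, taken on x · f
instead of x. -/
theorem op_act_d (hΦ : Φ.IsDGFunctor) {a b : ℕ} (i : ℤ) (z : (H.op Φ).obj a) (f : E.Hom a b)
    (hz : z ∈ ((H.op Φ).obj a).deg i) :
    ((H.op Φ).obj b).d ((H.op Φ).act z f) = (H.op Φ).act (((H.op Φ).obj a).d z) f +
      sgn i • (H.op Φ).act z ((E.Hom a b).d f) := by
  refine H.op_deg_le ((((H.op Φ).obj b).d.comp ((H.op Φ).act.flip f)).eqLocus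
    (((H.op Φ).act.flip f).comp ((H.op Φ).obj a).d +
      sgn i • ((H.op Φ).act.flip ((E.Hom a b).d f)))) ?_ hz
  rintro n k x hx rfl
  change ((H.op Φ).obj b).d ((H.op Φ).act (H.gen Φ a n x) f) =
    (H.op Φ).act (((H.op Φ).obj a).d (H.gen Φ a n x)) f +
      sgn (k + n) • (H.op Φ).act (H.gen Φ a n x) ((E.Hom a b).d f)
  have hE := (E.isComplex a b).internal
  refine hom_ext hE (f := (((H.op Φ).obj b).d.comp ((H.op Φ).act (H.gen Φ a n x))))
    (g := (H.op Φ).act (((H.op Φ).obj a).d (H.gen Φ a n x)) +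
      (sgn (k + n) • (H.op Φ).act (H.gen Φ a n x)).comp (E.Hom a b).d) (fun j f hf => ?_) f
  simp only [AddMonoidHom.comp_apply, AddMonoidHom.add_apply, AddMonoidHom.smul_apply]
  rw [H.act_gen hΦ, H.act_gen hΦ, H.d_gen hΦ, H.d_gen hΦ, map_add, AddMonoidHom.add_apply,
    H.act_gen hΦ, map_sum, AddMonoidHom.finsetSum_apply,
    show ∀ p q r : (H.op Φ).obj b, p + q + r = p + r + q from add_right_comm]
  have e1 : (E.Hom a b).koszul n f = sgn (n * j) • f := koszul_apply hE _ hf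
  have e2 : (E.Hom a b).koszul n ((E.Hom a b).d f) = sgn (n * (j - 1)) • (E.Hom a b).d f :=
    koszul_apply hE _ ((E.isComplex a b).d_deg _ _ hf)
  have hx1 : (Φ.obj (n + 1 + a)).koszul 1 x = sgn k • x := by
    rw [koszul_apply (hΦ.isComplex _).internal 1 hx, one_mul]
  congr 1
  · rw [hΦ.act_d k _ _ hx, map_add, E.tens_d 0 _ _ (E.one_deg _), E.one_d, e1, e2]
    simp only [map_zero, AddMonoidHom.zero_apply, zero_add, map_zsmul, sgn_smul_smul]
    rw [smul_zero, zero_add, map_zsmul, map_zsmul, sgn_smul_smul]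
    congr 1
    exact sgn_smul_congr (M := (H.op Φ).obj b) _ ⟨0, by ring⟩
  · refine Finset.sum_congr rfl fun l hl => ?_
    rw [Finset.mem_range] at hl
    have hh := hoch_mem_deg (A := A) (N := n + 1) (K := l + 1) (by omega)
    have e3 : (E.Hom a b).koszul l f = sgn (l * j) • f := koszul_apply hE _ hf
    rw [H.act_gen hΦ, hΦ.act_koszul, ← hΦ.act_comp, ← hΦ.act_comp,
      koszul_apply (E.isComplex _ _).internal 1 (E.tens_deg _ _ _ _ (E.one_deg _)
        (koszul_deg hE _ hf)), e1, e3, hx1]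
    simp only [map_zsmul, AddMonoidHom.smul_apply]
    rw [E.interchange _ _ _ _ _ _ hh hf, E.interchange 0 0 _ _ _ _ (E.one_deg _) (E.one_deg _),
      E.comp_one, E.comp_one, E.one_comp, E.one_comp]
    simp only [map_zsmul, sgn_smul_smul]
    exact sgn_smul_congr _ ⟨(n - l) * j, by push_cast; ring⟩

theorem op_act_one (hΦ : Φ.IsDGFunctor) {a : ℕ} (x : (H.op Φ).obj a) :
    (H.op Φ).act x (E.one a) = x := by
  refine H.op_hom_ext (f := (H.op Φ).act.flip (E.one a)) (g := AddMonoidHom.id _)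
    (fun n x => ?_) x
  change (H.op Φ).act (H.gen Φ a n x) (E.one a) = H.gen Φ a n x
  rw [H.act_gen_zero hΦ _ (E.one_deg a), E.tens_one, hΦ.act_one]

theorem op_act_comp (hΦ : Φ.IsDGFunctor) {a b c : ℕ} (x : (H.op Φ).obj a) (f : E.Hom a b)
    (g : E.Hom b c) : (H.op Φ).act x (E.comp f g) = (H.op Φ).act ((H.op Φ).act x f) g := by
  refine H.op_hom_ext (f := (H.op Φ).act.flip (E.comp f g))
    (g := ((H.op Φ).act.flip g).comp ((H.op Φ).act.flip f)) (fun n x => ?_) x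
  change (H.op Φ).act (H.gen Φ a n x) (E.comp f g) =
    (H.op Φ).act ((H.op Φ).act (H.gen Φ a n x) f) g
  rw [H.act_gen hΦ, H.act_gen hΦ, H.act_gen hΦ, ← hΦ.act_comp,
    E.interchange_left _ _ _ (E.one_deg _), E.one_comp,
    map_koszul_bi (E.isComplex a b).internal (E.isComplex b c).internal (E.isComplex a c).internal
      (fun i j x hx y hy => E.comp_deg i j x y hx hy)]

/-- `C(Φ)` is a dg-functor if its differentials have square zero. -/
theorem op_isDGFunctor (hΦ : Φ.IsDGFunctor)
    (hd : ∀ a (x : (H.op Φ).obj a), ((H.op Φ).obj a).d (((H.op Φ).obj a).d x) = 0) :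
    (H.op Φ).IsDGFunctor where
  isComplex a := ⟨H.op_internal hΦ a, H.op_d_deg hΦ, hd a⟩
  act_deg := H.op_act_deg hΦ
  act_d := H.op_act_d hΦ
  act_one := H.op_act_one hΦ
  act_comp := H.op_act_comp hΦ

end Variant

end HochschildAction
-- Iterated Hochschild complexes and their generation by representable functors
namespace HochschildAction

/-- The two mixed terms cancel. The target is not assumed to be a complex, so d² = 0 can be deduced
there wherever the values of a pairing generate. -/
theorem IsPairing.d_d {M : PreComplex.{u}} {N : PreComplex.{v}} {P : PreComplex.{w}}
    {B : M →+ N →+ P} (h : IsPairing B) (hM : M.IsComplex) (hN : N.IsComplex) (x : M) (y : N) :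
    P.d (P.d (B x y)) = 0 := by
  rw [h.d' hM.internal, map_add, h.d' hM.internal, h.d' hM.internal, hM.d_d, hN.d_d, hM.koszul_d,
    sgn_one]
  simp

namespace Variant

variable {E : DGProp.{u}} {A : AInfMult E} (H : Variant A) (Φ : PreFunctor.{u, v} E.toDGCat)

/-- `x ↦ x ⊗ l_{k+1}`, as a map to `C^{n+1}(Φ)(m)`. -/
noncomputable def pgen (n m k : ℕ) : (H.pow n Φ).obj (k + 1 + m) →+ (H.pow (n + 1) Φ).obj m :=
  H.gen (H.pow n Φ) m k

/-- `E(a, b) ⊗ Cⁿ(E(b, -))(m) → Cⁿ(E(a, -))(m)`. -/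
noncomputable def evE (a b n m : ℕ) : E.Hom a b →+ (H.pow n (rep E.toDGCat b)).obj m →+
    (H.pow n (rep E.toDGCat a)).obj m := H.ev (rep E.toDGCat a) b n m

variable {Φ}

theorem pow_hom_ext {n m : ℕ} {P : Type w} [AddCommGroup P] {f g : (H.pow (n + 1) Φ).obj m →+ P}
    (h : ∀ k x, f (H.pgen Φ n m k x) = g (H.pgen Φ n m k x)) (x : (H.pow (n + 1) Φ).obj m) :
    f x = g x :=
  H.op_hom_ext (Φ := H.pow n Φ) h x

theorem pow_lift {n m : ℕ} {P : Type w} [AddCommGroup P]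
    (T : ∀ k : ℕ, (H.pow n Φ).obj (k + 1 + m) →+ P)
    (h : ∀ k g, H.IsFace k g → ∀ y : (H.pow n Φ).obj (k + m),
      T k ((H.pow n Φ).act y (E.tens g (E.one m))) = 0)
    (k : ℕ) (x : (H.pow n Φ).obj (k + 1 + m)) :
    (H.lift (H.pow n Φ) m T : (H.pow (n + 1) Φ).obj m →+ P) (H.pgen Φ n m k x) = T k x :=
  H.lift_gen T h k x

theorem pgen_face {n k m : ℕ} {g : E.Hom k (k + 1)} (hg : H.IsFace k g)
    (y : (H.pow n Φ).obj (k + m)) :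
    H.pgen Φ n m k ((H.pow n Φ).act y (E.tens g (E.one m))) = 0 := H.gen_face hg y

theorem pgen_deg {n m k : ℕ} {i : ℤ} {x : (H.pow n Φ).obj (k + 1 + m)}
    (hx : x ∈ ((H.pow n Φ).obj (k + 1 + m)).deg i) :
    H.pgen Φ n m k x ∈ ((H.pow (n + 1) Φ).obj m).deg (i + k) := H.gen_deg hx

theorem pow_deg_le {n m : ℕ} {i : ℤ} (S : AddSubgroup ((H.pow (n + 1) Φ).obj m))
    (h : ∀ (k : ℕ) (j : ℤ) (x : (H.pow n Φ).obj (k + 1 + m)),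
      x ∈ ((H.pow n Φ).obj (k + 1 + m)).deg j → j + k = i → H.pgen Φ n m k x ∈ S) :
    ((H.pow (n + 1) Φ).obj m).deg i ≤ S := H.op_deg_le (Φ := H.pow n Φ) S h

theorem d_pgen {n : ℕ} (hΦ : (H.pow n Φ).IsDGFunctor) {m k : ℕ}
    (x : (H.pow n Φ).obj (k + 1 + m)) :
    ((H.pow (n + 1) Φ).obj m).d (H.pgen Φ n m k x) =
      H.pgen Φ n m k (((H.pow n Φ).obj (k + 1 + m)).d x) +
      ∑ l ∈ Finset.range k, H.pgen Φ n m l ((H.pow n Φ).act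
        (((H.pow n Φ).obj (k + 1 + m)).koszul 1 x)
        (E.tens (A.hoch (k + 1) (l + 1)) (E.one m))) := H.d_gen hΦ x

theorem act_pgen {n : ℕ} (hΦ : (H.pow n Φ).IsDGFunctor) {m m' k : ℕ}
    (x : (H.pow n Φ).obj (k + 1 + m)) (f : E.Hom m m') :
    (H.pow (n + 1) Φ).act (H.pgen Φ n m k x) f =
      H.pgen Φ n m' k ((H.pow n Φ).act x (E.tens (E.one (k + 1)) ((E.Hom m m').koszul k f))) :=
  H.act_gen hΦ x f

theorem act_pgen_zero {n : ℕ} (hΦ : (H.pow n Φ).IsDGFunctor) {m m' k : ℕ}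
    (x : (H.pow n Φ).obj (k + 1 + m)) {f : E.Hom m m'} (hf : f ∈ (E.Hom m m').deg 0) :
    (H.pow (n + 1) Φ).act (H.pgen Φ n m k x) f =
      H.pgen Φ n m' k ((H.pow n Φ).act x (E.tens (E.one (k + 1)) f)) :=
  H.act_gen_zero hΦ x hf

end Variant

section

variable {E : DGProp.{u}} {A : AInfMult E} {H : Variant A}

namespace Extension

variable (X : Extension H)
include X

/-- The iterated Hochschild complexes of the representable functors are dg-functors. -/
theorem pow_rep_isDGFunctor (n a : ℕ) : (H.pow n (rep E.toDGCat a)).IsDGFunctor := by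
  induction n with
  | zero => exact rep_isDGFunctor _ a
  | succ n ih =>
    refine H.op_isDGFunctor ih fun m (x : (H.pow (n + 1) (rep E.toDGCat a)).obj m) => ?_
    -- The differential corresponds under ι to that of a morphism complex of Ẽ, where its square is
    -- zero.
    have h1 := X.ι_d a m (n + 1) (((H.pow (n + 1) (rep E.toDGCat a)).obj m).d x)
    conv_rhs at h1 => rw [X.ι_d, (X.cat.isComplex _ _).d_d]
    exact (X.ι a m (n + 1)).injective (h1.trans (map_zero _).symm)

end Extension

/-- The properties of `Cⁿ(Φ)` and of the maps `Φ(a) ⊗ Cⁿ(E(a, -)) → Cⁿ(Φ)`. -/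
structure EvFacts (H : Variant A) (Φ : PreFunctor.{u, v} E.toDGCat) (n : ℕ) : Prop where
  dg : (H.pow n Φ).IsDGFunctor
  act : ∀ {a m m' : ℕ} (x : Φ.obj a) (z : (H.pow n (rep E.toDGCat a)).obj m) (f : E.Hom m m'),
    H.ev Φ a n m' x ((H.pow n (rep E.toDGCat a)).act z f) = (H.pow n Φ).act (H.ev Φ a n m x z) f
  pairing : ∀ a m : ℕ, IsPairing (H.ev Φ a n m)
  deg_le : ∀ (m : ℕ) (i : ℤ), ((H.pow n Φ).obj m).deg i ≤
    AddSubgroup.closure {w | ∃ (a : ℕ) (j k : ℤ) (x : Φ.obj a)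
      (z : (H.pow n (rep E.toDGCat a)).obj m), x ∈ (Φ.obj a).deg j ∧
      z ∈ ((H.pow n (rep E.toDGCat a)).obj m).deg k ∧ j + k = i ∧ w = H.ev Φ a n m x z}

/-- The co-Yoneda principle: a statement about Cⁿ(Φ) only has to be checked on elements x · z with z
in a representable case. -/
theorem EvFacts.induction {Φ : PreFunctor.{u, v} E.toDGCat} {n : ℕ} (h : EvFacts H Φ n) {m : ℕ}
    {p : (H.pow n Φ).obj m → Prop} (w : (H.pow n Φ).obj m) (add : ∀ x y, p x → p y → p (x + y))
    (neg : ∀ x, p x → p (-x))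
    (ev : ∀ (a : ℕ) (j k : ℤ) (x : Φ.obj a) (z : (H.pow n (rep E.toDGCat a)).obj m),
      x ∈ (Φ.obj a).deg j → z ∈ ((H.pow n (rep E.toDGCat a)).obj m).deg k →
        p (H.ev Φ a n m x z)) : p w := by
  have h0 : p 0 := by simpa using ev 0 0 0 0 0 (zero_mem _) (zero_mem _)
  refine hom_induction (h.dg.isComplex m).internal w h0 add fun i x hx => ?_
  refine AddSubgroup.closure_induction (p := fun x _ => p x) ?_ h0 (fun x y _ _ => add x y)
    (fun x _ => neg x) (h.deg_le m i hx)
  rintro _ ⟨a, j, k, x, z, hx, hz, -, rfl⟩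
  exact ev a j k x z hx hz

theorem EvFacts.hom_ext {Φ : PreFunctor.{u, v} E.toDGCat} {n : ℕ} (h : EvFacts H Φ n) {m : ℕ}
    {P : Type w} [AddCommGroup P] {f g : (H.pow n Φ).obj m →+ P}
    (hfg : ∀ (a : ℕ) (j k : ℤ) (x : Φ.obj a) (z : (H.pow n (rep E.toDGCat a)).obj m),
      x ∈ (Φ.obj a).deg j → z ∈ ((H.pow n (rep E.toDGCat a)).obj m).deg k →
        f (H.ev Φ a n m x z) = g (H.ev Φ a n m x z)) (w : (H.pow n Φ).obj m) : f w = g w :=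
  h.induction (p := fun w => f w = g w) w (fun x y hx hy => by rw [map_add, map_add, hx, hy])
    (fun x hx => by rw [map_neg, map_neg, hx]) hfg

/-- Evaluation at level n commutes with the action of E, hence it maps faces to faces, and the map
at level n + 1 is well defined. -/
theorem ev_gen_of {Φ : PreFunctor.{u, v} E.toDGCat} {n : ℕ} (h : EvFacts H Φ n) {a m k : ℕ}
    (x : Φ.obj a) (z : (H.pow n (rep E.toDGCat a)).obj (k + 1 + m)) :
    H.ev Φ a (n + 1) m x (H.pgen (rep E.toDGCat a) n m k z) =
      H.pgen Φ n m k (H.ev Φ a n (k + 1 + m) x z) := by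
  refine DFunLike.congr_fun (H.pow_lift (Φ := rep E.toDGCat a) (m := m) (fun k =>
      ((H.ev Φ a n (k + 1 + m)).compr₂ (H.pgen Φ n m k)).flip)
      (fun l g hg y => ?_) k z) x
  ext x
  change H.pgen Φ n m l (H.ev Φ a n (l + 1 + m) x _) = 0
  rw [h.act, H.pgen_face hg]

namespace Extension

variable (X : Extension H)
include X

/-- The facts are proved together because they depend on each other: evaluation at level n + 1 is
well defined by its equivariance at level n, and Cⁿ⁺¹(Φ) is a complex because evaluation at that
level is a pairing whose values generate. -/
theorem evFacts {Φ : PreFunctor.{u, v} E.toDGCat} (hΦ : Φ.IsDGFunctor) (n : ℕ) :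
    EvFacts H Φ n := by
  induction n with
  | zero =>
    refine ⟨hΦ, fun x z f => hΦ.act_comp x z f, fun a m => hΦ.pairing a m, fun m i x hx => ?_⟩
    -- At level 0 one has x = x · id.
    exact AddSubgroup.subset_closure ⟨m, i, 0, x, E.one m, hx, E.one_deg m, add_zero i,
      (hΦ.act_one x).symm⟩
  | succ n ih =>
    have hR := fun a => X.pow_rep_isDGFunctor n a
    have hact : ∀ {a m m' : ℕ} (x : Φ.obj a) (z : (H.pow (n + 1) (rep E.toDGCat a)).obj m)
        (f : E.Hom m m'), H.ev Φ a (n + 1) m' x ((H.pow (n + 1) (rep E.toDGCat a)).act z f) =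
          (H.pow (n + 1) Φ).act (H.ev Φ a (n + 1) m x z) f := by
      intro a m m' x z f
      refine H.pow_hom_ext (Φ := rep E.toDGCat a)
        (f := (H.ev Φ a (n + 1) m' x).comp ((H.pow (n + 1) (rep E.toDGCat a)).act.flip f))
        (g := ((H.pow (n + 1) Φ).act.flip f).comp (H.ev Φ a (n + 1) m x)) (fun k z => ?_) z
      change H.ev Φ a (n + 1) m' x ((H.pow (n + 1) (rep E.toDGCat a)).act
        (H.pgen (rep E.toDGCat a) n m k z) f) = (H.pow (n + 1) Φ).act
          (H.ev Φ a (n + 1) m x (H.pgen (rep E.toDGCat a) n m k z)) f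
      rw [H.act_pgen (hR a), ev_gen_of ih, ev_gen_of ih, H.act_pgen ih.dg, ih.act]
    have hpair : ∀ a m : ℕ, IsPairing (H.ev Φ a (n + 1) m) := by
      intro a m
      refine ⟨fun i j x z hx hz => ?_, fun i x z hx => ?_⟩
      · refine H.pow_deg_le (Φ := rep E.toDGCat a)
          ((((H.pow (n + 1) Φ).obj m).deg (i + j)).comap (H.ev Φ a (n + 1) m x)) ?_ hz
        rintro k l y hy rfl
        rw [AddSubgroup.mem_comap, ev_gen_of ih]
        have := H.pgen_deg ((ih.pairing a (k + 1 + m)).deg i l x y hx hy)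
        rwa [add_assoc] at this
      · refine H.pow_hom_ext (Φ := rep E.toDGCat a)
          (f := ((H.pow (n + 1) Φ).obj m).d.comp (H.ev Φ a (n + 1) m x))
          (g := H.ev Φ a (n + 1) m ((Φ.obj a).d x) + sgn i • (H.ev Φ a (n + 1) m x).comp
            ((H.pow (n + 1) (rep E.toDGCat a)).obj m).d) (fun k z => ?_) z
        change ((H.pow (n + 1) Φ).obj m).d (H.ev Φ a (n + 1) m x
            (H.pgen (rep E.toDGCat a) n m k z)) = H.ev Φ a (n + 1) m ((Φ.obj a).d x)
            (H.pgen (rep E.toDGCat a) n m k z) + sgn i • (H.ev Φ a (n + 1) m x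
            (((H.pow (n + 1) (rep E.toDGCat a)).obj m).d
              (H.pgen (rep E.toDGCat a) n m k z)))
        rw [H.d_pgen (hR a), ev_gen_of ih, ev_gen_of ih, map_add, ev_gen_of ih, H.d_pgen ih.dg,
          (ih.pairing a _).d i x _ hx, map_sum, smul_add, map_add, map_zsmul, add_assoc,
          (ih.pairing a _).koszul (hΦ.isComplex _) ((hR a).isComplex _) (ih.dg.isComplex _),
          koszul_apply (hΦ.isComplex _).internal 1 hx, Finset.smul_sum]
        congr 2
        refine Finset.sum_congr rfl fun l _ => ?_
        rw [ev_gen_of ih, ih.act, one_mul]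
        simp only [map_zsmul, AddMonoidHom.smul_apply]
    have hdeg : ∀ (m : ℕ) (i : ℤ), ((H.pow (n + 1) Φ).obj m).deg i ≤
        AddSubgroup.closure {w | ∃ (a : ℕ) (j k : ℤ) (x : Φ.obj a)
          (z : (H.pow (n + 1) (rep E.toDGCat a)).obj m), x ∈ (Φ.obj a).deg j ∧
          z ∈ ((H.pow (n + 1) (rep E.toDGCat a)).obj m).deg k ∧ j + k = i ∧
            w = H.ev Φ a (n + 1) m x z} := by
      intro m i
      refine H.pow_deg_le (Φ := Φ) _ fun k j w hw hkj => ?_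
      have := ih.deg_le _ _ hw
      refine (AddSubgroup.closure_le (AddSubgroup.comap (H.pgen Φ n m k)
        (AddSubgroup.closure {w | ∃ (a : ℕ) (j k : ℤ) (x : Φ.obj a)
          (z : (H.pow (n + 1) (rep E.toDGCat a)).obj m), x ∈ (Φ.obj a).deg j ∧
          z ∈ ((H.pow (n + 1) (rep E.toDGCat a)).obj m).deg k ∧ j + k = i ∧
            w = H.ev Φ a (n + 1) m x z}))).2 ?_ this
      rintro _ ⟨a, j', k', x, z, hx, hz, hjk, rfl⟩
      refine AddSubgroup.subset_closure ⟨a, j', k' + k, x, H.pgen _ n m k z, hx, H.pgen_deg hz,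
        by omega, ?_⟩
      rw [ev_gen_of ih]
    -- Only d² = 0 is left. On the generators x · z it follows from d² = 0 in Φ(a) and in the
    -- complex of the representable functor.
    refine ⟨H.op_isDGFunctor ih.dg fun m z => ?_, hact, hpair, hdeg⟩
    refine HochschildAction.hom_ext (M := (H.pow (n + 1) Φ).obj m) (H.op_internal ih.dg m)
      (f := ((H.pow (n + 1) Φ).obj m).d.comp ((H.pow (n + 1) Φ).obj m).d) (g := 0)
      (fun i z hz => ?_) z
    refine (AddSubgroup.closure_le
      (((H.pow (n + 1) Φ).obj m).d.comp ((H.pow (n + 1) Φ).obj m).d).ker).2 ?_ (hdeg m i hz)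
    rintro _ ⟨a, j, k, x, z, -, -, -, rfl⟩
    exact (hpair a m).d_d (hΦ.isComplex a) ((X.pow_rep_isDGFunctor (n + 1) a).isComplex m) x z

theorem evE_gen {n a b m k : ℕ} (f : E.Hom a b)
    (z : (H.pow n (rep E.toDGCat b)).obj (k + 1 + m)) :
    H.evE a b (n + 1) m f (H.pgen (rep E.toDGCat b) n m k z) =
      H.pgen (rep E.toDGCat a) n m k (H.evE a b n (k + 1 + m) f z) :=
  ev_gen_of (X.evFacts (rep_isDGFunctor _ a) n) f z

theorem ι_evE {a b m n : ℕ} (f : E.Hom a b) (z : (H.pow n (rep E.toDGCat b)).obj m) :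
    X.ι a m n (H.evE a b n m f z) = X.cat.comp (X.ι a b 0 f) (X.ι b m n z) :=
  (X.ι_comp a b m n f z).symm

variable {Φ : PreFunctor.{u, v} E.toDGCat} (hΦ : Φ.IsDGFunctor)
include hΦ

theorem pow_isDGFunctor (n : ℕ) : (H.pow n Φ).IsDGFunctor := (X.evFacts hΦ n).dg

theorem ev_gen {n a m k : ℕ} (x : Φ.obj a) (z : (H.pow n (rep E.toDGCat a)).obj (k + 1 + m)) :
    H.ev Φ a (n + 1) m x (H.pgen (rep E.toDGCat a) n m k z) =
      H.pgen Φ n m k (H.ev Φ a n (k + 1 + m) x z) := ev_gen_of (X.evFacts hΦ n) x z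

/-- The relation x · (f · z) = (x · f) · z between the generators of Cⁿ(Φ)(m). A formula in x and z
must respect it in order to define a map on Cⁿ(Φ)(m). -/
theorem ev_ev {n a b m : ℕ} (x : Φ.obj a) (f : E.Hom a b)
    (z : (H.pow n (rep E.toDGCat b)).obj m) :
    H.ev Φ a n m x (H.evE a b n m f z) = H.ev Φ b n m (Φ.act x f) z := by
  induction n generalizing m with
  | zero => exact hΦ.act_comp x f z
  | succ n ih =>
    refine H.pow_hom_ext (Φ := rep E.toDGCat b)
      (f := (H.ev Φ a (n + 1) m x).comp (H.evE a b (n + 1) m f))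
      (g := H.ev Φ b (n + 1) m (Φ.act x f)) (fun k z => ?_) z
    change H.ev Φ a (n + 1) m x (H.evE a b (n + 1) m f
      (H.pgen (rep E.toDGCat b) n m k z)) = _
    rw [X.ev_gen hΦ, X.evE_gen, X.ev_gen hΦ, ih]

/-- A Yoneda argument: `ofUniversal` only uses T on the elements id_a ⊗ l. Additivity in z and
compatibility with x · (f · z) = (x · f) · z, which is the condition `hT`, determine all other
values. -/
theorem ofUniversal_ev {P : Type w} [AddCommGroup P] (n m : ℕ)
    (T : ∀ a, (H.pow n (rep E.toDGCat a)).obj m → (Φ.obj a →+ P))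
    (hadd : ∀ a z z', T a (z + z') = T a z + T a z')
    (hT : ∀ a b (f : E.Hom a b) z x, T b z (Φ.act x f) = T a (H.evE a b n m f z) x)
    {a : ℕ} (x : Φ.obj a) (z : (H.pow n (rep E.toDGCat a)).obj m) :
    H.ofUniversal Φ n m T (H.ev Φ a n m x z) = T a z x := by
  have hz0 : ∀ a, T a 0 = 0 := fun a => by simpa using hadd a 0 0
  induction n generalizing m a with
  | zero =>
    -- At level 0 the element z is itself a morphism of E and can be moved across onto x.
    refine (hT a m z (E.one m : E.Hom m m) x).trans ?_
    exact congrArg (fun w => T a w x) (E.comp_one z)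
  | succ n ih =>
    have ih' : ∀ (k : ℕ) {a : ℕ} (x : Φ.obj a) (z : (H.pow n (rep E.toDGCat a)).obj (k + 1 + m)),
        H.ofUniversal Φ n (k + 1 + m) (fun a z => T a (H.pgen (rep E.toDGCat a) n m k z))
          (H.ev Φ a n (k + 1 + m) x z) = T a (H.pgen (rep E.toDGCat a) n m k z) x := by
      intro k a x z
      refine ih (k + 1 + m) (fun a z => T a (H.pgen (rep E.toDGCat a) n m k z))
        (fun a z z' => ?_) (fun a b f z x => ?_) x z fun a => ?_
      · rw [map_add]; exact hadd _ _ _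
      · rw [hT, X.evE_gen]
      · rw [map_zero]; exact hz0 a
    refine H.pow_hom_ext (Φ := rep E.toDGCat a)
      (f := (H.ofUniversal Φ (n + 1) m T).comp (H.ev Φ a (n + 1) m x))
      (g := AddMonoidHom.mk' (fun z => T a z x) fun z z' => by
        rw [hadd, AddMonoidHom.add_apply]) (fun k z => ?_) z
    rw [AddMonoidHom.comp_apply, X.ev_gen hΦ]
    -- To see that faces are killed, y is written through elements y' · z. There the induction
    -- hypothesis brings the face into the representable functor, where it becomes zero.
    refine (H.pow_lift (Φ := Φ) _ (fun l g hg y => ?_) k _).trans (ih' k x z)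
    refine (X.evFacts hΦ n).hom_ext (f := (H.ofUniversal Φ n (l + 1 + m) fun a z =>
      T a (H.pgen (rep E.toDGCat a) n m l z)).comp
        ((H.pow n Φ).act.flip (E.tens g (E.one m)))) (g := 0) (fun b _ _ y z _ _ => ?_) y
    rw [AddMonoidHom.comp_apply, AddMonoidHom.flip_apply, ← (X.evFacts hΦ n).act, ih',
      H.pgen_face hg, hz0]
    rfl

/-- The action of `E(a, -)` extended to `Ẽ`: `Φ(a) ⊗ Ẽ((a, 0), p) → C^{p.2}(Φ)(p.1)`. -/
noncomputable def evX (_ : Φ.IsDGFunctor) (a : ℕ) (p : ℕ × ℕ) :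
    Φ.obj a →+ X.cat.Hom (a, 0) p →+ (H.pow p.2 Φ).obj p.1 :=
  (H.ev Φ a p.2 p.1).compl₂ (X.ι a p.1 p.2).symm.toAddMonoidHom

theorem evX_ι {a : ℕ} {p : ℕ × ℕ} (x : Φ.obj a) (z : (H.pow p.2 (rep E.toDGCat a)).obj p.1) :
    X.evX hΦ a p x (X.ι a p.1 p.2 z) = H.ev Φ a p.2 p.1 x z := by
  change H.ev Φ a p.2 p.1 x ((X.ι a p.1 p.2).symm (X.ι a p.1 p.2 z)) = _
  rw [AddEquiv.symm_apply_apply]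

/-- The formula (x · z) · f = x · (z · f). It holds for all z, not only for the id_a ⊗ l of the
definition, by associativity of the composition in Ẽ. -/
theorem act_ev {p q : ℕ × ℕ} {a : ℕ} (x : Φ.obj a)
    (z : (H.pow p.2 (rep E.toDGCat a)).obj p.1) (f : X.cat.Hom p q) :
    X.act Φ p q (H.ev Φ a p.2 p.1 x z) f = X.evX hΦ a q x (X.cat.comp (X.ι a p.1 p.2 z) f) := by
  refine DFunLike.congr_fun (X.ofUniversal_ev hΦ p.2 p.1 (fun a z =>
    (H.ev Φ a q.2 q.1).compl₂
      ((X.ι a q.1 q.2).symm.toAddMonoidHom.comp (X.cat.comp (X.ι a p.1 p.2 z))))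
      (fun a z z' => ?_) (fun a b f z x => ?_) x z) f
  · ext x g
    simp
  · ext g
    change H.ev Φ b q.2 q.1 (Φ.act x f) ((X.ι b q.1 q.2).symm (X.cat.comp (X.ι b p.1 p.2 z) g)) =
      H.ev Φ a q.2 q.1 x ((X.ι a q.1 q.2).symm (X.cat.comp (X.ι a p.1 p.2
        (H.evE a b p.2 p.1 f z)) g))
    rw [← X.ev_ev hΦ]
    congr 1
    rw [AddEquiv.eq_symm_apply]
    rw [X.ι_evE, X.ι_evE, AddEquiv.apply_symm_apply]
    exact (X.cat.comp_assoc _ _ _).symm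

end Extension

end

end HochschildAction
namespace HochschildAction

/-! ### Products of iterated Hochschild complexes -/

section Products

open Arr

variable {E : DGProp.{u}} {A : AInfMult E} (H : Variant A)

/-- The permutation that moves a block of `k` inputs in front of a block of `a` inputs. -/
noncomputable def blockMove (E : DGProp.{u}) (a k b : ℕ) : E.Hom (a + (k + b)) (k + (a + b)) :=
  E.comp (E.comp (E.eqId (a + (k + b)) (a + k + b)) (E.tens (E.sym.braid a k) (E.one b)))
    (E.eqId (k + a + b) (k + (a + b)))

theorem of_blockMove (a k b : ℕ) :
    of (blockMove E a k b) = of (E.sym.braid a k) * I E.toDGCat b := by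
  unfold blockMove
  rw [of_comp, of_comp, of_tens, of_eqId (by omega), of_eqId (by omega), I_cmp (by simp; omega),
    cmp_I (by simp), of_one]

/-- Naturality of the symmetry. For h the insertion of a unit it says that a face of the second
factor is a face of the product. -/
theorem blockMove_natural {a a' k k' b b' : ℕ} {f : E.Hom a a'} {h : E.Hom k k'} {g : E.Hom b b'}
    (hf : f ∈ (E.Hom a a').deg 0) (hh : h ∈ (E.Hom k k').deg 0) :
    E.comp (E.tens f (E.tens h g)) (blockMove E a' k' b') =
      E.comp (blockMove E a k b) (E.tens h (E.tens f g)) := by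
  apply of_injective
  have zf : (of f).Zero := hf
  have zh : (of h).Zero := hh
  have zB : (of (E.sym.braid a' k')).Zero := E.sym.braid_deg a' k'
  rw [of_comp, of_comp, of_blockMove, of_blockMove, of_tens, of_tens, of_tens, of_tens,
    ← mul_assoc, ← mul_assoc, mul_cmp_mul (by simp) (by simp) zB,
    mul_cmp_mul (by simp) (by simp) (Zero.mul (D := E.toMonDGCat) zh zf),
    mul_cmp_braid E.sym (F := of f) (G := of h) (a := a') (b := k') rfl rfl (.inl zf),
    cmp_I (by simp), I_cmp (by simp)]
  rfl

/-- The inverse of `blockMove`. -/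
noncomputable def blockBack (E : DGProp.{u}) (a k b : ℕ) : E.Hom (k + (a + b)) (a + (k + b)) :=
  blockMove E k a b

theorem blockMove_blockBack (a k b : ℕ) :
    E.comp (blockMove E a k b) (blockBack E a k b) = E.one (a + (k + b)) := by
  apply of_injective
  unfold blockBack
  have zB : (of (E.sym.braid k a)).Zero := E.sym.braid_deg k a
  rw [of_comp, of_blockMove, of_blockMove, mul_cmp_mul (by simp) (by simp) zB,
    ← of_comp, E.sym.braid_braid, cmp_I (by simp), of_one, of_one, ← I_add, add_assoc]

theorem blockBack_blockMove (a k b : ℕ) :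
    E.comp (blockBack E a k b) (blockMove E a k b) = E.one (k + (a + b)) :=
  blockMove_blockBack k a b

variable {F G K : PreFunctor.{u, v} E.toDGCat}

/-- A product, natural for the morphisms of degree `0`. -/
structure IsProduct (p : ∀ a b, F.obj a →+ G.obj b →+ K.obj (a + b)) : Prop where
  left : ∀ n, (H.pow n F).IsDGFunctor
  mid : ∀ n, (H.pow n G).IsDGFunctor
  right : ∀ n, (H.pow n K).IsDGFunctor
  nat : ∀ {a a' b b' : ℕ} (x : F.obj a) (y : G.obj b) {f : E.Hom a a'} {g : E.Hom b b'},
    f ∈ (E.Hom a a').deg 0 → g ∈ (E.Hom b b').deg 0 →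
    p a' b' (F.act x f) (G.act y g) = K.act (p a b x y) (E.tens f g)

variable {H} {p : ∀ a b, F.obj a →+ G.obj b →+ K.obj (a + b)}

namespace IsProduct

variable (hp : IsProduct H p)
include hp

/-- The product with values in `Cⁿ` is natural for the morphisms of degree `0`. -/
def RNat (_ : IsProduct H p) (n : ℕ) : Prop :=
  ∀ {a a' b b' : ℕ} (x : (H.pow n F).obj a) (y : G.obj b) {f : E.Hom a a'} {g : E.Hom b b'},
    f ∈ (E.Hom a a').deg 0 → g ∈ (E.Hom b b').deg 0 →
    H.rmul p n a' b' ((H.pow n F).act x f) (G.act y g) =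
      (H.pow n K).act (H.rmul p n a b x y) (E.tens f g)

/-- Naturality of the product at level n makes the product at level n + 1 kill faces. This formula
in turn gives naturality at level n + 1, so the two are established alternately. -/
theorem rmul_pgen_of {n : ℕ} (hn : hp.RNat n) {a b k : ℕ} (x : (H.pow n F).obj (k + 1 + a))
    (y : G.obj b) : H.rmul p (n + 1) a b (H.pgen F n a k x) y =
      H.pgen K n (a + b) k ((H.pow n K).act (H.rmul p n (k + 1 + a) b x ((G.obj b).koszul k y))
        (E.eqId (k + 1 + a + b) (k + 1 + (a + b)))) := by
  refine DFunLike.congr_fun (H.pow_lift (Φ := F) (n := n) (m := a)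
    (P := G.obj b →+ (H.pow (n + 1) K).obj (a + b)) (fun k =>
    biadd (fun x y => H.gen (H.pow n K) (a + b) k
      ((H.pow n K).act (H.rmul p n (k + 1 + a) b x ((G.obj b).koszul k y))
        (E.eqId (k + 1 + a + b) (k + 1 + (a + b)))))
        (fun x x' y => by simp; rfl) (fun x y y' => by simp; rfl)) (fun l g hg x => ?_) k x) y
  ext y
  change H.pgen K n (a + b) l ((H.pow n K).act (H.rmul p n (l + 1 + a) b
    ((H.pow n F).act x (E.tens g (E.one a))) ((G.obj b).koszul l y))
        (E.eqId (l + 1 + a + b) (l + 1 + (a + b)))) = 0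
  have h := hn x ((G.obj b).koszul l y) (hg.tens_deg a) (E.one_deg b)
  have hG : G.IsDGFunctor := hp.mid 0
  rw [hG.act_one] at h
  rw [h, ← (hp.right n).act_comp, E.tens_assoc, E.tens_one, (hp.right n).act_comp,
    H.pgen_face hg]

theorem rNat (n : ℕ) : hp.RNat n := by
  induction n with
  | zero => intro a a' b b' x y f g hf hg; exact hp.nat x y hf hg
  | succ n ih =>
    intro a a' b b' x y f g hf hg
    refine H.pow_hom_ext (Φ := F)
      (f := ((H.rmul p (n + 1) a' b').flip (G.act y g)).comp ((H.pow (n + 1) F).act.flip f))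
      (g := ((H.pow (n + 1) K).act.flip (E.tens f g)).comp ((H.rmul p (n + 1) a b).flip y))
      (fun k x => ?_) x
    change H.rmul p (n + 1) a' b' ((H.pow (n + 1) F).act (H.pgen F n a k x) f) (G.act y g) =
      (H.pow (n + 1) K).act (H.rmul p (n + 1) a b (H.pgen F n a k x) y) (E.tens f g)
    have hG : G.IsDGFunctor := hp.mid 0
    rw [H.act_pgen_zero (hp.left n) _ hf, hp.rmul_pgen_of ih, hp.rmul_pgen_of ih,
      hG.act_koszul_zero _ _ hg, ih _ _ (E.tens_deg 0 0 _ _ (E.one_deg _) hf) hg,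
      H.act_pgen_zero (hp.right n) _ (E.tens_deg 0 0 _ _ hf hg), ← (hp.right n).act_comp,
      ← (hp.right n).act_comp, E.tens_assoc]

theorem rmul_pgen {n a b k : ℕ} (x : (H.pow n F).obj (k + 1 + a)) (y : G.obj b) :
    H.rmul p (n + 1) a b (H.pgen F n a k x) y =
      H.pgen K n (a + b) k ((H.pow n K).act (H.rmul p n (k + 1 + a) b x ((G.obj b).koszul k y))
        (E.eqId (k + 1 + a + b) (k + 1 + (a + b)))) := hp.rmul_pgen_of (hp.rNat n) x y

/-- The product `Cⁿ ⊗ Cⁿ' → Cⁿ⁺ⁿ'` is natural for the morphisms of degree `0`. -/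
def PNat (_ : IsProduct H p) (n n' : ℕ) : Prop :=
  ∀ {a a' b b' : ℕ} (x : (H.pow n F).obj a) (y : (H.pow n' G).obj b) {f : E.Hom a a'}
    {g : E.Hom b b'}, f ∈ (E.Hom a a').deg 0 → g ∈ (E.Hom b b').deg 0 →
    H.pair p n n' a' b' ((H.pow n F).act x f) ((H.pow n' G).act y g) =
      (H.pow (n + n') K).act (H.pair p n n' a b x y) (E.tens f g)

/-- The same alternation as for `rmul_pgen_of`, now in the second factor. -/
theorem pair_pgen_of {n n' : ℕ} (hn : hp.PNat n n') {a b k : ℕ} (x : (H.pow n F).obj a)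
    (y : (H.pow n' G).obj (k + 1 + b)) : H.pair p n (n' + 1) a b x (H.pgen G n' b k y) =
      H.pgen K (n + n') (a + b) k ((H.pow (n + n') K).act (H.pair p n n' a (k + 1 + b) x y)
        (blockMove E a (k + 1) b)) := by
  refine DFunLike.congr_fun (H.pow_lift (Φ := G) (n := n') (m := b)
    (P := (H.pow n F).obj a →+ (H.pow (n + n' + 1) K).obj (a + b)) (fun k =>
    biadd (fun y x => H.gen (H.pow (n + n') K) (a + b) k
          ((H.pow (n + n') K).act (H.pair p n n' a (k + 1 + b) x y)
            (E.comp (E.comp (E.eqId (a + (k + 1 + b)) (a + (k + 1) + b))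
              (E.tens (E.sym.braid a (k + 1)) (E.one b)))
              (E.eqId (k + 1 + a + b) (k + 1 + (a + b))))))
        (fun y y' x => by simp; rfl) (fun y x x' => by simp; rfl)) (fun l g hg y => ?_) k y) x
  ext x
  change H.pgen K (n + n') (a + b) l ((H.pow (n + n') K).act (H.pair p n n' a (l + 1 + b) x
    ((H.pow n' G).act y (E.tens g (E.one b)))) (blockMove E a (l + 1) b)) = 0
  have h := hn x y (E.one_deg a) (hg.tens_deg b)
  rw [(hp.left n).act_one] at h
  rw [h, ← (hp.right _).act_comp, blockMove_natural (E.one_deg a) hg.deg, E.tens_one,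
    (hp.right _).act_comp, H.pgen_face hg]

theorem pNat (n n' : ℕ) : hp.PNat n n' := by
  induction n' with
  | zero => intro a a' b b' x y f g hf hg; exact hp.rNat n x y hf hg
  | succ n' ih =>
    intro a a' b b' x y f g hf hg
    refine H.pow_hom_ext (Φ := G)
      (f := (H.pair p n (n' + 1) a' b' ((H.pow n F).act x f)).comp
        ((H.pow (n' + 1) G).act.flip g))
      (g := ((H.pow (n + n' + 1) K).act.flip (E.tens f g)).comp (H.pair p n (n' + 1) a b x))
      (fun k y => ?_) y
    change H.pair p n (n' + 1) a' b' ((H.pow n F).act x f)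
        ((H.pow (n' + 1) G).act (H.pgen G n' b k y) g) =
      (H.pow (n + n' + 1) K).act (H.pair p n (n' + 1) a b x (H.pgen G n' b k y)) (E.tens f g)
    rw [H.act_pgen_zero (hp.mid n') _ hg, hp.pair_pgen_of ih, hp.pair_pgen_of ih,
      ih _ _ hf (E.tens_deg 0 0 _ _ (E.one_deg _) hg),
      H.act_pgen_zero (hp.right _) _ (E.tens_deg 0 0 _ _ hf hg), ← (hp.right _).act_comp,
      ← (hp.right _).act_comp, blockMove_natural hf (E.one_deg _)]

theorem pair_pgen {n n' a b k : ℕ} (x : (H.pow n F).obj a)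
    (y : (H.pow n' G).obj (k + 1 + b)) : H.pair p n (n' + 1) a b x (H.pgen G n' b k y) =
      H.pgen K (n + n') (a + b) k ((H.pow (n + n') K).act (H.pair p n n' a (k + 1 + b) x y)
        (blockMove E a (k + 1) b)) := hp.pair_pgen_of (hp.pNat n n') x y

end IsProduct

/-! ### The products of a split functor are isomorphisms -/

theorem onTensor_bijective {M : PreComplex.{u}} {N : PreComplex.{v}} {P : Type w} [AddCommGroup P]
    {B : M →+ N →+ P} (g : P →+ tensor M N) (hg : ∀ x y, g (B x y) = tmk x y)
    (hs : (onTensor B).range = ⊤) : Function.Bijective (onTensor B) := by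
  refine ⟨?_, fun z => ?_⟩
  · have : g.comp (onTensor B) = AddMonoidHom.id _ := tensor_hom_ext hg
    exact Function.LeftInverse.injective (DFunLike.congr_fun this)
  · have : z ∈ (onTensor B).range := by rw [hs]; trivial
    exact this

theorem onTensor_induction {M : PreComplex.{u}} {N : PreComplex.{v}} {P : Type w} [AddCommGroup P]
    {B : M →+ N →+ P} (hB : Function.Surjective (onTensor B)) {q : P → Prop} (z : P)
    (h : ∀ x y, q (B x y)) (add : ∀ z z', q z → q z' → q (z + z')) : q z := by
  obtain ⟨t, rfl⟩ := hB z
  refine tensor_induction (p := fun t => q (onTensor B t)) t h fun x y hx hy => ?_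
  rw [map_add]
  exact add _ _ hx hy

theorem pow_induction {n m : ℕ} {q : (H.pow (n + 1) F).obj m → Prop} (x : (H.pow (n + 1) F).obj m)
    (gen : ∀ k x, q (H.pgen F n m k x)) (add : ∀ x y, q x → q y → q (x + y)) : q x :=
  H.op_induction (Φ := H.pow n F) x gen add

namespace IsProduct

variable (hp : IsProduct H p)
include hp

/-- The product acts separately on the coefficients of each l, where it is bijective by induction.
The inverse is assembled from the inverses there, with the Koszul sign undone. For the reduced
complex it must be checked that this inverse kills faces. -/
theorem rmul_bijective (hb : ∀ a b, Function.Bijective (onTensor (p a b))) (n a b : ℕ) :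
    Function.Bijective (onTensor (H.rmul p n a b)) := by
  induction n generalizing a with
  | zero => exact hb a b
  | succ n ih =>
    let e (a : ℕ) : tensor ((H.pow n F).obj a) (G.obj b) ≃+ (H.pow n K).obj (a + b) :=
      AddEquiv.ofBijective _ (ih a)
    have he : ∀ a x y, (e a).symm (H.rmul p n a b x y) = tmk x y := fun a x y =>
      (AddEquiv.symm_apply_eq _).2 rfl
    have hGi : DirectSum.IsInternal (G.obj b).deg := ((hp.mid 0).isComplex b).internal
    let s (k : ℕ) : tensor ((H.pow n F).obj (k + 1 + a)) (G.obj b) →+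
        tensor ((H.pow (n + 1) F).obj a) (G.obj b) :=
      onTensor (((tmkHom _ _).comp (H.pgen F n a k)).compl₂ ((G.obj b).koszul k))
    have hs : ∀ k x y, s k (tmk x y) = tmk (H.pgen F n a k x) ((G.obj b).koszul k y) :=
      fun k x y => rfl
    have hT : ∀ k (x : (H.pow n F).obj (k + 1 + a)) y, ((s k).comp
        ((e (k + 1 + a)).symm.toAddMonoidHom.comp
        ((H.pow n K).act.flip (E.eqId (k + 1 + (a + b)) (k + 1 + a + b)))))
        ((H.pow n K).act (H.rmul p n (k + 1 + a) b x y)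
          (E.eqId (k + 1 + a + b) (k + 1 + (a + b)))) =
        tmk (H.pgen F n a k x) ((G.obj b).koszul k y) := by
      intro k x y
      change s k ((e (k + 1 + a)).symm ((H.pow n K).act _ _)) = _
      rw [← (hp.right n).act_comp, E.eqId_comp_eqId (by omega), E.eqId_self,
        (hp.right n).act_one, he, hs]
    let L : (H.pow (n + 1) K).obj (a + b) →+ tensor ((H.pow (n + 1) F).obj a) (G.obj b) :=
      H.lift (H.pow n K) (a + b) fun k => (s k).comp
      ((e (k + 1 + a)).symm.toAddMonoidHom.comp
        ((H.pow n K).act.flip (E.eqId (k + 1 + (a + b)) (k + 1 + a + b))))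
    refine onTensor_bijective L (fun x y => ?_) ?_
    · refine pow_induction (q := fun x => L (H.rmul p (n + 1) a b x y) = tmk x y) x (fun k x => ?_) fun x x' hx hx' => ?_
      · rw [hp.rmul_pgen]
        refine (H.pow_lift (Φ := K) _ (fun l g hg z => ?_) _ _).trans ?_
        -- A face of z is, after rebracketing, a face that affects only the first factor. The
        -- induction hypothesis writes z through products, and naturality puts the face on the
        -- element of F.
        · have hz : (H.pow n K).act z (E.tens g (E.one (a + b))) = (H.pow n K).act ((H.pow n K).act
              ((H.pow n K).act z (E.eqId (l + (a + b)) (l + a + b)))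
              (E.tens (E.tens g (E.one a)) (E.one b)))
                (E.eqId (l + 1 + a + b) (l + 1 + (a + b))) := by
            rw [← (hp.right n).act_comp, E.tens_assoc, ← (hp.right n).act_comp, ← E.comp_assoc,
              E.eqId_comp_eqId (by omega), E.eqId_self, E.one_comp, E.tens_one]
          rw [hz]
          refine onTensor_induction (ih (l + a)).2 (q := fun w => ((s l).comp
            ((e (l + 1 + a)).symm.toAddMonoidHom.comp
            ((H.pow n K).act.flip (E.eqId (l + 1 + (a + b)) (l + 1 + a + b)))))
            ((H.pow n K).act ((H.pow n K).act w (E.tens (E.tens g (E.one a)) (E.one b)))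
              (E.eqId (l + 1 + a + b) (l + 1 + (a + b)))) = 0) _ (fun x y => ?_)
              fun w w' hw hw' => ?_
          · have h := hp.rNat n x y (hg.tens_deg a) (E.one_deg b)
            have hG : G.IsDGFunctor := hp.mid 0
            rw [hG.act_one] at h
            rw [← h, hT, H.pgen_face hg, tmk_zero_left]
          · beta_reduce at hw hw' ⊢
            rw [map_add, AddMonoidHom.add_apply, map_add, AddMonoidHom.add_apply, map_add, hw, hw',
              add_zero]
        · rw [hT, koszul_koszul hGi, koszul_even hGi ⟨k, rfl⟩]
      · rw [map_add, AddMonoidHom.add_apply, tmk_add_left, ← hx, ← hx', map_add]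
    · rw [eq_top_iff]
      intro z _
      refine pow_induction z (fun k z => ?_) fun x y hx hy => add_mem hx hy
      have hz : z = (H.pow n K).act ((H.pow n K).act z
          (E.eqId (k + 1 + (a + b)) (k + 1 + a + b))) (E.eqId (k + 1 + a + b) (k + 1 + (a + b))) := by
        rw [← (hp.right n).act_comp, E.eqId_comp_eqId (by omega), E.eqId_self, (hp.right n).act_one]
      rw [hz]
      refine onTensor_induction (ih (k + 1 + a)).2 (q := fun w => H.pgen K n (a + b) k
        ((H.pow n K).act w (E.eqId (k + 1 + a + b) (k + 1 + (a + b)))) ∈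
          (onTensor (H.rmul p (n + 1) a b)).range) _ (fun x y => ?_) fun w w' hw hw' => ?_
      · refine ⟨tmk (H.pgen F n a k x) ((G.obj b).koszul k y), ?_⟩
        rw [onTensor_tmk, hp.rmul_pgen, koszul_koszul hGi, koszul_even hGi ⟨k, rfl⟩]
      · beta_reduce at hw hw' ⊢
        rw [map_add, AddMonoidHom.add_apply, map_add]
        exact add_mem hw hw'

/-- The same construction in the second factor. The block permutation is undone by `blockBack`, and
faces of the product come from faces of G. -/
theorem pair_bijective (hb : ∀ a b, Function.Bijective (onTensor (p a b))) (n n' a b : ℕ) :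
    Function.Bijective (onTensor (H.pair p n n' a b)) := by
  induction n' generalizing b with
  | zero => exact hp.rmul_bijective hb n a b
  | succ n' ih =>
    let e (b : ℕ) : tensor ((H.pow n F).obj a) ((H.pow n' G).obj b) ≃+
        (H.pow (n + n') K).obj (a + b) := AddEquiv.ofBijective _ (ih b)
    have he : ∀ b x y, (e b).symm (H.pair p n n' a b x y) = tmk x y := fun b x y =>
      (AddEquiv.symm_apply_eq _).2 rfl
    let s (k : ℕ) : tensor ((H.pow n F).obj a) ((H.pow n' G).obj (k + 1 + b)) →+
        tensor ((H.pow n F).obj a) ((H.pow (n' + 1) G).obj b) :=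
      onTensor ((tmkHom _ _).compl₂ (H.pgen G n' b k))
    have hs : ∀ k x y, s k (tmk x y) = tmk x (H.pgen G n' b k y) := fun k x y => rfl
    have hT : ∀ k x (y : (H.pow n' G).obj (k + 1 + b)), ((s k).comp
        ((e (k + 1 + b)).symm.toAddMonoidHom.comp
        ((H.pow (n + n') K).act.flip (blockBack E a (k + 1) b))))
        ((H.pow (n + n') K).act (H.pair p n n' a (k + 1 + b) x y) (blockMove E a (k + 1) b)) =
        tmk x (H.pgen G n' b k y) := by
      intro k x y
      change s k ((e (k + 1 + b)).symm ((H.pow (n + n') K).act _ _)) = _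
      rw [← (hp.right _).act_comp, blockMove_blockBack, (hp.right _).act_one, he, hs]
    let L : (H.pow (n + n' + 1) K).obj (a + b) →+
        tensor ((H.pow n F).obj a) ((H.pow (n' + 1) G).obj b) :=
      H.lift (H.pow (n + n') K) (a + b) fun k => (s k).comp
      ((e (k + 1 + b)).symm.toAddMonoidHom.comp
        ((H.pow (n + n') K).act.flip (blockBack E a (k + 1) b)))
    refine onTensor_bijective L (fun x y => ?_) ?_
    · refine pow_induction (q := fun y => L (H.pair p n (n' + 1) a b x y) = tmk x y) y (fun k y => ?_) fun y y' hy hy' => ?_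
      · rw [hp.pair_pgen]
        refine (H.pow_lift (Φ := K) _ (fun l g hg z => ?_) _ _).trans (hT k x y)
        have hz : (H.pow (n + n') K).act z (E.tens g (E.one (a + b))) =
            (H.pow (n + n') K).act ((H.pow (n + n') K).act
              ((H.pow (n + n') K).act z (blockBack E a l b))
              (E.tens (E.one a) (E.tens g (E.one b)))) (blockMove E a (l + 1) b) := by
          rw [← (hp.right _).act_comp, blockMove_natural (E.one_deg a) hg.deg,
            ← (hp.right _).act_comp, ← E.comp_assoc, blockBack_blockMove, E.one_comp, E.tens_one]
        rw [hz]
        refine onTensor_induction (ih (l + b)).2 (q := fun w => ((s l).comp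
          ((e (l + 1 + b)).symm.toAddMonoidHom.comp
          ((H.pow (n + n') K).act.flip (blockBack E a (l + 1) b))))
          ((H.pow (n + n') K).act ((H.pow (n + n') K).act w
            (E.tens (E.one a) (E.tens g (E.one b)))) (blockMove E a (l + 1) b)) = 0) _
            (fun x y => ?_) fun w w' hw hw' => ?_
        · have h := hp.pNat n n' x y (E.one_deg a) (hg.tens_deg b)
          rw [(hp.left n).act_one] at h
          rw [← h, hT, H.pgen_face hg, tmk_zero_right]
        · beta_reduce at hw hw' ⊢
          rw [map_add, AddMonoidHom.add_apply, map_add, AddMonoidHom.add_apply, map_add, hw, hw',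
            add_zero]
      · rw [map_add, tmk_add_right, ← hy, ← hy', map_add]
    · rw [eq_top_iff]
      intro z _
      refine pow_induction (n := n + n') z (fun k z => ?_) fun x y hx hy => add_mem hx hy
      have hz : z = (H.pow (n + n') K).act ((H.pow (n + n') K).act z (blockBack E a (k + 1) b))
          (blockMove E a (k + 1) b) := by
        rw [← (hp.right _).act_comp, blockBack_blockMove, (hp.right _).act_one]
      rw [hz]
      refine onTensor_induction (ih (k + 1 + b)).2 (q := fun w => H.pgen K (n + n') (a + b) k
        ((H.pow (n + n') K).act w (blockMove E a (k + 1) b)) ∈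
          (onTensor (H.pair p n (n' + 1) a b)).range) _ (fun x y => ?_) fun w w' hw hw' => ?_
      · exact ⟨tmk x (H.pgen G n' b k y), hp.pair_pgen x y⟩
      · beta_reduce at hw hw' ⊢
        rw [map_add, AddMonoidHom.add_apply, map_add]
        exact add_mem hw hw'

end IsProduct

end Products

end HochschildAction
namespace HochschildAction

/-! ### Products of elements x · z -/

section

variable {E : DGProp.{u}} {A : AInfMult E} {H : Variant A}

/-- The product of the iterated Hochschild complexes of the functors `E(a, -)`. -/
noncomputable def pairE (H : Variant A) (a a' n n' m m' : ℕ) :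
    (H.pow n (rep E.toDGCat a)).obj m →+ (H.pow n' (rep E.toDGCat a')).obj m' →+
      (H.pow (n + n') (rep E.toDGCat (a + a'))).obj (m + m') :=
  H.pair (F := rep E.toDGCat a) (G := rep E.toDGCat a') (K := rep E.toDGCat (a + a'))
    (fun _ _ => E.tens) n n' m m'

/-- The product of the iterated Hochschild complexes of a monoidal functor. -/
noncomputable def pairM (H : Variant A) {Φ : PreFunctor.{u, v} E.toDGCat}
    (M : MonStr (D := E.toMonDGCat) Φ) (n n' m m' : ℕ) :
    (H.pow n Φ).obj m →+ (H.pow n' Φ).obj m' →+ (H.pow (n + n') Φ).obj (m + m') :=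
  H.pair (F := Φ) (G := Φ) (K := Φ) (fun _ _ => M.mul) n n' m m'

namespace Extension

variable (X : Extension H)
include X

theorem isProduct_rep (a a' : ℕ) :
    IsProduct H (F := rep E.toDGCat a) (G := rep E.toDGCat a') (K := rep E.toDGCat (a + a'))
      (fun _ _ => E.tens) :=
  ⟨fun n => X.pow_rep_isDGFunctor n a, fun n => X.pow_rep_isDGFunctor n a',
    fun n => X.pow_rep_isDGFunctor n _,
    fun {_ _ _ _} x y {_} {g} hf _ => (E.interchange_left (x : E.Hom a _) (y : E.Hom a' _) g hf).symm⟩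

variable {Φ : PreFunctor.{u, v} E.toDGCat} (hΦ : Φ.IsDGFunctor)
  (M : MonStr (D := E.toMonDGCat) Φ)
include hΦ

theorem isProduct_mul : IsProduct H (F := Φ) (G := Φ) (K := Φ) (fun _ _ => M.mul) := by
  refine ⟨fun n => X.pow_isDGFunctor hΦ n, fun n => X.pow_isDGFunctor hΦ n,
    fun n => X.pow_isDGFunctor hΦ n, fun {a a' b b'} x y {f} {g} hf _ => ?_⟩
  refine HochschildAction.hom_ext (hΦ.isComplex b).internal
    (f := (M.mul (Φ.act x f)).comp (Φ.act.flip g))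
    (g := (Φ.act.flip (E.tens f g)).comp (M.mul x)) (fun j y hy => ?_) y
  simpa [sgn_zero] using M.naturality 0 j x f y g hf hy

/-- The rule (x · z)(y · g) = (-1)^(|z||y|) (x y) · (z ⊗ g), where y moves past z. At level 0 it is
the naturality of the products of Φ. At each further level the factor l_{k+1} adds k to the degree
of z, and `rmul` has the matching sign. -/
theorem rmul_ev {n m m' a a' : ℕ} {i : ℤ} (x : Φ.obj a) (y : Φ.obj a')
    {z : (H.pow n (rep E.toDGCat a)).obj m} (g : E.Hom a' m')
    (hz : z ∈ ((H.pow n (rep E.toDGCat a)).obj m).deg i) :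
    H.rmul (F := Φ) (G := Φ) (K := Φ) (fun _ _ => M.mul) n m m' (H.ev Φ a n m x z) (Φ.act y g) =
      H.ev Φ (a + a') n (m + m') (M.mul x ((Φ.obj a').koszul i y))
        (H.rmul (F := rep E.toDGCat a) (G := rep E.toDGCat a') (K := rep E.toDGCat (a + a'))
          (fun _ _ => E.tens) n m m' z g) := by
  induction n generalizing m i y g with
  | zero =>
    refine HochschildAction.hom_ext (hΦ.isComplex a').internal
      (f := (M.mul (Φ.act x z)).comp (Φ.act.flip g))
      (g := (Φ.act.flip (E.tens (z : E.Hom a m) g)).comp ((M.mul x).comp ((Φ.obj a').koszul i)))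
      (fun j y hy => ?_) y
    refine (M.naturality i j x z y g hz hy).trans ?_
    change _ = Φ.act (M.mul x ((Φ.obj a').koszul i y)) (E.tens (z : E.Hom a m) g)
    rw [koszul_apply (hΦ.isComplex a').internal i hy, map_zsmul, map_zsmul]
    rfl
  | succ n ih =>
    have hE := X.isProduct_rep a a'
    have hM := X.isProduct_mul hΦ M
    refine H.pow_deg_le (Φ := rep E.toDGCat a) (AddMonoidHom.eqLocus
      (((H.rmul (F := Φ) (G := Φ) (K := Φ) (fun _ _ => M.mul) (n + 1) m m').flip
        (Φ.act y g)).comp (H.ev Φ a (n + 1) m x))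
      ((H.ev Φ (a + a') (n + 1) (m + m') (M.mul x ((Φ.obj a').koszul i y))).comp
        ((H.rmul (F := rep E.toDGCat a) (G := rep E.toDGCat a') (K := rep E.toDGCat (a + a'))
          (fun _ _ => E.tens) (n + 1) m m').flip g))) ?_ hz
    rintro k j z hzj rfl
    change H.rmul (F := Φ) (G := Φ) (K := Φ) (fun _ _ => M.mul) (n + 1) m m'
        (H.ev Φ a (n + 1) m x (H.pgen (rep E.toDGCat a) n m k z)) (Φ.act y g) =
      H.ev Φ (a + a') (n + 1) (m + m') (M.mul x ((Φ.obj a').koszul (j + k) y))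
        (H.rmul (F := rep E.toDGCat a) (G := rep E.toDGCat a') (K := rep E.toDGCat (a + a'))
          (fun _ _ => E.tens) (n + 1) m m' (H.pgen (rep E.toDGCat a) n m k z) g)
    rw [X.ev_gen hΦ, hM.rmul_pgen, hΦ.act_koszul, ih _ _ hzj,
      koszul_koszul (hΦ.isComplex a').internal, ← (X.evFacts hΦ n).act, ← X.ev_gen hΦ]
    congr 1
    exact (hE.rmul_pgen z g).symm

theorem pair_ev {n n' m m' a a' : ℕ} {i : ℤ} (x : Φ.obj a) (y : Φ.obj a')
    {z : (H.pow n (rep E.toDGCat a)).obj m} (w : (H.pow n' (rep E.toDGCat a')).obj m')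
    (hz : z ∈ ((H.pow n (rep E.toDGCat a)).obj m).deg i) :
    pairM H M n n' m m' (H.ev Φ a n m x z) (H.ev Φ a' n' m' y w) =
      H.ev Φ (a + a') (n + n') (m + m') (M.mul x ((Φ.obj a').koszul i y))
        (pairE H a a' n n' m m' z w) := by
  induction n' generalizing m' with
  | zero => exact X.rmul_ev hΦ M x y w hz
  | succ n' ih =>
    refine H.pow_hom_ext (Φ := rep E.toDGCat a')
      (f := (pairM H M n (n' + 1) m m' (H.ev Φ a n m x z)).comp (H.ev Φ a' (n' + 1) m' y))
      (g := (H.ev Φ (a + a') (n + (n' + 1)) (m + m') (M.mul x ((Φ.obj a').koszul i y))).comp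
        (pairE H a a' n (n' + 1) m m' z)) (fun k w => ?_) w
    have h1 := (X.isProduct_mul hΦ M).pair_pgen (n := n) (n' := n') (a := m) (b := m') (k := k)
    have h2 := (X.isProduct_rep a a').pair_pgen (n := n) (n' := n') (a := m) (b := m') (k := k)
    change pairM H M n (n' + 1) m m' (H.ev Φ a n m x z)
        (H.ev Φ a' (n' + 1) m' y (H.pgen (rep E.toDGCat a') n' m' k w)) =
      H.ev Φ (a + a') (n + n' + 1) (m + m') (M.mul x ((Φ.obj a').koszul i y))
        (pairE H a a' n (n' + 1) m m' z (H.pgen (rep E.toDGCat a') n' m' k w))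
    rw [X.ev_gen hΦ]
    refine (h1 _ _).trans ?_
    refine ((congrArg _ (congrArg (fun t => (H.pow (n + n') Φ).act t _) (ih w)))).trans ?_
    refine Eq.trans ?_ (congrArg _ (h2 z w).symm)
    rw [X.ev_gen hΦ, (X.evFacts hΦ (n + n')).act]
    rfl

end Extension

end

end HochschildAction
namespace HochschildAction

/-! ### The monoidal dg-functor (m, n) ↦ Cⁿ(Φ)(m) on the extension -/

namespace Extension

variable {E : DGProp.{u}} {A : AInfMult E} {H : Variant A} (X : Extension H)

theorem ι_eqId (a b : ℕ) : X.ι a b 0 (E.eqId a b) = X.cat.eqId (a, 0) (b, 0) := by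
  by_cases h : a = b
  · subst h
    rw [DGCat.eqId_self, DGCat.eqId_self]
    exact X.ι_one a
  · rw [DGCat.eqId, DGCat.eqId, dif_neg h, dif_neg fun h' => h (congrArg Prod.fst h')]
    exact map_zero _

theorem evX_zero_apply {Φ : PreFunctor.{u, v} E.toDGCat} (hΦ : Φ.IsDGFunctor) {a b : ℕ}
    (x : Φ.obj a) (f : E.Hom a b) :
    X.evX hΦ a (b, 0) x (X.ι a b 0 f : X.cat.Hom (a, 0) (b, 0)) = Φ.act x f :=
  X.evX_ι hΦ (p := (b, 0)) x f

variable {Φ : PreFunctor.{u, v} E.toDGCat} (hΦ : Φ.IsDGFunctor)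
  (M : MonStr (D := E.toMonDGCat) Φ)

theorem evX_pairing (a : ℕ) (p : ℕ × ℕ) : IsPairing (X.evX hΦ a p) := by
  have hp := (X.evFacts hΦ p.2).pairing a p.1
  refine ⟨fun i j x f hx hf => ?_, fun i x f hx => ?_⟩
  · obtain ⟨z, rfl⟩ := (X.ι a p.1 p.2).surjective f
    rw [X.evX_ι]
    exact hp.deg i j x z hx ((X.ι_deg a p.1 p.2 j z).1 hf)
  · obtain ⟨z, rfl⟩ := (X.ι a p.1 p.2).surjective f
    have hd := X.ι_d a p.1 p.2 z
    rw [X.evX_ι, hp.d i x z hx, X.evX_ι]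
    change _ = _ + sgn i • X.evX hΦ a p x ((X.cat.Hom (a, 0) (p.1, p.2)).d _)
    rw [← hd]
    congr 2
    exact (X.evX_ι hΦ (p := p) _ _).symm

/-- Moves a morphism of E from Φ into Ẽ or back. In the verification of the monoidal axioms it
passes associators, units and symmetries from Ẽ to Φ. -/
theorem evX_act {a b : ℕ} {p : ℕ × ℕ} (x : Φ.obj a) (e : E.Hom a b) (f : X.cat.Hom (b, 0) p) :
    X.evX hΦ b p (Φ.act x e) f = X.evX hΦ a p x (X.cat.comp (X.ι a b 0 e) f) := by
  obtain ⟨z, rfl⟩ := (X.ι b p.1 p.2).surjective f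
  have h := X.ι_evE e z
  rw [X.evX_ι, ← X.ev_ev hΦ]
  refine (X.evX_ι hΦ (p := p) x _).symm.trans ?_
  rw [h]

theorem act_evX {a : ℕ} {p q : ℕ × ℕ} (x : Φ.obj a) (g : X.cat.Hom (a, 0) p)
    (f : X.cat.Hom p q) :
    X.act Φ p q (X.evX hΦ a p x g) f = X.evX hΦ a q x (X.cat.comp g f) := by
  obtain ⟨z, rfl⟩ := (X.ι a p.1 p.2).surjective g
  rw [X.evX_ι]
  exact X.act_ev hΦ x z f

theorem deg_le_evX {p : ℕ × ℕ} {i : ℤ} (S : AddSubgroup ((H.pow p.2 Φ).obj p.1))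
    (h : ∀ (a : ℕ) (j k : ℤ) (x : Φ.obj a) (f : X.cat.Hom (a, 0) p), x ∈ (Φ.obj a).deg j →
      f ∈ (X.cat.Hom (a, 0) p).deg k → j + k = i → X.evX hΦ a p x f ∈ S) :
    ((H.pow p.2 Φ).obj p.1).deg i ≤ S := by
  refine ((X.evFacts hΦ p.2).deg_le p.1 i).trans ((AddSubgroup.closure_le S).2 ?_)
  rintro _ ⟨a, j, k, x, z, hx, hz, hjk, rfl⟩
  have := h a j k x (X.ι a p.1 p.2 z) hx ((X.ι_deg a p.1 p.2 k z).2 hz) hjk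
  rwa [X.evX_ι] at this

theorem evX_hom_ext_deg {p : ℕ × ℕ} {P : Type w} [AddCommGroup P] {i : ℤ}
    {f g : (H.pow p.2 Φ).obj p.1 →+ P}
    (h : ∀ (a : ℕ) (j k : ℤ) (x : Φ.obj a) (z : X.cat.Hom (a, 0) p), x ∈ (Φ.obj a).deg j →
      z ∈ (X.cat.Hom (a, 0) p).deg k → j + k = i →
        f (X.evX hΦ a p x z) = g (X.evX hΦ a p x z))
    {w : (H.pow p.2 Φ).obj p.1} (hw : w ∈ ((H.pow p.2 Φ).obj p.1).deg i) : f w = g w :=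
  X.deg_le_evX hΦ (AddMonoidHom.eqLocus f g) h hw

theorem evX_hom_ext {p : ℕ × ℕ} {P : Type w} [AddCommGroup P]
    {f g : (H.pow p.2 Φ).obj p.1 →+ P}
    (h : ∀ (a : ℕ) (j k : ℤ) (x : Φ.obj a) (z : X.cat.Hom (a, 0) p), x ∈ (Φ.obj a).deg j →
      z ∈ (X.cat.Hom (a, 0) p).deg k →
        f (X.evX hΦ a p x z) = g (X.evX hΦ a p x z)) (w : (H.pow p.2 Φ).obj p.1) : f w = g w :=
  HochschildAction.hom_ext ((X.pow_isDGFunctor hΦ p.2).isComplex p.1).internal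
    (fun _ _ hw => X.evX_hom_ext_deg hΦ (fun a j k x z hx hz _ => h a j k x z hx hz) hw) w

theorem mulC_evX {p q : ℕ × ℕ} {a a' : ℕ} {i : ℤ} (x : Φ.obj a) (y : Φ.obj a')
    {f : X.cat.Hom (a, 0) p} (g : X.cat.Hom (a', 0) q) (hf : f ∈ (X.cat.Hom (a, 0) p).deg i) :
    H.mulC M p q (X.evX hΦ a p x f) (X.evX hΦ a' q y g) =
      X.evX hΦ (a + a') (p + q) (M.mul x ((Φ.obj a').koszul i y)) (X.cat.tens f g) := by
  obtain ⟨z, rfl⟩ := (X.ι a p.1 p.2).surjective f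
  obtain ⟨w, rfl⟩ := (X.ι a' q.1 q.2).surjective g
  have h := X.pair_ev hΦ M x y w ((X.ι_deg a p.1 p.2 i z).1 hf)
  have ht := X.ι_tens a p.1 p.2 a' q.1 q.2 z w
  rw [X.evX_ι, X.evX_ι]
  refine (h.trans ?_ : pairM H M p.2 q.2 p.1 q.1 _ _ = _)
  refine (X.evX_ι hΦ (p := p + q) _ _).symm.trans ?_
  exact congrArg _ ht.symm

/-- Since ι identifies the products of representable functors with the tensor product of Ẽ,
multiplication in Cⁿ(Φ) is multiplication in Φ together with ⊗ in Ẽ, up to the sign of moving y past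
f. -/
theorem mulC_evX_of_deg {p q : ℕ × ℕ} {a a' : ℕ} {i j : ℤ} (x : Φ.obj a) {y : Φ.obj a'}
    {f : X.cat.Hom (a, 0) p} (g : X.cat.Hom (a', 0) q) (hf : f ∈ (X.cat.Hom (a, 0) p).deg i)
    (hy : y ∈ (Φ.obj a').deg j) :
    H.mulC M p q (X.evX hΦ a p x f) (X.evX hΦ a' q y g) =
      sgn (i * j) • X.evX hΦ (a + a') (p + q) (M.mul x y) (X.cat.tens f g) := by
  rw [X.mulC_evX hΦ M x y g hf, koszul_apply (hΦ.isComplex a').internal i hy, map_zsmul, map_zsmul]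
  rfl

/-- The extension of the iterated Hochschild complexes `Cⁿ(Φ)(m)` to a dg-functor on `Ẽ`. -/
noncomputable def total (Φ : PreFunctor.{u, v} E.toDGCat) : PreFunctor.{u, v} X.cat.toDGCat where
  obj p := (H.pow p.2 Φ).obj p.1
  act {p q} := X.act Φ p q

/-- On elements x · g the action is composition in Ẽ, so each axiom is the corresponding axiom of
the dg-category Ẽ. -/
theorem total_isDGFunctor (hΦ : Φ.IsDGFunctor) : (X.total Φ).IsDGFunctor where
  isComplex p := (X.pow_isDGFunctor hΦ p.2).isComplex p.1
  act_deg {p q} i j w f hw hf := by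
    refine X.deg_le_evX hΦ ((((H.pow q.2 Φ).obj q.1).deg (i + j)).comap
      ((X.act Φ p q).flip f)) ?_ hw
    rintro a k l x g hx hg rfl
    rw [AddSubgroup.mem_comap, AddMonoidHom.flip_apply, X.act_evX hΦ]
    have := (X.evX_pairing hΦ a q).deg k (l + j) x _ hx (X.cat.comp_deg l j g f hg hf)
    rwa [← add_assoc] at this
  act_d {p q} i w f hw := by
    refine X.evX_hom_ext_deg hΦ (f := ((H.pow q.2 Φ).obj q.1).d.comp ((X.act Φ p q).flip f))
      (g := ((X.act Φ p q).flip f).comp ((H.pow p.2 Φ).obj p.1).d + sgn i •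
        (X.act Φ p q).flip ((X.cat.Hom p q).d f)) ?_ hw
    rintro a k l x g hx hg rfl
    change ((H.pow q.2 Φ).obj q.1).d (X.act Φ p q (X.evX hΦ a p x g) f) =
      X.act Φ p q (((H.pow p.2 Φ).obj p.1).d (X.evX hΦ a p x g)) f +
        sgn (k + l) • X.act Φ p q (X.evX hΦ a p x g) ((X.cat.Hom p q).d f)
    rw [X.act_evX hΦ, (X.evX_pairing hΦ a q).d k _ _ hx, X.cat.comp_d l g f hg,
      (X.evX_pairing hΦ a p).d k _ _ hx, X.act_evX hΦ]
    simp only [map_add, map_zsmul, AddMonoidHom.add_apply, AddMonoidHom.smul_apply]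
    rw [X.act_evX hΦ, X.act_evX hΦ, smul_add, sgn_smul_smul, add_assoc]
  act_one {p} w := X.evX_hom_ext hΦ (f := (X.act Φ p p).flip (X.cat.one p))
      (g := AddMonoidHom.id _) (fun a j k x g _ _ => by
        rw [AddMonoidHom.flip_apply, X.act_evX hΦ, X.cat.comp_one]; rfl) w
  act_comp {p q r} w f g := X.evX_hom_ext hΦ (f := (X.act Φ p r).flip (X.cat.comp f g))
      (g := ((X.act Φ q r).flip g).comp ((X.act Φ p q).flip f)) (fun a j k x h _ _ => by
        change X.act Φ p r (X.evX hΦ a p x h) (X.cat.comp f g) =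
          X.act Φ q r (X.act Φ p q (X.evX hΦ a p x h) f) g
        rw [X.act_evX hΦ, X.act_evX hΦ, X.act_evX hΦ, X.cat.comp_assoc]) w

theorem unit_eq_evX : (M.one : (H.pow (0 : ℕ × ℕ).2 Φ).obj (0 : ℕ × ℕ).1) =
    X.evX hΦ 0 0 M.one (X.cat.one 0) := by
  have h := X.evX_zero_apply hΦ M.one (E.one 0)
  have h1 := X.ι_one 0
  rw [h1] at h
  exact (h.trans (hΦ.act_one _)).symm

include X hΦ in
theorem mulC_isPairing (p q : ℕ × ℕ) : IsPairing (H.mulC M p q) := by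
  refine ⟨fun i j w w' hw hw' => ?_, fun i w w' hw => ?_⟩
  · refine X.deg_le_evX hΦ ((((H.pow (p + q).2 Φ).obj (p + q).1).deg (i + j)).comap
      ((H.mulC M p q).flip w')) ?_ hw
    rintro a k l x f hx hf rfl
    refine X.deg_le_evX hΦ ((((H.pow (p + q).2 Φ).obj (p + q).1).deg (k + l + j)).comap
      (H.mulC M p q (X.evX hΦ a p x f))) ?_ hw'
    rintro b k' l' y g hy hg rfl
    rw [AddSubgroup.mem_comap, X.mulC_evX_of_deg hΦ M x g hf hy]
    refine zsmul_mem ?_ _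
    have := (X.evX_pairing hΦ (a + b) (p + q)).deg (k + k') (l + l') _ _
      (M.mul_deg k k' x y hx hy) (X.cat.tens_deg l l' f g hf hg)
    rwa [add_add_add_comm] at this
  · refine X.evX_hom_ext_deg hΦ (f := ((H.pow (p + q).2 Φ).obj (p + q).1).d.comp
      ((H.mulC M p q).flip w')) (g := ((H.mulC M p q).flip w').comp ((H.pow p.2 Φ).obj p.1).d +
        sgn i • (H.mulC M p q).flip (((H.pow q.2 Φ).obj q.1).d w')) ?_ hw
    rintro a k l x f hx hf rfl
    refine X.evX_hom_ext hΦ (f := ((H.pow (p + q).2 Φ).obj (p + q).1).d.comp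
      (H.mulC M p q (X.evX hΦ a p x f)))
      (g := H.mulC M p q (((H.pow p.2 Φ).obj p.1).d (X.evX hΦ a p x f)) + sgn (k + l) •
        (H.mulC M p q (X.evX hΦ a p x f)).comp ((H.pow q.2 Φ).obj q.1).d)
      (fun b k' l' y g hy hg => ?_) w'
    change ((H.pow (p + q).2 Φ).obj (p + q).1).d (H.mulC M p q (X.evX hΦ a p x f)
        (X.evX hΦ b q y g)) =
      H.mulC M p q (((H.pow p.2 Φ).obj p.1).d (X.evX hΦ a p x f)) (X.evX hΦ b q y g) +
        sgn (k + l) • H.mulC M p q (X.evX hΦ a p x f)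
          (((H.pow q.2 Φ).obj q.1).d (X.evX hΦ b q y g))
    have hdf := (X.cat.isComplex (a, 0) p).d_deg l f hf
    have hdy := (hΦ.isComplex b).d_deg k' y hy
    rw [X.mulC_evX_of_deg hΦ M x g hf hy, map_zsmul,
      (X.evX_pairing hΦ _ _).d (k + k') _ _ (M.mul_deg k k' x y hx hy),
      (X.evX_pairing hΦ a p).d k _ _ hx, (X.evX_pairing hΦ b q).d k' _ _ hy,
      M.mul_d k x y hx]
    have ht := X.cat.tens_d l f g hf
    refine (congrArg (fun t => _ • (_ + _ • X.evX hΦ (a + b) (p + q) (M.mul x y) t)) ht).trans ?_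
    simp only [map_add, map_zsmul, AddMonoidHom.add_apply, AddMonoidHom.smul_apply]
    rw [X.mulC_evX_of_deg hΦ M _ g hf hy, X.mulC_evX_of_deg hΦ M x g hdf hy,
      X.mulC_evX_of_deg hΦ M x g hf hdy, X.mulC_evX_of_deg hΦ M x _ hf hy]
    simp only [smul_add, sgn_smul_smul]
    -- The exponents belong to the terms with d y, d f and d g, in this order; the term with d x
    -- needs no change of sign.
    have e1 : sgn (l * k' + k) = sgn (k + l + l * (k' - 1)) :=
      sgn_congr ⟨0, by ring⟩
    have e2 : sgn (l * k' + (k + k')) = sgn (k + (l - 1) * k') := sgn_congr ⟨k', by ring⟩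
    have e3 : sgn (l * k' + (k + k' + l)) = sgn (k + l + (k' + l * k')) :=
      sgn_congr ⟨0, by ring⟩
    rw [e1, e2, e3]
    abel

/-- The monoidal structure of the dg-functor `(m, n) ↦ Cⁿ(Φ)(m)`. -/
noncomputable def totalMon (hΦ : Φ.IsDGFunctor) (M : MonStr (D := E.toMonDGCat) Φ) :
    MonStr (X.total Φ) where
  one := M.one
  mul {p q} := H.mulC M p q
  one_deg := M.one_deg
  one_d := M.one_d
  mul_deg {p q} i j x y := (X.mulC_isPairing hΦ M p q).deg i j x y
  mul_d {p q} i x y := (X.mulC_isPairing hΦ M p q).d i x y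
  naturality {p p' q q'} i j w f w' g hf hw' := by
    refine X.evX_hom_ext_deg hΦ (f := (H.mulC M p' q' (X.act Φ p p' w f)).comp
        ((X.act Φ q q').flip g))
      (g := sgn (i * j) • ((X.act Φ (p + q) (p' + q')).flip (X.cat.tens f g)).comp
        (H.mulC M p q w)) ?_ hw'
    rintro b k' l' y h' hy hh' rfl
    refine X.evX_hom_ext hΦ (f := ((H.mulC M p' q').flip
        (X.act Φ q q' (X.evX hΦ b q y h') g)).comp ((X.act Φ p p').flip f))
      (g := sgn (i * (k' + l')) • ((X.act Φ (p + q) (p' + q')).flip (X.cat.tens f g)).comp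
        ((H.mulC M p q).flip (X.evX hΦ b q y h')))
      (fun a k l x h hx hh => ?_) w
    change H.mulC M p' q' (X.act Φ p p' (X.evX hΦ a p x h) f)
        (X.act Φ q q' (X.evX hΦ b q y h') g) = sgn (i * (k' + l')) •
      X.act Φ (p + q) (p' + q') (H.mulC M p q (X.evX hΦ a p x h) (X.evX hΦ b q y h'))
        (X.cat.tens f g)
    rw [X.act_evX hΦ, X.act_evX hΦ, X.mulC_evX_of_deg hΦ M x _ (X.cat.comp_deg l i h f hh hf) hy,
      X.mulC_evX_of_deg hΦ M x h' hh hy]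
    simp only [map_zsmul, AddMonoidHom.smul_apply]
    rw [X.act_evX hΦ]
    -- The interchange in Ẽ moves f past the morphism part of the second factor. Its element y has
    -- already been moved past f in forming the product.
    have hi := X.cat.interchange i l' h f h' g hf hh'
    refine Eq.trans ?_ (congrArg (fun t => _ • _ • X.evX hΦ (a + b) (p' + q') (M.mul x y) t)
      hi.symm)
    rw [map_zsmul]
    refine Eq.trans ?_ (congrArg _ (sgn_smul_smul _ _ _).symm)
    refine Eq.trans ?_ (sgn_smul_smul _ _ _).symm
    refine sgn_smul_congr _ ⟨-(i * l'), by ring⟩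
  mul_assoc {p q r} w w' w'' := by
    refine X.evX_hom_ext hΦ (f := ((X.act Φ (p + q + r) (p + (q + r))).flip
        (X.cat.eqId (p + q + r) (p + (q + r)))).comp (H.mulC M (p + q) r (H.mulC M p q w w')))
      (g := (H.mulC M p (q + r) w).comp (H.mulC M q r w')) (fun c k'' l'' z h hz hh => ?_) w''
    refine X.evX_hom_ext hΦ (f := ((X.act Φ (p + q + r) (p + (q + r))).flip
        (X.cat.eqId (p + q + r) (p + (q + r)))).comp (((H.mulC M (p + q) r).flip
        (X.evX hΦ c r z h)).comp (H.mulC M p q w)))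
      (g := (H.mulC M p (q + r) w).comp ((H.mulC M q r).flip (X.evX hΦ c r z h)))
      (fun b k' l' y g hy hg => ?_) w'
    refine X.evX_hom_ext hΦ (f := ((X.act Φ (p + q + r) (p + (q + r))).flip
        (X.cat.eqId (p + q + r) (p + (q + r)))).comp (((H.mulC M (p + q) r).flip
        (X.evX hΦ c r z h)).comp ((H.mulC M p q).flip (X.evX hΦ b q y g))))
      (g := (H.mulC M p (q + r)).flip (H.mulC M q r (X.evX hΦ b q y g) (X.evX hΦ c r z h)))
      (fun a k l x f hx hf => ?_) w
    change X.act Φ (p + q + r) (p + (q + r)) (H.mulC M (p + q) r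
      (H.mulC M p q (X.evX hΦ a p x f) (X.evX hΦ b q y g)) (X.evX hΦ c r z h))
        (X.cat.eqId (p + q + r) (p + (q + r))) =
      H.mulC M p (q + r) (X.evX hΦ a p x f)
        (H.mulC M q r (X.evX hΦ b q y g) (X.evX hΦ c r z h))
    rw [X.mulC_evX_of_deg hΦ M x g hf hy, X.mulC_evX_of_deg hΦ M y h hg hz, map_zsmul, map_zsmul,
      AddMonoidHom.smul_apply]
    have hfg : X.cat.tens f g ∈ (X.cat.Hom (a + b, 0) (p + q)).deg (l + l') :=
      X.cat.tens_deg l l' f g hf hg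
    have hyz := M.mul_deg k' k'' y z hy hz
    have t1 := X.mulC_evX_of_deg hΦ M (M.mul x y) h hfg hz
    have t2 := X.mulC_evX_of_deg hΦ M x (X.cat.tens g h : X.cat.Hom (b + c, 0) (q + r)) hf hyz
    rw [t1, t2]
    simp only [map_zsmul, AddMonoidHom.smul_apply]
    refine (congrArg _ (congrArg _ (X.act_evX hΦ _ _ _))).trans ?_
    have ha := X.cat.tens_assoc f g h
    refine (congrArg (fun t => _ • _ • X.evX hΦ (a + b + c) (p + (q + r)) _ t) ha).trans ?_
    -- The associator that strictness of ⊗ leaves on the source of the morphism lies in E. It is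
    -- moved onto the product in Φ, where associativity of Φ removes it.
    have he := X.ι_eqId (a + b + c) (a + (b + c))
    have hb := X.evX_act hΦ (p := p + (q + r)) (M.mul (M.mul x y) z)
      (E.eqId (a + b + c) (a + (b + c)))
      (X.cat.tens f (X.cat.tens g h) : X.cat.Hom (a + (b + c), 0) (p + (q + r)))
    rw [he, M.mul_assoc] at hb
    refine (congrArg (fun t => _ • _ • t) hb.symm).trans ?_
    rw [sgn_smul_smul, sgn_smul_smul]
    exact sgn_smul_congr _ ⟨0, by ring⟩
  one_mul {p} w := by
    refine X.evX_hom_ext hΦ (f := ((X.act Φ (0 + p) p).flip (X.cat.eqId (0 + p) p)).comp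
      (H.mulC M 0 p M.one)) (g := AddMonoidHom.id _) (fun a k l x f hx hf => ?_) w
    change X.act Φ (0 + p) p (H.mulC M 0 p M.one (X.evX hΦ a p x f)) (X.cat.eqId (0 + p) p) =
      X.evX hΦ a p x f
    have h0 := X.unit_eq_evX hΦ M
    have h1 := X.mulC_evX_of_deg hΦ M M.one f (X.cat.one_deg 0) hx
    rw [zero_mul, sgn_zero, one_smul] at h1
    refine (congrArg (fun t => X.act Φ (0 + p) p t _)
      ((congrArg (fun t => H.mulC M 0 p t _) h0).trans h1)).trans ?_
    rw [X.act_evX hΦ]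
    have hz := X.cat.zero_tens f
    refine (congrArg (fun t => X.evX hΦ (0 + a) p _ t) hz).trans ?_
    have he := X.ι_eqId (0 + a) a
    have hb := X.evX_act hΦ (p := p) (M.mul M.one x) (E.eqId (0 + a) a) f
    rw [he, M.one_mul] at hb
    exact hb.symm
  mul_one {p} w := by
    refine X.evX_hom_ext hΦ (f := ((X.act Φ (p + 0) p).flip (X.cat.eqId (p + 0) p)).comp
      ((H.mulC M p 0).flip M.one)) (g := AddMonoidHom.id _) (fun a k l x f hx hf => ?_) w
    change X.act Φ (p + 0) p (H.mulC M p 0 (X.evX hΦ a p x f) M.one) (X.cat.eqId (p + 0) p) =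
      X.evX hΦ a p x f
    have h0 := X.unit_eq_evX hΦ M
    have h1 := X.mulC_evX_of_deg hΦ M x (X.cat.one 0) hf M.one_deg
    rw [mul_zero, sgn_zero, one_smul] at h1
    refine (congrArg (fun t => X.act Φ (p + 0) p t _)
      ((congrArg (fun t => H.mulC M p 0 _ t) h0).trans h1)).trans ?_
    have hz := X.cat.tens_zero f
    refine (X.act_evX hΦ _ _ _).trans ?_
    refine (congrArg (fun t => X.evX hΦ (a + 0) p _ t) hz).trans ?_
    have he := X.ι_eqId (a + 0) a
    have hb := X.evX_act hΦ (p := p) (M.mul x M.one) (E.eqId (a + 0) a) f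
    rw [he, M.mul_one] at hb
    exact hb.symm

/-- Naturality of τ turns its action at (p, q) into its action at the sources (a, 0), (b, 0). There
it is the symmetry of E, and the symmetry of Φ applies. -/
theorem totalMon_symmetric {τ : Symmetry X.cat} (hτ : X.Compatible τ) (hM : M.Symmetric E.sym) :
    (X.totalMon hΦ M).Symmetric τ := by
  intro p q i j w w' hw hw'
  refine X.evX_hom_ext_deg hΦ (f := ((X.act Φ (p + q) (q + p)).flip (τ.braid p q)).comp
      ((H.mulC M p q).flip w')) (g := sgn (i * j) • H.mulC M q p w') ?_ hw
  rintro a k l x f hx hf rfl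
  refine X.evX_hom_ext_deg hΦ (f := ((X.act Φ (p + q) (q + p)).flip (τ.braid p q)).comp
      (H.mulC M p q (X.evX hΦ a p x f)))
      (g := sgn ((k + l) * j) • (H.mulC M q p).flip (X.evX hΦ a p x f)) ?_ hw'
  rintro b k' l' y g hy hg rfl
  change X.act Φ (p + q) (q + p) (H.mulC M p q (X.evX hΦ a p x f) (X.evX hΦ b q y g))
      (τ.braid p q) =
    sgn ((k + l) * (k' + l')) • H.mulC M q p (X.evX hΦ b q y g) (X.evX hΦ a p x f)
  rw [X.mulC_evX_of_deg hΦ M x g hf hy, X.mulC_evX_of_deg hΦ M y f hg hx, map_zsmul,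
    AddMonoidHom.smul_apply]
  have hn := τ.naturality l l' f g hf hg
  have hb := X.evX_act hΦ (p := q + p) (M.mul x y) (E.sym.braid a b)
    (X.cat.tens g f : X.cat.Hom (b + a, 0) (q + p))
  rw [← hτ, hM k k' x y hx hy, map_zsmul, AddMonoidHom.smul_apply] at hb
  refine (congrArg _ (X.act_evX hΦ _ _ _)).trans ?_
  refine (congrArg (fun t => _ • X.evX hΦ (a + b) (q + p) _ t) hn).trans ?_
  rw [map_zsmul]
  refine (congrArg (fun t => _ • _ • t) hb.symm).trans ?_
  rw [sgn_smul_smul, sgn_smul_smul, sgn_smul_smul]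
  exact sgn_smul_congr _ ⟨-(k * l'), by ring⟩

end Extension

end HochschildAction
namespace HochschildAction

/-! ### Tensor products of maps -/

/-- `f ⊗ g`. -/
noncomputable def tmap {M : PreComplex.{v₁}} {M' : PreComplex.{v₂}} {N : PreComplex.{v₃}}
    {N' : PreComplex.{v₄}} (f : M →+ M') (g : N →+ N') :
    tensor M N →+ tensor M' N' :=
  onTensor (((tmkHom M' N').comp f).compl₂ g)

@[simp] theorem tmap_tmk {M : PreComplex.{v₁}} {M' : PreComplex.{v₂}} {N : PreComplex.{v₃}}
    {N' : PreComplex.{v₄}} (f : M →+ M')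
    (g : N →+ N') (x : M) (y : N) : tmap f g (tmk x y) = tmk (f x) (g y) := rfl

theorem tmap_bijective {M : PreComplex.{v₁}} {M' : PreComplex.{v₂}} {N : PreComplex.{v₃}}
    {N' : PreComplex.{v₄}} {f : M →+ M'}
    {g : N →+ N'} (hf : Function.Bijective f) (hg : Function.Bijective g) :
    Function.Bijective (tmap f g) := by
  let e := AddEquiv.ofBijective f hf
  let e' := AddEquiv.ofBijective g hg
  refine Function.bijective_iff_has_inverse.2 ⟨tmap e.symm.toAddMonoidHom e'.symm.toAddMonoidHom,
    DFunLike.congr_fun (f := (tmap e.symm.toAddMonoidHom e'.symm.toAddMonoidHom).comp (tmap f g))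
      (g := AddMonoidHom.id _) (tensor_hom_ext fun x y => ?_),
    DFunLike.congr_fun (f := (tmap f g).comp (tmap e.symm.toAddMonoidHom e'.symm.toAddMonoidHom))
      (g := AddMonoidHom.id _) (tensor_hom_ext fun x y => ?_)⟩
  · change tmk (e.symm (e x)) (e'.symm (e' y)) = tmk x y
    rw [AddEquiv.symm_apply_apply, AddEquiv.symm_apply_apply]
  · change tmk (e (e.symm x)) (e' (e'.symm y)) = tmk x y
    rw [AddEquiv.apply_symm_apply, AddEquiv.apply_symm_apply]

theorem IsPairing.comp {M : PreComplex.{v₁}} {M' : PreComplex.{v₂}} {N : PreComplex.{v₃}}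
    {N' : PreComplex.{v₄}} {P : PreComplex.{w}}
    {B : M' →+ N' →+ P} (h : IsPairing B) {f : M →+ M'} {g : N →+ N'} (hf : IsChainMap f)
    (hg : IsChainMap g) : IsPairing ((B.comp f).compl₂ g) := by
  refine ⟨fun i j x y hx hy => h.deg i j _ _ (hf.map_deg i x hx) (hg.map_deg j y hy),
    fun i x y hx => ?_⟩
  change P.d (B (f x) (g y)) = B (f (M.d x)) (g y) + sgn i • B (f x) (g (N.d y))
  rw [h.d i _ _ (hf.map_deg i x hx), hf.map_d, hg.map_d]

theorem IsChainMap.id (M : PreComplex.{u}) : IsChainMap (AddMonoidHom.id M) :=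
  ⟨fun _ _ h => h, fun _ => rfl⟩

theorem vpow_isComplex {V : PreComplex.{v}} (hV : V.IsComplex) (n : ℕ) :
    (vpow V n).IsComplex := by
  induction n with
  | zero => exact unitComplex_isComplex
  | succ n ih => exact tensor_isComplex ih hV

theorem vwpow_isComplex {V W : PreComplex.{v}} (hV : V.IsComplex) (hW : W.IsComplex) (n m : ℕ) :
    (vwpow V W n m).IsComplex := by
  induction m with
  | zero => exact vpow_isComplex hV n
  | succ m ih => exact tensor_isComplex ih hW

/-! ### The maps `λ` -/

section

variable {E : DGProp.{u}} {A : AInfMult E} {H : Variant A} {Φ : PreFunctor.{u, v} E.toDGCat}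

/-- If the components already come from a map on the complex, they kill faces, and no separate check
is needed. -/
theorem lift_comp_gen (Φ : PreFunctor.{u, v} E.toDGCat) {m : ℕ} {P : Type w} [AddCommGroup P]
    {T : ∀ k : ℕ, Φ.obj (k + 1 + m) →+ P} (G : (H.op Φ).obj m →+ P)
    (hT : ∀ k x, T k x = G (H.gen Φ m k x)) : H.lift Φ m T = G := by
  ext z
  refine H.op_hom_ext (fun k x => ?_) z
  rw [H.lift_gen T (fun n g hg y => by rw [hT, H.gen_face hg, map_zero]), hT]

theorem blockMove_zero_left (k : ℕ) :
    blockMove E 0 (k + 1) 0 = E.eqId (0 + (k + 1 + 0)) (k + 1 + 0) := by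
  apply Arr.of_injective
  rw [of_blockMove, Symmetry.of_braid_zero_left, Arr.I_zero, mul_one,
    Arr.of_eqId (by omega)]
  exact congrArg (Arr.I E.toDGCat) (by omega)

namespace Extension

variable (X : Extension H) (hΦ : Φ.IsDGFunctor) (M : MonStr (D := E.toMonDGCat) Φ)
include X hΦ

/-- The block permutation of the general product moves inputs past an empty block here, so it is the
identification used in the definition of `lamV`. This makes λ an iterated product. -/
theorem lamV_tmk (n : ℕ) (x : vpow ((H.op Φ).obj 0) n) (y : (H.op Φ).obj 0) :
    H.lamV M (n + 1) (tmk x y) = pairM H M n 1 0 0 (H.lamV M n x) y := by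
  have h := lift_comp_gen (H := H) Φ (m := 0) (T := fun k =>
      biadd (fun (y : Φ.obj (k + 1 + 0)) (x : vpow ((H.op Φ).obj 0) n) =>
          (H.gen (H.pow n Φ) 0 k ((H.pow n Φ).act
            (H.rmul (fun _ _ => M.mul) n 0 (k + 1 + 0) (H.lamV M n x) y)
            (E.eqId (0 + (k + 1 + 0)) (k + 1 + 0))) : (H.op (H.pow n Φ)).obj 0))
        (fun y y' x => by simp) (fun y x x' => by simp))
      (((pairM H M n 1 0 0).comp (H.lamV M n)).flip) (fun k y => by
        ext x
        refine Eq.trans ?_ ((X.isProduct_mul hΦ M).pair_pgen (n' := 0) (b := 0) (k := k)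
          (H.lamV M n x) y).symm
        rw [blockMove_zero_left]
        rfl)
  exact DFunLike.congr_fun (DFunLike.congr_fun h y) x

theorem lam_V (n : ℕ) (x : H.T Φ (0, n)) (y : (H.op Φ).obj 0) :
    H.lam M (0, n + 1) (tmk x y : tensor (vpow ((H.op Φ).obj 0) n) _) =
      H.mulC M (0, n) (0, 1) (H.lam M (0, n) x) y :=
  X.lamV_tmk hΦ M n x y

omit X hΦ in
theorem lam_W (m n : ℕ) (x : H.T Φ (m, n)) (y : Φ.obj 1) :
    H.lam M (m + 1, n) (tmk x y : tensor (vwpow ((H.op Φ).obj 0) (Φ.obj 1) n m) _) =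
      H.mulC M (m, n) (1, 0) (H.lam M (m, n) x) y := rfl

omit X hΦ in
theorem lam_tone : H.lam M 0 (tone _ _) = M.one := one_smul ℤ M.one

theorem T_isComplex (p : ℕ × ℕ) : (H.T Φ p).IsComplex :=
  vwpow_isComplex ((X.pow_isDGFunctor hΦ 1).isComplex 0) (hΦ.isComplex 1) _ _

omit X hΦ in
theorem unitMap_isChainMap : IsChainMap M.unitMap := by
  refine ⟨fun i (z : ULift.{v} ℤ) hz => ?_, fun z => ?_⟩
  · by_cases h : i = 0
    · subst h; exact zsmul_mem M.one_deg _
    · have hz : z ∈ (if i = 0 then ⊤ else ⊥ : AddSubgroup (ULift.{v} ℤ)) := hz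
      rw [if_neg h, AddSubgroup.mem_bot] at hz
      subst hz
      exact (map_zero M.unitMap).symm ▸ zero_mem _
  · change M.unitMap 0 = (Φ.obj 0).d ((z : ULift.{v} ℤ).down • M.one)
    rw [map_zero, map_zsmul, M.one_d, smul_zero]

theorem lam_isChainMap (p : ℕ × ℕ) : IsChainMap (H.lam M p) := by
  obtain ⟨m, n⟩ := p
  induction m with
  | zero =>
    induction n with
    | zero => exact unitMap_isChainMap M
    | succ n ih =>
      have h : H.lam M (0, n + 1) = onTensor (((H.mulC M (0, n) (0, 1)).comp
          (H.lam M (0, n))).compl₂ (AddMonoidHom.id ((H.op Φ).obj 0))) :=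
        tensor_hom_ext fun x y => X.lamV_tmk hΦ M n x y
      rw [h]
      exact ((X.mulC_isPairing hΦ M (0, n) (0, 1)).comp ih (IsChainMap.id _)).isChainMap
        (X.T_isComplex hΦ (0, n))
  | succ m ih =>
    exact ((X.mulC_isPairing hΦ M (m, n) (1, 0)).comp ih (IsChainMap.id _)).isChainMap
        (X.T_isComplex hΦ (m, n))

/-- At each step λ is the previous λ, tensored with an identity, followed by a product that is
bijective for split Φ. -/
theorem lam_bijective (hM : M.Split) (p : ℕ × ℕ) : Function.Bijective (H.lam M p) := by
  have hb : ∀ p q, Function.Bijective (onTensor (H.mulC M p q)) := fun p q =>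
    (X.isProduct_mul hΦ M).pair_bijective hM.2 _ _ _ _
  obtain ⟨m, n⟩ := p
  induction m with
  | zero =>
    induction n with
    | zero => exact hM.1
    | succ n ih =>
      have h : H.lam M (0, n + 1) = (onTensor (H.mulC M (0, n) (0, 1))).comp
          (tmap (H.lam M (0, n)) (AddMonoidHom.id ((H.op Φ).obj 0))) :=
        tensor_hom_ext fun x y => X.lamV_tmk hΦ M n x y
      rw [h]
      exact (hb (0, n) (0, 1)).comp (tmap_bijective ih Function.bijective_id)
  | succ m ih =>
    have h : H.lam M (m + 1, n) = (onTensor (H.mulC M (m, n) (1, 0))).comp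
        (tmap (H.lam M (m, n)) (AddMonoidHom.id (Φ.obj 1))) :=
      tensor_hom_ext fun x y => rfl
    rw [h]
    exact (hb (m, n) (1, 0)).comp (tmap_bijective ih Function.bijective_id)

omit hΦ in
theorem total_act_eqId (hF : (X.total Φ).IsDGFunctor) {p : ℕ × ℕ} (x : (X.total Φ).obj p) :
    X.act Φ p p x (X.cat.eqId p p) = x := by
  rw [DGCat.eqId_self]
  exact hF.act_one x

theorem mulC_one_V (y : (H.op Φ).obj 0) :
    H.mulC M (0, 0) (0, 1) (M.one : Φ.obj 0) y = (y : (H.pow 1 Φ).obj 0) := by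
  have h := (X.totalMon hΦ M).one_mul (a := (0, 1)) y
  exact (X.total_act_eqId (X.total_isDGFunctor hΦ) (p := (0, 1)) _).symm.trans h

theorem mulC_one_W (y : Φ.obj 1) :
    H.mulC M (0, 0) (1, 0) (M.one : Φ.obj 0) y = y := by
  have h := (X.totalMon hΦ M).one_mul (a := (1, 0)) y
  exact (X.total_act_eqId (X.total_isDGFunctor hΦ) (p := (1, 0)) _).symm.trans h

theorem mulC_one_right {m n : ℕ} (x : (H.pow n Φ).obj m) :
    H.mulC M (m, n) (0, 0) x (M.one : Φ.obj 0) = x := by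
  have h := (X.totalMon hΦ M).mul_one (a := (m, n)) x
  exact (X.total_act_eqId (X.total_isDGFunctor hΦ) (p := (m, n)) _).symm.trans h

theorem lam_inV (y : (H.op Φ).obj 0) : H.lam M (0, 1) (inV _ _ y) = y := by
  have h := X.lam_V hΦ M 0 (tone _ _) y
  refine h.trans ?_
  refine (congrArg (fun t => H.mulC M (0, 0) (0, 1) t y) (lam_tone M)).trans ?_
  exact X.mulC_one_V hΦ M y

theorem lam_inW (y : Φ.obj 1) : H.lam M (1, 0) (inW _ _ y) = y := by
  have h := lam_W (H := H) M 0 0 (tone _ _) y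
  refine h.trans ?_
  refine (congrArg (fun t => H.mulC M (0, 0) (1, 0) t y) (lam_tone M)).trans ?_
  exact X.mulC_one_W hΦ M y

/-- For a third factor of type (0, 1) both bracketings of the object agree by definition, so the
associator acts as an identity and can be dropped. The same holds for type (1, 0). -/
theorem mulC_assoc_V {m n m' n' : ℕ} (x : (H.pow n Φ).obj m) (y : (H.pow n' Φ).obj m')
    (z : (H.op Φ).obj 0) :
    H.mulC M (m + m', n + n') (0, 1) (H.mulC M (m, n) (m', n') x y) z =
      H.mulC M (m, n) (m', n' + 1) x (H.mulC M (m', n') (0, 1) y z) := by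
  have h := (X.totalMon hΦ M).mul_assoc (a := (m, n)) (b := (m', n')) (c := (0, 1)) x y z
  exact (X.total_act_eqId (X.total_isDGFunctor hΦ) (p := (m + m', n + n' + 1)) _).symm.trans h

theorem mulC_assoc_W {m n m' n' : ℕ} (x : (H.pow n Φ).obj m) (y : (H.pow n' Φ).obj m')
    (z : Φ.obj 1) :
    H.mulC M (m + m', n + n') (1, 0) (H.mulC M (m, n) (m', n') x y) z =
      H.mulC M (m, n) (m' + 1, n') x (H.mulC M (m', n') (1, 0) y z) := by
  have h := (X.totalMon hΦ M).mul_assoc (a := (m, n)) (b := (m', n')) (c := (1, 0)) x y z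
  exact (X.total_act_eqId (X.total_isDGFunctor hΦ) (p := (m + m' + 1, n + n')) _).symm.trans h

end Extension

end

end HochschildAction
namespace HochschildAction

/-! ### Reordering of tensor factors -/

section Shuffle

variable {V W : PreComplex.{v}}

theorem insV_tmk_even (hV : V.IsComplex) {n m : ℕ} {i : ℤ} (hi : Even i) (x : vwpow V W n m)
    (w : W) {y : V} (hy : y ∈ V.deg i) :
    insV V W n (m + 1) (tmk x w : tensor (vwpow V W n m) W) y =
      (tmk (insV V W n m x y) w : tensor (vwpow V W (n + 1) m) W) := by
  change (tmk (insV V W n m x (V.scale (fun i => if Even i then 1 else 0) y)) w +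
    tmk (insV V W n m x (V.scale (fun i => if Even i then 0 else 1) y)) (W.koszul 1 w) :
      tensor (vwpow V W (n + 1) m) W) = _
  rw [scale_apply hV.internal _ hy, scale_apply hV.internal _ hy, if_pos hi, if_pos hi, one_smul,
    zero_smul, map_zero, tmk_zero_left, add_zero]

theorem insV_tmk_odd (hV : V.IsComplex) {n m : ℕ} {i : ℤ} (hi : ¬ Even i) (x : vwpow V W n m)
    (w : W) {y : V} (hy : y ∈ V.deg i) :
    insV V W n (m + 1) (tmk x w : tensor (vwpow V W n m) W) y =
      (tmk (insV V W n m x y) (W.koszul 1 w) : tensor (vwpow V W (n + 1) m) W) := by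
  change (tmk (insV V W n m x (V.scale (fun i => if Even i then 1 else 0) y)) w +
    tmk (insV V W n m x (V.scale (fun i => if Even i then 0 else 1) y)) (W.koszul 1 w) :
      tensor (vwpow V W (n + 1) m) W) = _
  rw [scale_apply hV.internal _ hy, scale_apply hV.internal _ hy, if_neg hi, if_neg hi, one_smul,
    zero_smul, map_zero, tmk_zero_left, zero_add]

/-- Splitting y into even and odd parts in `insV` produces exactly the Koszul sign, which depends
only on the parity of |y|. -/
theorem insV_tmk (hV : V.IsComplex) (hW : W.IsComplex) {n m : ℕ} {i : ℤ} (x : vwpow V W n m)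
    (w : W) {y : V} (hy : y ∈ V.deg i) :
    insV V W n (m + 1) (tmk x w : tensor (vwpow V W n m) W) y =
      (tmk (insV V W n m x y) (W.koszul i w) : tensor (vwpow V W (n + 1) m) W) := by
  by_cases hi : Even i
  · rw [insV_tmk_even hV hi x w hy, koszul_even hW.internal hi]
  · rw [insV_tmk_odd hV hi x w hy]
    rw [koszul_congr hW.internal (m := 1) (n := i)]
    rw [Int.not_even_iff_odd] at hi
    exact (odd_one.sub_odd hi)

/-- Insertion only reorders factors, so its values generate. The same is then true of `shuffle`, and
a statement about V^{⊗n} ⊗ W^{⊗m} may be checked on reordered products. -/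
theorem insV_mem (hV : V.IsComplex) (hW : W.IsComplex) {n m : ℕ}
    (S : AddSubgroup (vwpow V W (n + 1) m)) (hS : ∀ x y, insV V W n m x y ∈ S)
    (z : vwpow V W (n + 1) m) : z ∈ S := by
  induction m with
  | zero => exact tensor_induction (p := fun z => z ∈ S) z hS fun x y hx hy => add_mem hx hy
  | succ m ih =>
    refine tensor_induction (p := fun z => z ∈ S) z (fun x w => ?_) fun x y hx hy => add_mem hx hy
    refine ih (S.comap ((tmkHom _ _).flip w)) (fun x y => ?_) x
    refine hom_induction hV.internal (p := fun y => insV V W n m x y ∈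
      S.comap ((tmkHom _ _).flip w)) y ?_ (fun y y' hy hy' => ?_) fun i y hy => ?_
    · rw [map_zero]; exact zero_mem _
    · rw [map_add]; exact add_mem hy hy'
    -- The sign put on w beforehand cancels the one that the insertion creates.
    · have := hS (tmk x (W.koszul i w) : tensor (vwpow V W n m) W) y
      rw [insV_tmk hV hW x _ hy, koszul_koszul hW.internal, koszul_even hW.internal ⟨i, rfl⟩] at this
      exact this

theorem shuffle_mem (hV : V.IsComplex) (hW : W.IsComplex) {p q : ℕ × ℕ}
    (S : AddSubgroup (tpow V W (p + q))) (hS : ∀ x y, shuffle V W p q x y ∈ S)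
    (z : tpow V W (p + q)) : z ∈ S := by
  obtain ⟨m, n⟩ := p
  obtain ⟨m', n'⟩ := q
  induction m' with
  | zero =>
    induction n' with
    | zero =>
      have := hS z (ULift.up 1 : ULift.{v} ℤ)
      change (1 : ℤ) • z ∈ S at this
      rwa [one_smul] at this
    | succ n' ih =>
      refine insV_mem (n := n + n') (m := m) hV hW S (fun x y => ?_) z
      exact ih (S.comap ((insV V W (n + n') m).flip y)) (fun x z => hS x (tmk z y :
        tensor (vpow V n') V)) x
  | succ m' ih =>
    refine tensor_induction (M := vwpow V W (n + n') (m + m')) (p := fun z => z ∈ S) z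
      (fun x w => ?_) fun x y hx hy => add_mem hx hy
    exact ih (S.comap ((tmkHom (vwpow V W (n + n') (m + m')) W).flip w)) (fun x z => hS x (tmk z w :
        tensor (vwpow V W n' m') W)) x

end Shuffle

namespace Extension

variable {E : DGProp.{u}} {A : AInfMult E} {H : Variant A} {Φ : PreFunctor.{u, v} E.toDGCat}
  (X : Extension H) (hΦ : Φ.IsDGFunctor) (M : MonStr (D := E.toMonDGCat) Φ)

theorem _root_.HochschildAction.sgn_map {M N : Type*} [AddCommGroup M] [AddCommGroup N] (f : M →+ N)
    {a b c : ℤ} (x : M) (h : Even (a - (b + c))) :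
    f (sgn a • x) = sgn b • f (sgn c • x) := by
  rw [map_zsmul, map_zsmul, sgn_smul_smul]
  exact sgn_smul_congr _ h

theorem blockMove_one (k : ℕ) : blockMove E 1 (k + 1) 0 = E.sym.braid 1 (k + 1) := by
  apply Arr.of_injective
  rw [of_blockMove, Arr.I_zero, mul_one]

section Commute

variable (hM : M.Symmetric E.sym)
include X hΦ hM

/-- The elementary exchange of a factor W with a factor V. It is here that the symmetry of Φ enters
the compatibility of λ with reorderings. -/
theorem mulC_W_V {i j : ℤ} {w : Φ.obj 1} {y : (H.op Φ).obj 0} (hw : w ∈ (Φ.obj 1).deg i)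
    (hy : y ∈ ((H.op Φ).obj 0).deg j) :
    H.mulC M (1, 0) (0, 1) w y = sgn (i * j) • H.mulC M (0, 1) (1, 0) y w := by
  refine H.op_deg_le (Φ := Φ) (AddMonoidHom.eqLocus (H.mulC M (1, 0) (0, 1) w)
    (sgn (i * j) • (H.mulC M (0, 1) (1, 0)).flip w)) ?_ hy
  rintro k l y hyl rfl
  have h1 : H.mulC M (1, 0) (0, 1) w (H.gen Φ 0 k y) = _ :=
    (X.isProduct_mul hΦ M).pair_pgen (n := 0) (n' := 0) (a := 1) (b := 0) (k := k) w y
  have h2 : H.mulC M (0, 1) (1, 0) (H.gen Φ 0 k y) w = _ :=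
    (X.isProduct_mul hΦ M).rmul_pgen (n := 0) (a := 0) (b := 1) (k := k) y w
  refine (h1.trans ?_).trans (congrArg (fun t => sgn (i * (l + k)) • t) h2.symm)
  -- In w y the inputs of l_{k+1} are moved past the input of w, and the symmetry of Φ turns this
  -- into y w with sign (-1)^(i l). In the other product l_{k+1} moves past w with sign (-1)^(i k).
  rw [blockMove_one, koszul_apply (hΦ.isComplex 1).internal k hw]
  have h3 : Φ.act (M.mul w y) (E.sym.braid 1 (k + 1)) = _ := hM i l w y hw hyl
  refine (congrArg (H.pgen Φ 0 1 k) h3).trans ?_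
  have h4 : (H.pow 0 Φ).act (H.rmul (F := Φ) (G := Φ) (K := Φ) (fun _ _ => M.mul) 0 (k + 1 + 0) 1
      y (sgn (k * i) • w)) (E.eqId (k + 1 + 0 + 1) (k + 1 + (0 + 1))) =
      sgn (k * i) • M.mul y w := by
    have e : (E.eqId (k + 1 + 0 + 1) (k + 1 + (0 + 1))) = E.one (k + 1 + 1) := E.eqId_self _
    rw [e]
    refine (hΦ.act_one _).trans ?_
    exact map_zsmul (M.mul y) _ _
  refine Eq.trans ?_ (congrArg (fun t => _ • H.pgen Φ 0 1 k t) h4.symm)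
  exact sgn_map (H.pgen Φ 0 1 k) (M.mul y w) ⟨-(i * k), by ring⟩

theorem lam_insV {m n : ℕ} (x : H.T Φ (m, n)) (y : (H.op Φ).obj 0) :
    H.lam M (m, n + 1) (insV _ _ n m x y) = H.mulC M (m, n) (0, 1) (H.lam M (m, n) x) y := by
  have hV : ((H.op Φ).obj 0).IsComplex := (X.pow_isDGFunctor hΦ 1).isComplex 0
  have hW := hΦ.isComplex 1
  induction m generalizing y with
  | zero => exact X.lam_V hΦ M n x y
  | succ m ih =>
    refine HochschildAction.hom_ext hV.internal
      (f := (H.lam M (m + 1, n + 1)).comp (insV _ _ n (m + 1) x))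
      (g := H.mulC M (m + 1, n) (0, 1) (H.lam M (m + 1, n) x)) (fun i y hy => ?_) y
    refine tensor_hom_ext_of_deg (X.T_isComplex hΦ (m, n)) hW
      (f := (H.lam M (m + 1, n + 1)).comp ((insV _ _ n (m + 1)).flip y))
      (g := ((H.mulC M (m + 1, n) (0, 1)).flip y).comp (H.lam M (m + 1, n)))
      (fun _ j x w _ hw => ?_) x
    change H.lam M (m + 1, n + 1) (insV _ _ n (m + 1) (tmk x w) y) =
      H.mulC M (m + 1, n) (0, 1) (H.mulC M (m, n) (1, 0) (H.lam M (m, n) x) w) y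
    have h1 := X.mulC_assoc_V hΦ M (m := m) (n := n) (m' := 1) (n' := 0) (H.lam M (m, n) x) w y
    have h2 := X.mulC_assoc_W hΦ M (m := m) (n := n) (m' := 0) (n' := 1) (H.lam M (m, n) x) y
      ((Φ.obj 1).koszul i w)
    rw [insV_tmk hV hW x w hy]
    refine (lam_W (H := H) M m (n + 1) _ _).trans ?_
    refine (congrArg (fun t => H.mulC M (m, n + 1) (1, 0) t _) (ih x y)).trans ?_
    refine h2.trans (Eq.trans ?_ h1.symm)
    rw [X.mulC_W_V hΦ M hM hw hy, koszul_apply hW.internal i hw]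
    refine congrArg (H.mulC M (m, n) (1, 1) (H.lam M (m, n) x)) ?_
    rw [mul_comm j i]
    exact map_zsmul (H.mulC M (0, 1) (1, 0) y) _ w

/-- By induction on the factors of y: a new factor W is appended at the end, and a new factor V is
inserted in front of the factors W of x, which costs the exchange `mulC_W_V`. -/
theorem lam_shuffle (p q : ℕ × ℕ) (x : H.T Φ p) (y : H.T Φ q) :
    H.lam M (p + q) (shuffle _ _ p q x y) = H.mulC M p q (H.lam M p x) (H.lam M q y) := by
  obtain ⟨m, n⟩ := p
  obtain ⟨m', n'⟩ := q
  induction m' with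
  | zero =>
    induction n' with
    | zero =>
      have h := X.mulC_one_right hΦ M (H.lam M (m, n) x)
      change H.lam M (m, n) ((y : ULift.{v} ℤ).down • x) =
        H.mulC M (m, n) (0, 0) (H.lam M (m, n) x) ((y : ULift.{v} ℤ).down • (M.one : Φ.obj 0))
      rw [map_zsmul]
      refine Eq.trans ?_ (map_zsmul (H.mulC M (m, n) (0, 0) (H.lam M (m, n) x)) _ _).symm
      exact congrArg _ h.symm
    | succ n' ih =>
      refine DFunLike.congr_fun (tensor_hom_ext (M := vpow _ n')
        (f := (H.lam M (m, n + n' + 1)).comp (shuffle _ _ (m, n) (0, n' + 1) x))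
        (g := (H.mulC M (m, n) (0, n' + 1) (H.lam M (m, n) x)).comp (H.lam M (0, n' + 1)))
        fun y v => ?_) y
      have h := X.lam_insV hΦ M hM (m := m) (n := n + n') (shuffle _ _ (m, n) (0, n') x y) v
      have h' := ih y
      refine (h.trans ?_).trans (congrArg (H.mulC M (m, n) (0, n' + 1) (H.lam M (m, n) x))
        (X.lam_V hΦ M n' y v).symm)
      refine (congrArg (fun t => H.mulC M (m, n + n') (0, 1) t v) h').trans ?_
      exact X.mulC_assoc_V hΦ M (m' := 0) _ _ _
  | succ m' ih =>
    refine DFunLike.congr_fun (tensor_hom_ext (M := vwpow _ _ n' m')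
        (f := (H.lam M (m + m' + 1, n + n')).comp (shuffle _ _ (m, n) (m' + 1, n') x))
        (g := (H.mulC M (m, n) (m' + 1, n') (H.lam M (m, n) x)).comp (H.lam M (m' + 1, n')))
        fun y v => ?_) y
    have h' := ih y
    refine (lam_W (H := H) M (m + m') (n + n') (shuffle _ _ (m, n) (m', n') x y) v).trans ?_
    refine (congrArg (fun t => H.mulC M (m + m', n + n') (1, 0) t v) h').trans ?_
    exact X.mulC_assoc_W hΦ M _ _ _

end Commute

end Extension

end HochschildAction
namespace HochschildAction

/-! ### Naturality -/

section Naturality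

variable {E : DGProp.{u}} {A : AInfMult E} {H : Variant A} {Φ Φ' : PreFunctor.{u, v} E.toDGCat}

namespace Variant

theorem map_pgen_of {η : ∀ a, Φ.obj a →+ Φ'.obj a} {n : ℕ}
    (h : ∀ {m m' : ℕ} (x : (H.pow n Φ).obj m) (f : E.Hom m m'),
      H.map η n m' ((H.pow n Φ).act x f) = (H.pow n Φ').act (H.map η n m x) f)
    {m k : ℕ} (x : (H.pow n Φ).obj (k + 1 + m)) :
    H.map η (n + 1) m (H.pgen Φ n m k x) = H.pgen Φ' n m k (H.map η n (k + 1 + m) x) := by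
  refine H.pow_lift (Φ := Φ) (fun k => (H.pgen Φ' n m k).comp (H.map η n (k + 1 + m)))
    (fun k g hg y => ?_) k x
  rw [AddMonoidHom.comp_apply, h, H.pgen_face hg]

end Variant

namespace Extension

variable (X : Extension H) (hΦ : Φ.IsDGFunctor) (hΦ' : Φ'.IsDGFunctor)
  {η : ∀ a, Φ.obj a →+ Φ'.obj a}
  (hη : ∀ {a b} (x : Φ.obj a) (f : E.Hom a b), η b (Φ.act x f) = Φ'.act (η a x) f)
include X hΦ hΦ' hη

theorem map_act {n m m' : ℕ} (x : (H.pow n Φ).obj m) (f : E.Hom m m') :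
    H.map η n m' ((H.pow n Φ).act x f) = (H.pow n Φ').act (H.map η n m x) f := by
  induction n generalizing m m' with
  | zero => exact hη x f
  | succ n ih =>
    refine H.pow_hom_ext (Φ := Φ) (f := (H.map η (n + 1) m').comp ((H.pow (n + 1) Φ).act.flip f))
      (g := ((H.pow (n + 1) Φ').act.flip f).comp (H.map η (n + 1) m)) (fun k x => ?_) x
    change H.map η (n + 1) m' ((H.pow (n + 1) Φ).act (H.pgen Φ n m k x) f) =
      (H.pow (n + 1) Φ').act (H.map η (n + 1) m (H.pgen Φ n m k x)) f
    rw [H.act_pgen (X.pow_isDGFunctor hΦ n), Variant.map_pgen_of ih,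
      Variant.map_pgen_of ih, H.act_pgen (X.pow_isDGFunctor hΦ' n), ih]

theorem map_pgen {n m k : ℕ} (x : (H.pow n Φ).obj (k + 1 + m)) :
    H.map η (n + 1) m (H.pgen Φ n m k x) = H.pgen Φ' n m k (H.map η n (k + 1 + m) x) :=
  Variant.map_pgen_of (X.map_act hΦ hΦ' hη) x

/-- A natural transformation only touches x. As the action and the products operate on z inside Ẽ,
their naturality follows. -/
theorem map_ev {a n m : ℕ} (x : Φ.obj a) (z : (H.pow n (rep E.toDGCat a)).obj m) :
    H.map η n m (H.ev Φ a n m x z) = H.ev Φ' a n m (η a x) z := by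
  induction n generalizing m with
  | zero => exact hη x z
  | succ n ih =>
    refine H.pow_hom_ext (Φ := rep E.toDGCat a)
      (f := (H.map η (n + 1) m).comp (H.ev Φ a (n + 1) m x))
      (g := H.ev Φ' a (n + 1) m (η a x)) (fun k z => ?_) z
    rw [AddMonoidHom.comp_apply, X.ev_gen hΦ, X.map_pgen hΦ hΦ' hη, X.ev_gen hΦ', ih]

theorem map_evX {a : ℕ} {p : ℕ × ℕ} (x : Φ.obj a) (f : X.cat.Hom (a, 0) p) :
    H.map η p.2 p.1 (X.evX hΦ a p x f) = X.evX hΦ' a p (η a x) f :=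
  X.map_ev hΦ hΦ' hη x _

theorem map_total_act {p q : ℕ × ℕ} (x : (H.pow p.2 Φ).obj p.1) (f : X.cat.Hom p q) :
    H.map η q.2 q.1 (X.act Φ p q x f) = X.act Φ' p q (H.map η p.2 p.1 x) f := by
  refine X.evX_hom_ext hΦ (f := (H.map η q.2 q.1).comp ((X.act Φ p q).flip f))
    (g := ((X.act Φ' p q).flip f).comp (H.map η p.2 p.1)) (fun a _ _ x z _ _ => ?_) x
  change H.map η q.2 q.1 (X.act Φ p q (X.evX hΦ a p x z) f) =
    X.act Φ' p q (H.map η p.2 p.1 (X.evX hΦ a p x z)) f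
  rw [X.act_evX hΦ, X.map_evX hΦ hΦ' hη, X.map_evX hΦ hΦ' hη, X.act_evX hΦ']

omit hη in
theorem map_mulC {M : MonStr (D := E.toMonDGCat) Φ} {M' : MonStr (D := E.toMonDGCat) Φ'}
    (hη : IsMonNat M M' η) {p q : ℕ × ℕ} (x : (H.pow p.2 Φ).obj p.1)
    (y : (H.pow q.2 Φ).obj q.1) :
    H.map η (p + q).2 (p + q).1 (H.mulC M p q x y) =
      H.mulC M' p q (H.map η p.2 p.1 x) (H.map η q.2 q.1 y) := by
  refine X.evX_hom_ext hΦ (f := (H.map η (p + q).2 (p + q).1).comp ((H.mulC M p q).flip y))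
    (g := ((H.mulC M' p q).flip (H.map η q.2 q.1 y)).comp (H.map η p.2 p.1))
    (fun a _ _ x f _ hf => ?_) x
  refine X.evX_hom_ext hΦ (f := (H.map η (p + q).2 (p + q).1).comp
      (H.mulC M p q (X.evX hΦ a p x f)))
    (g := (H.mulC M' p q (H.map η p.2 p.1 (X.evX hΦ a p x f))).comp (H.map η q.2 q.1))
    (fun b k _ y g hy _ => ?_) y
  change H.map η (p + q).2 (p + q).1 (H.mulC M p q (X.evX hΦ a p x f) (X.evX hΦ b q y g)) =
    H.mulC M' p q (H.map η p.2 p.1 (X.evX hΦ a p x f)) (H.map η q.2 q.1 (X.evX hΦ b q y g))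
  rw [X.mulC_evX_of_deg hΦ M x g hf hy, map_zsmul, X.map_evX hΦ hΦ' hη.map_act,
    X.map_evX hΦ hΦ' hη.map_act,
    hη.map_mul, ← X.mulC_evX_of_deg hΦ' M' _ g hf ((hη.chain b).map_deg k y hy)]
  exact congrArg _ (X.map_evX hΦ hΦ' hη.map_act y g).symm

omit hη in
theorem map_lam {M : MonStr (D := E.toMonDGCat) Φ} {M' : MonStr (D := E.toMonDGCat) Φ'}
    (hη : IsMonNat M M' η) (p : ℕ × ℕ) (x : H.T Φ p) :
    H.lam M' p (vwmap (H.map η 1 0) (η 1) p.2 p.1 x) = H.map η p.2 p.1 (H.lam M p x) := by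
  obtain ⟨m, n⟩ := p
  induction m with
  | zero =>
    induction n with
    | zero =>
      change (x : ULift.{v} ℤ).down • M'.one = η 0 ((x : ULift.{v} ℤ).down • M.one)
      rw [map_zsmul, hη.map_one]
    | succ n ih =>
      refine DFunLike.congr_fun (tensor_hom_ext (M := vpow _ n)
        (f := (H.lam M' (0, n + 1)).comp (vwmap (H.map η 1 0) (η 1) (n + 1) 0))
        (g := (H.map η (n + 1) 0).comp (H.lam M (0, n + 1))) fun x y => ?_) x
      refine (X.lam_V hΦ' M' n (vmap (H.map η 1 0) n x) (H.map η 1 0 y)).trans ?_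
      refine Eq.trans ?_ (congrArg (H.map η (n + 1) 0) (X.lam_V hΦ M n x y).symm)
      refine Eq.trans ?_ (X.map_mulC hΦ hΦ' hη (p := (0, n)) (q := (0, 1)) _ _).symm
      exact congrArg (fun t => H.mulC M' (0, n) (0, 1) t (H.map η 1 0 y)) (ih x)
  | succ m ih =>
    refine DFunLike.congr_fun (tensor_hom_ext (M := vwpow _ _ n m)
      (f := (H.lam M' (m + 1, n)).comp (vwmap (H.map η 1 0) (η 1) n (m + 1)))
      (g := (H.map η n (m + 1)).comp (H.lam M (m + 1, n))) fun x y => ?_) x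
    refine (lam_W (H := H) M' m n (vwmap (H.map η 1 0) (η 1) n m x) (η 1 y)).trans ?_
    refine Eq.trans ?_ (X.map_mulC hΦ hΦ' hη (p := (m, n)) (q := (1, 0)) _ _).symm
    exact congrArg (fun t => H.mulC M' (m, n) (1, 0) t (η 1 y)) (ih x)

end Extension

end Naturality

/-! ### Transport of structure along isomorphisms -/

section Transport

variable {O : Type} [AddMonoid O]

/-- Chain isomorphisms, with their inverses, onto the values of a dg-functor. -/
structure ChainIso {D : DGCat.{u} O} (F : PreFunctor.{u, v} D) (G : O → PreComplex.{v})
    (l : ∀ p, G p →+ F.obj p) (s : ∀ p, F.obj p →+ G p) : Prop where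
  complex : ∀ p, (G p).IsComplex
  chain : ∀ p, IsChainMap (l p)
  chain' : ∀ p, IsChainMap (s p)
  left : ∀ p x, s p (l p x) = x
  right : ∀ p x, l p (s p x) = x

theorem IsChainMap.inverse {M N : PreComplex.{v}} (hM : M.IsComplex) (hN : N.IsComplex)
    {f : M →+ N} {g : N →+ M} (hf : IsChainMap f) (hgf : ∀ x, g (f x) = x)
    (hfg : ∀ x, f (g x) = x) : IsChainMap g := by
  refine ⟨fun i x hx => ?_, fun x => ?_⟩
  -- The map f commutes with the projections onto degree i. Therefore g x is fixed by this
  -- projection and has degree i.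
  · let c : ℤ → ℤ := fun j => if j = i then 1 else 0
    have h1 : ∀ y : M, f (M.scale c y) = N.scale c (f y) := fun y =>
      hom_ext hM.internal (f := f.comp (M.scale c)) (g := (N.scale c).comp f) (fun j y hy => by
        rw [AddMonoidHom.comp_apply, AddMonoidHom.comp_apply, scale_apply hM.internal c hy,
          scale_apply hN.internal c (hf.map_deg j y hy), map_zsmul]) y
    have h2 : ∀ y : M, M.scale c y ∈ M.deg i := fun y => by
      refine hom_induction hM.internal (p := fun y => M.scale c y ∈ M.deg i) y
        (by rw [map_zero]; exact zero_mem _) (fun y y' h h' => by rw [map_add]; exact add_mem h h')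
        fun j y hy => ?_
      rw [scale_apply hM.internal c hy]
      by_cases hj : j = i
      · subst hj; exact zsmul_mem hy _
      · simp [c, hj]
    have h3 : M.scale c (g x) = g x := by
      rw [← hgf (M.scale c (g x)), h1, hfg, scale_apply hN.internal c hx]
      simp [c]
    rw [← h3]
    exact h2 _
  · rw [← hgf (M.d (g x)), hf.map_d, hfg]

variable {D : MonDGCat.{u} O} {F : PreFunctor.{u, v} D.toDGCat} {G : O → PreComplex.{v}}
  {l : ∀ p, G p →+ F.obj p} {s : ∀ p, F.obj p →+ G p}

/-- The functor with values `G p` obtained from `F` through the isomorphisms `l`. -/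
noncomputable def PreFunctor.via {D : DGCat.{u} O} (F : PreFunctor.{u, v} D) (G : O → PreComplex.{v})
    (l : ∀ p, G p →+ F.obj p) (s : ∀ p, F.obj p →+ G p) : PreFunctor.{u, v} D where
  obj := G
  act {p q} := (F.act.comp (l p)).compr₂ (s q)

theorem ChainIso.isDGFunctor (hs : ChainIso F G l s) (hF : F.IsDGFunctor) :
    (F.via G l s).IsDGFunctor where
  isComplex := hs.complex
  act_deg {p q} i j x f hx hf := (hs.chain' q).map_deg _ _ (hF.act_deg i j _ f
    ((hs.chain p).map_deg i x hx) hf)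
  act_d {p q} i (x : G p) f (hx : x ∈ (G p).deg i) := by
    change (G q).d (s q (F.act (l p x) f)) = s q (F.act (l p ((G p).d x)) f) +
      sgn i • s q (F.act (l p x) ((D.Hom p q).d f))
    rw [← (hs.chain' q).map_d, hF.act_d i _ f ((hs.chain p).map_deg i x hx), (hs.chain p).map_d,
      map_add, map_zsmul]
  act_one {p} (x : G p) := by
    change s p (F.act (l p x) (D.one p)) = x
    rw [hF.act_one, hs.left]
  act_comp {p q r} (x : G p) f g := by
    change s r (F.act (l p x) (D.comp f g)) = s r (F.act (l q (s q (F.act (l p x) f))) g)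
    rw [hs.right, hF.act_comp]

/-- The monoidal structure obtained through the isomorphisms `l`. -/
noncomputable def MonStr.via (hs : ChainIso F G l s) (S : MonStr F) : MonStr (F.via G l s) where
  one := s 0 S.one
  mul {p q} := ((S.mul.comp (l p)).compl₂ (l q)).compr₂ (s (p + q))
  one_deg := (hs.chain' 0).map_deg 0 _ S.one_deg
  one_d := ((hs.chain' 0).map_d _).symm.trans (by rw [S.one_d, map_zero]; rfl)
  mul_deg {p q} i j x y hx hy := (hs.chain' _).map_deg _ _ (S.mul_deg i j _ _
    ((hs.chain p).map_deg i x hx) ((hs.chain q).map_deg j y hy))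
  mul_d {p q} i (x : G p) (y : G q) (hx : x ∈ (G p).deg i) := by
    change (G (p + q)).d (s (p + q) (S.mul (l p x) (l q y))) =
      s (p + q) (S.mul (l p ((G p).d x)) (l q y)) +
        sgn i • s (p + q) (S.mul (l p x) (l q ((G q).d y)))
    rw [← (hs.chain' _).map_d, S.mul_d i _ _ ((hs.chain p).map_deg i x hx), (hs.chain p).map_d,
      (hs.chain q).map_d, map_add, map_zsmul]
  naturality {p p' q q'} i j (x : G p) f (y : G q) g hf (hy : y ∈ (G q).deg j) := by
    change s (p' + q') (S.mul (l p' (s p' (F.act (l p x) f))) (l q' (s q' (F.act (l q y) g)))) =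
      sgn (i * j) • s (p' + q') (F.act (l (p + q) (s (p + q) (S.mul (l p x) (l q y))))
        (D.tens f g))
    rw [hs.right, hs.right, hs.right, S.naturality i j _ f _ g hf ((hs.chain q).map_deg j y hy),
      map_zsmul]
  mul_assoc {p q r} (x : G p) (y : G q) (z : G r) := by
    change s (p + (q + r)) (F.act (l (p + q + r) (s (p + q + r)
        (S.mul (l (p + q) (s (p + q) (S.mul (l p x) (l q y)))) (l r z)))) _) =
      s (p + (q + r)) (S.mul (l p x) (l (q + r) (s (q + r) (S.mul (l q y) (l r z)))))
    rw [hs.right, hs.right, hs.right, S.mul_assoc]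
  one_mul {p} (x : G p) := by
    change s p (F.act (l (0 + p) (s (0 + p) (S.mul (l 0 (s 0 S.one)) (l p x)))) _) = x
    rw [hs.right, hs.right, S.one_mul, hs.left]
  mul_one {p} (x : G p) := by
    change s p (F.act (l (p + 0) (s (p + 0) (S.mul (l p x) (l 0 (s 0 S.one))))) _) = x
    rw [hs.right, hs.right, S.mul_one, hs.left]

theorem MonStr.via_symmetric (hs : ChainIso F G l s) {S : MonStr F} {τ : Symmetry D}
    (hS : S.Symmetric τ) : (S.via hs).Symmetric τ := by
  intro p q i j x y hx hy
  change s (q + p) (F.act (l (p + q) (s (p + q) (S.mul (l p x) (l q y)))) _) =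
    sgn (i * j) • s (q + p) (S.mul (l q y) (l p x))
  rw [hs.right, hS i j _ _ ((hs.chain p).map_deg i x hx) ((hs.chain q).map_deg j y hy), map_zsmul]

end Transport

/-! ### The split case -/

namespace Extension

variable {E : DGProp.{u}} {A : AInfMult E} {H : Variant A} {Φ : PreFunctor.{u, v} E.toDGCat}
  (X : Extension H) (hΦ : Φ.IsDGFunctor) (M : MonStr (D := E.toMonDGCat) Φ)
  {σ : ∀ p : ℕ × ℕ, (H.pow p.2 Φ).obj p.1 →+ H.T Φ p}
  (hσ : ∀ p, Function.LeftInverse (σ p) (H.lam M p) ∧ Function.RightInverse (σ p) (H.lam M p))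

include hΦ hσ

theorem chainIso_lam : ChainIso (X.total Φ) (H.T Φ) (H.lam M) σ where
  complex p := X.T_isComplex hΦ p
  chain p := X.lam_isChainMap hΦ M p
  chain' p := (X.lam_isChainMap hΦ M p).inverse (X.T_isComplex hΦ p)
    ((X.pow_isDGFunctor hΦ p.2).isComplex p.1) (hσ p).1 (hσ p).2
  left p := (hσ p).1
  right p := (hσ p).2

theorem via_split (hM : M.Split) :
    ((X.totalMon hΦ M).via (X.chainIso_lam hΦ M hσ)).Split := by
  have ht : σ 0 M.one = tone _ _ := by rw [← lam_tone (H := H) M]; exact (hσ 0).1 _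
  refine ⟨⟨fun z z' h => ?_, fun z => ⟨z, ?_⟩⟩, fun p q => ?_⟩
  · change (z : ULift.{v} ℤ).down • σ 0 M.one = (z' : ULift.{v} ℤ).down • σ 0 M.one at h
    rw [ht] at h
    have h := congrArg ULift.down h
    change z.down • (1 : ℤ) = z'.down • (1 : ℤ) at h
    rw [smul_eq_mul, smul_eq_mul, mul_one, mul_one] at h
    exact ULift.ext _ _ h
  · change (z : ULift.{v} ℤ).down • σ 0 M.one = z
    rw [ht]
    refine ULift.ext _ _ ?_
    change (z : ULift.{v} ℤ).down • (1 : ℤ) = (z : ULift.{v} ℤ).down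
    rw [smul_eq_mul, mul_one]
  -- The transported product is λ ⊗ λ, then the product of the Cⁿ(Φ), then λ⁻¹, and all three are
  -- bijective.
  · have h : onTensor (((X.totalMon hΦ M).via (X.chainIso_lam hΦ M hσ)).mul (a := p) (b := q)) =
        (σ (p + q)).comp ((onTensor (H.mulC M p q)).comp (tmap (H.lam M p) (H.lam M q))) :=
      tensor_hom_ext fun x y => rfl
    rw [h]
    have hb : Function.Bijective (onTensor (H.mulC M p q)) :=
      (X.isProduct_mul hΦ M).pair_bijective hM.2 p.2 q.2 p.1 q.1
    exact (Function.bijective_iff_has_inverse.2 ⟨_, (hσ _).2, (hσ _).1⟩).comp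
      (Function.Bijective.comp (g := onTensor (H.mulC M p q)) hb
      (tmap_bijective (X.lam_bijective hΦ M hM p) (X.lam_bijective hΦ M hM q)))

/-- The monoidal dg-functor on Ẽ is transported along λ. Its products with V and W are the plain
tensor products because λ satisfies the same recursion. -/
theorem isModule (hM : M.Split) :
    IsModule X.cat ((H.op Φ).obj 0) (Φ.obj 1) (X.gammaVia M σ) where
  functor := (X.chainIso_lam hΦ M hσ).isDGFunctor (X.total_isDGFunctor hΦ)
  monoidal := by
    refine ⟨(X.totalMon hΦ M).via (X.chainIso_lam hΦ M hσ), X.via_split hΦ M hσ hM, ?_,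
      fun n x y => ?_, fun m n x y => ?_⟩
    · change σ 0 M.one = _
      rw [← lam_tone (H := H) M]
      exact (hσ 0).1 _
    · change σ (0, n + 1) (H.mulC M (0, n) (0, 1) (H.lam M (0, n) x)
        (H.lam M (0, 1) (inV _ _ y))) = _
      have h := X.lam_inV hΦ M y
      refine (congrArg (fun t => σ (0, n + 1) (H.mulC M (0, n) (0, 1) (H.lam M (0, n) x) t))
        h).trans ?_
      refine (congrArg (σ (0, n + 1)) (X.lam_V hΦ M n x y).symm).trans ?_
      exact (hσ (0, n + 1)).1 _
    · change σ (m + 1, n) (H.mulC M (m, n) (1, 0) (H.lam M (m, n) x)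
        (H.lam M (1, 0) (inW _ _ y))) = _
      have h := X.lam_inW hΦ M y
      refine (congrArg (fun t => σ (m + 1, n) (H.mulC M (m, n) (1, 0) (H.lam M (m, n) x) t))
        h).trans ?_
      exact (hσ (m + 1, n)).1 (tmk x y : tensor (vwpow ((H.op Φ).obj 0) (Φ.obj 1) n m) _)

theorem isEquivariantModule (hM : M.Split) {τ : Symmetry X.cat} (hτ : X.Compatible τ)
    (hS : M.Symmetric E.sym) :
    IsEquivariantModule X.cat ((H.op Φ).obj 0) (Φ.obj 1) (X.gammaVia M σ) τ := by
  refine ⟨(X.totalMon hΦ M).via (X.chainIso_lam hΦ M hσ), fun p q x y => ?_, ?_,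
    X.via_split hΦ M hσ hM, MonStr.via_symmetric _ (X.totalMon_symmetric hΦ M hτ hS)⟩
  · change σ (p + q) (H.mulC M p q (H.lam M p x) (H.lam M q y)) = _
    exact (congrArg (σ (p + q)) (X.lam_shuffle hΦ M hS p q x y).symm).trans ((hσ (p + q)).1 _)
  · change σ 0 M.one = _
    rw [← lam_tone (H := H) M]
    exact (hσ 0).1 _

end Extension

end HochschildAction
namespace HochschildAction

/-! ### Chain homotopies -/


section Homotopies

theorem IsChainMap.comp {M : PreComplex.{v₁}} {N : PreComplex.{v₂}} {P : PreComplex.{v₃}}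
    {g : N →+ P} {f : M →+ N} (hg : IsChainMap g) (hf : IsChainMap f) : IsChainMap (g.comp f) :=
  ⟨fun i x hx => hg.map_deg i _ (hf.map_deg i x hx), fun x => by
    rw [AddMonoidHom.comp_apply, hf.map_d, hg.map_d, AddMonoidHom.comp_apply]⟩

theorem IsPairing.compr {M : PreComplex.{v₁}} {N : PreComplex.{v₂}} {P : PreComplex.{v₃}}
    {Q : PreComplex.{v₄}} {B : M →+ N →+ P} (h : IsPairing B) {s : P →+ Q} (hs : IsChainMap s) :
    IsPairing (B.compr₂ s) := by
  refine ⟨fun i j x y hx hy => hs.map_deg _ _ (h.deg i j x y hx hy), fun i x y hx => ?_⟩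
  change Q.d (s (B x y)) = s (B (M.d x) y) + sgn i • s (B x (N.d y))
  rw [← hs.map_d, h.d i x y hx, map_add, map_zsmul]

theorem tmap_isChainMap {M : PreComplex.{v₁}} {M' : PreComplex.{v₂}} {N : PreComplex.{v₃}}
    {N' : PreComplex.{v₄}} (hM : M.IsComplex)
    (hM' : M'.IsComplex) {f : M →+ M'} {g : N →+ N'} (hf : IsChainMap f) (hg : IsChainMap g) :
    IsChainMap (tmap f g) :=
  ((tmkHom_isPairing hM').comp hf hg).isChainMap hM

theorem tmap_comp {M : PreComplex.{v₁}} {M' : PreComplex.{v₂}} {M'' : PreComplex.{v₃}}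
    {N : PreComplex.{v₄}} {N' : PreComplex.{v₅}} {N'' : PreComplex.{v₆}} (f : M' →+ M'')
    (f' : M →+ M') (g : N' →+ N'') (g' : N →+ N') :
    tmap (f.comp f') (g.comp g') = (tmap f g).comp (tmap f' g') := tensor_hom_ext fun _ _ => rfl

namespace Homotopic

variable {M : PreComplex.{v₁}} {N : PreComplex.{v₂}} {P : PreComplex.{v₃}}

theorem symm {f g : M →+ N} (h : Homotopic f g) : Homotopic g f := by
  obtain ⟨k, hk, hd⟩ := h
  refine ⟨-k, fun i x hx => neg_mem (hk i x hx), fun x => ?_⟩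
  rw [AddMonoidHom.neg_apply, AddMonoidHom.neg_apply, map_neg, ← neg_add, ← hd, neg_sub]

theorem trans {f g h : M →+ N} (h₁ : Homotopic f g) (h₂ : Homotopic g h) : Homotopic f h := by
  obtain ⟨k, hk, hd⟩ := h₁
  obtain ⟨k', hk', hd'⟩ := h₂
  refine ⟨k + k', fun i x hx => add_mem (hk i x hx) (hk' i x hx), fun x => ?_⟩
  rw [AddMonoidHom.add_apply, AddMonoidHom.add_apply, map_add, add_add_add_comm, ← hd, ← hd',
    sub_add_sub_cancel]

theorem trans_symm {f g f' g' : M →+ N} (h : Homotopic f g) (h' : Homotopic f' g')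
    (hg : ∀ x, g x = g' x) : Homotopic f f' :=
  h.trans (AddMonoidHom.ext hg ▸ h'.symm)

theorem comp_left {f g : M →+ N} (h : Homotopic f g) {k : N →+ P} (hk : IsChainMap k) :
    Homotopic (k.comp f) (k.comp g) := by
  obtain ⟨l, hl, hd⟩ := h
  refine ⟨k.comp l, fun i x hx => hk.map_deg _ _ (hl i x hx), fun x => ?_⟩
  simp only [AddMonoidHom.comp_apply]
  rw [← map_sub, hd, map_add, hk.map_d]

theorem comp_right {f g : N →+ P} (h : Homotopic f g) {k : M →+ N} (hk : IsChainMap k) :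
    Homotopic (f.comp k) (g.comp k) := by
  obtain ⟨l, hl, hd⟩ := h
  refine ⟨l.comp k, fun i x hx => hl _ _ (hk.map_deg i x hx), fun x => ?_⟩
  simp only [AddMonoidHom.comp_apply]
  rw [hd, hk.map_d]

theorem tmap_left {M : PreComplex.{v₁}} {M' : PreComplex.{v₂}} {N : PreComplex.{v₃}} (hM : M.IsComplex)
    (hM' : M'.IsComplex) (hN : N.IsComplex) {f g : M →+ M'} (h : Homotopic f g) :
    Homotopic (tmap f (AddMonoidHom.id N)) (tmap g (AddMonoidHom.id N)) := by
  obtain ⟨l, hl, hd⟩ := h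
  refine ⟨tmap l (AddMonoidHom.id N), fun n z hz => ?_, fun z => ?_⟩
  · refine tensor_deg_le (((tensor M' N).deg (n + 1)).comap (tmap l (AddMonoidHom.id N))) ?_ hz
    rintro i j x y hx hy rfl
    have := tmk_deg (hl i x hx) hy
    rwa [add_right_comm] at this
  · refine tensor_hom_ext_of_deg hM hN
      (f := tmap f (AddMonoidHom.id N) - tmap g (AddMonoidHom.id N))
      (g := (tensor M' N).d.comp (tmap l (AddMonoidHom.id N)) +
        (tmap l (AddMonoidHom.id N)).comp (tensor M N).d) (fun i j x y hx hy => ?_) z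
    change tmk (f x) y - tmk (g x) y = (tensor M' N).d (tmk (l x) y) +
      tmap l (AddMonoidHom.id N) ((tensor M N).d (tmk x y))
    rw [tensor_d_of_deg hM'.internal (hl i x hx), tensor_d_of_deg hM.internal hx, map_add,
      map_zsmul, tmap_tmk, tmap_tmk, sgn_add, sgn_one, mul_neg_one, neg_smul]
    simp only [AddMonoidHom.id_apply]
    have e : tmk (f x) y = tmk (g x) y + (tmk (M'.d (l x)) y + tmk (l (M.d x)) y) := by
      rw [← tmk_add_left, ← hd, ← tmk_add_left, add_sub_cancel]
    rw [e]
    abel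

theorem tmap_right {M : PreComplex.{v₁}} {N : PreComplex.{v₂}} {N' : PreComplex.{v₃}} (hM : M.IsComplex)
    (hN : N.IsComplex) {f g : N →+ N'} (h : Homotopic f g) :
    Homotopic (tmap (AddMonoidHom.id M) f) (tmap (AddMonoidHom.id M) g) := by
  obtain ⟨l, hl, hd⟩ := h
  -- The homotopy l has degree 1 and passes x, which requires the sign (-1)^|x|.
  refine ⟨tmap (M.koszul 1) l, fun n z hz => ?_, fun z => ?_⟩
  · refine tensor_deg_le (((tensor M N').deg (n + 1)).comap (tmap (M.koszul 1) l)) ?_ hz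
    rintro i j x y hx hy rfl
    have := tmk_deg (koszul_deg hM.internal 1 hx) (hl j y hy)
    rwa [← add_assoc] at this
  · refine tensor_hom_ext_of_deg hM hN
      (f := tmap (AddMonoidHom.id M) f - tmap (AddMonoidHom.id M) g)
      (g := (tensor M N').d.comp (tmap (M.koszul 1) l) +
        (tmap (M.koszul 1) l).comp (tensor M N).d) (fun i j x y hx hy => ?_) z
    change tmk x (f y) - tmk x (g y) = (tensor M N').d (tmk (M.koszul 1 x) (l y)) +
      tmap (M.koszul 1) l ((tensor M N).d (tmk x y))
    rw [tensor_d_of_deg hM.internal hx, tensor_d, koszul_koszul hM.internal,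
      koszul_even hM.internal ⟨1, rfl⟩, map_add, map_zsmul, tmap_tmk, tmap_tmk,
      hM.koszul_d, sgn_one, neg_one_smul, koszul_apply hM.internal 1 hx, one_mul,
      tmk_zsmul_left, sgn_smul_smul]
    have e : tmk x (f y) = tmk x (g y) + (tmk x (N'.d (l y)) + tmk x (l (N.d y))) := by
      rw [← tmk_add_right, ← hd, ← tmk_add_right, add_sub_cancel]
    have e' : tmk (-M.d (sgn i • x)) (l y) = - tmk (M.d (sgn i • x)) (l y) := by
      rw [← neg_one_smul ℤ, tmk_zsmul_left, neg_one_smul]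
    rw [e, e', sgn_smul_congr (tmk x (l (N.d y))) (b := 0) (by simp), sgn_zero, one_smul]
    abel

theorem tmap_both {M : PreComplex.{v₁}} {M' : PreComplex.{v₂}} {N : PreComplex.{v₃}}
    {N' : PreComplex.{v₄}} (hM : M.IsComplex)
    (hM' : M'.IsComplex) (hN : N.IsComplex) (hN' : N'.IsComplex) {f g : M →+ M'} {f' g' : N →+ N'}
    (h : Homotopic f g) (h' : Homotopic f' g') (hf' : IsChainMap f') (hg : IsChainMap g) :
    Homotopic (tmap f f') (tmap g g') := by
  have h1 := (tmap_left hM hM' hN' h).comp_right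
    (tmap_isChainMap hM hM (IsChainMap.id M) hf')
  have h2 := (tmap_right hM hN h').comp_left (tmap_isChainMap hM hM' hg (IsChainMap.id N'))
  rw [← tmap_comp, ← tmap_comp] at h1 h2
  exact h1.trans h2

end Homotopic

theorem tensor₃_hom_ext {M : PreComplex.{v₁}} {N : PreComplex.{v₂}} {P : PreComplex.{v₃}}
    {R : Type w} [AddCommGroup R] {s t : tensor (tensor M N) P →+ R}
    (h : ∀ x f y, s (tmk (tmk x f) y) = t (tmk (tmk x f) y)) : s = t := by
  refine tensor_hom_ext fun z y => ?_
  exact DFunLike.congr_fun (tensor_hom_ext (f := s.comp ((tmkHom (tensor M N) P).flip y))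
    (g := t.comp ((tmkHom (tensor M N) P).flip y)) fun x f => h x f y) z

/-- The map `(M ⊗ N) ⊗ (P ⊗ Q) → R` of an additive map in four variables. -/
noncomputable def onTensor₄ {M : PreComplex.{v₁}} {N : PreComplex.{v₂}} {P : PreComplex.{v₃}}
    {Q : PreComplex.{v₄}} {R : Type w} [AddCommGroup R] (e : M →+ N →+ P →+ Q →+ R) :
    tensor (tensor M N) (tensor P Q) →+ R :=
  onTensor (onTensor (e.compr₂ (AddMonoidHom.mk' (fun t : P →+ Q →+ R => onTensor t)
    fun _ _ => tensor_hom_ext fun _ _ => rfl)))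

theorem onTensor₄_tmk {M : PreComplex.{v₁}} {N : PreComplex.{v₂}} {P : PreComplex.{v₃}}
    {Q : PreComplex.{v₄}} {R : Type w} [AddCommGroup R] (e : M →+ N →+ P →+ Q →+ R) (x : M) (f : N)
    (y : P) (g : Q) : onTensor₄ e (tmk (tmk x f) (tmk y g)) = e x f y g := rfl

section

variable {M : PreComplex.{v₁}} {N : PreComplex.{v₂}} {P : PreComplex.{v₃}} {Q : PreComplex.{v₄}}
  (hM : M.IsComplex) (hN : N.IsComplex) (hP : P.IsComplex) (hQ : Q.IsComplex)
include hM hN hP hQ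

theorem tensor₄_hom_ext {R : Type w} [AddCommGroup R]
    {s t : tensor (tensor M N) (tensor P Q) →+ R}
    (h : ∀ (i j k l : ℤ) (x : M) (f : N) (y : P) (g : Q), x ∈ M.deg i → f ∈ N.deg j →
      y ∈ P.deg k → g ∈ Q.deg l → s (tmk (tmk x f) (tmk y g)) = t (tmk (tmk x f) (tmk y g)))
    (z : tensor (tensor M N) (tensor P Q)) : s z = t z := by
  refine tensor_hom_ext_of_deg (tensor_isComplex hM hN) (tensor_isComplex hP hQ)
    (fun _ _ a b _ _ => ?_) z
  refine tensor_hom_ext_of_deg hM hN (f := s.comp ((tmkHom _ (tensor P Q)).flip b))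
    (g := t.comp ((tmkHom _ (tensor P Q)).flip b)) (fun i j x f hx hf => ?_) a
  exact tensor_hom_ext_of_deg hP hQ (f := s.comp (tmkHom (tensor M N) _ (tmk x f)))
    (g := t.comp (tmkHom (tensor M N) _ (tmk x f))) (fun k l y g hy hg =>
      h i j k l x f y g hx hf hy hg) b

/-- The reordering `(M ⊗ N) ⊗ (P ⊗ Q) → (M ⊗ P) ⊗ (N ⊗ Q)`, with the Koszul sign. -/
theorem exists_middleSwap :
    ∃ s : tensor (tensor M N) (tensor P Q) →+ tensor (tensor M P) (tensor N Q), IsChainMap s ∧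
      ∀ (i j : ℤ) (x : M) (f : N) (y : P) (g : Q), f ∈ N.deg i → y ∈ P.deg j →
        s (tmk (tmk x f) (tmk y g)) = sgn (i * j) • tmk (tmk x y) (tmk f g) := by
  let B : M →+ N →+ P →+ Q →+ tensor (tensor M P) (tensor N Q) :=
    biadd (fun x f => biadd (fun y g => tmk (tmk x y) (tmk f g))
      (fun y y' g => by rw [tmk_add_right, tmk_add_left])
      (fun y g g' => by rw [tmk_add_right, tmk_add_right]))
      (fun x x' f => by ext y g; exact (congrArg (fun t => tmk t (tmk f g))
        (tmk_add_left x x' y)).trans (tmk_add_left _ _ _))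
      (fun x f f' => by ext y g; exact (congrArg (tmk (tmk x y))
        (tmk_add_left f f' g)).trans (tmk_add_right _ _ _))
  -- The sign is Koszul's sign on y for a fixed degree i of f; the resulting maps are glued over the
  -- degrees of f.
  obtain ⟨e, he⟩ := exists_glue hN.internal (P := M →+ P →+ Q →+ tensor (tensor M P) (tensor N Q))
    (fun i => AddMonoidHom.mk' (fun f => (B.flip f).compl₂ (P.koszul i))
      (fun f f' => by ext x y g; simp))
  have hs : ∀ (i j : ℤ) (x : M) (f : N) (y : P) (g : Q), f ∈ N.deg i → y ∈ P.deg j →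
      onTensor₄ e.flip (tmk (tmk x f) (tmk y g)) = sgn (i * j) • tmk (tmk x y) (tmk f g) := by
    intro i j x f y g hf hy
    rw [onTensor₄_tmk, AddMonoidHom.flip_apply, he i f hf]
    change tmk (tmk x (P.koszul i y)) (tmk f g) = _
    rw [koszul_apply hP.internal i hy, tmk_zsmul_right, tmk_zsmul_left]
  refine ⟨onTensor₄ e.flip, ⟨fun n z hz => ?_, fun z => ?_⟩, hs⟩
  · refine tensor_deg_le (((tensor (tensor M P) (tensor N Q)).deg n).comap (onTensor₄ e.flip)) ?_ hz
    rintro a b c c' hc hc' rfl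
    refine tensor_deg_le (((tensor (tensor M P) (tensor N Q)).deg (a + b)).comap
      ((onTensor₄ e.flip).comp ((tmkHom _ (tensor P Q)).flip c'))) ?_ hc
    rintro i j x f hx hf rfl
    refine tensor_deg_le (((tensor (tensor M P) (tensor N Q)).deg (i + j + b)).comap
      ((onTensor₄ e.flip).comp (tmkHom (tensor M N) _ (tmk x f)))) ?_ hc'
    rintro k l y g hy hg rfl
    have h : onTensor₄ e.flip (tmk (tmk x f) (tmk y g)) ∈
        (tensor (tensor M P) (tensor N Q)).deg (i + j + (k + l)) := by
      rw [hs j k x f y g hf hy, add_add_add_comm]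
      exact zsmul_mem (tmk_deg (tmk_deg hx hy) (tmk_deg hf hg)) _
    exact h
  · refine tensor₄_hom_ext hM hN hP hQ (s := (onTensor₄ e.flip).comp
      (tensor (tensor M N) (tensor P Q)).d)
      (t := (tensor (tensor M P) (tensor N Q)).d.comp (onTensor₄ e.flip))
      (fun i j k l x f y g hx hf hy hg => ?_) z
    have hMN := (tensor_isComplex hM hN).internal
    have hMP := (tensor_isComplex hM hP).internal
    rw [AddMonoidHom.comp_apply, AddMonoidHom.comp_apply, hs j k x f y g hf hy, map_zsmul,
      tensor_d_of_deg hMN (tmk_deg hx hf), tensor_d_of_deg hM.internal hx,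
      tensor_d_of_deg hP.internal hy, tensor_d_of_deg hMP (tmk_deg hx hy),
      tensor_d_of_deg hM.internal hx, tensor_d_of_deg hN.internal hf]
    simp only [tmk_add_left, tmk_add_right, tmk_zsmul_left, tmk_zsmul_right, map_add, map_zsmul]
    rw [hs j k _ _ _ _ hf hy, hs (j - 1) k _ _ _ _ (hN.d_deg j f hf) hy,
      hs j (k - 1) _ _ _ _ hf (hP.d_deg k y hy), hs j k _ _ _ _ hf hy]
    simp only [smul_add, sgn_smul_smul]
    rw [sgn_congr (a := i + (j - 1) * k) (b := j * k + (i + k)) ⟨-k, by ring⟩,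
      sgn_congr (a := i + j + j * (k - 1)) (b := j * k + i) ⟨0, by ring⟩,
      sgn_congr (a := i + j + (k + j * k)) (b := j * k + (i + k + j)) ⟨0, by ring⟩]
    abel

end

end Homotopies

end HochschildAction
-- The homotopy module and its equivariance
namespace HochschildAction

theorem MonStr.naturality_zero {O : Type} [AddMonoid O] {D : MonDGCat.{u} O}
    {F : PreFunctor.{u, v} D.toDGCat} (hF : F.IsDGFunctor) (S : MonStr F) {a a' b b' : O}
    (x : F.obj a) {f : D.Hom a a'} (y : F.obj b) (g : D.Hom b b')
    (hf : f ∈ (D.Hom a a').deg 0) :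
    S.mul (F.act x f) (F.act y g) = F.act (S.mul x y) (D.tens f g) := by
  refine hom_ext (hF.isComplex b).internal (f := (S.mul (F.act x f)).comp (F.act.flip g))
    (g := (F.act.flip (D.tens f g)).comp (S.mul x)) (fun j y hy => ?_) y
  simpa [sgn_zero] using S.naturality 0 j x f y g hf hy

namespace Extension

variable {E : DGProp.{u}} {A : AInfMult E} {H : Variant A} {Φ : PreFunctor.{u, v} E.toDGCat}
  (X : Extension H) (hΦ : Φ.IsDGFunctor) (M : MonStr (D := E.toMonDGCat) Φ)

include hΦ

theorem gamma_isChainMap (p q : ℕ × ℕ) : IsChainMap (X.gamma M p q) :=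
  (((X.total_isDGFunctor hΦ).pairing p q).comp (X.lam_isChainMap hΦ M p)
    (IsChainMap.id _)).isChainMap (X.T_isComplex hΦ p)

/-- On the complexes Cⁿ(Φ)(m) all axioms hold strictly. Composing or multiplying operations σγ
places λσ between them, and a homotopy from λσ to the identity, composed with chain maps on both
sides, gives the required one. -/
theorem isHomotopyModule {σ : ∀ p : ℕ × ℕ, (H.pow p.2 Φ).obj p.1 →+ H.T Φ p}
    (hσ : IsHomotopyInverse H M σ) :
    IsHomotopyModule X.cat ((H.op Φ).obj 0) (Φ.obj 1) (X.gammaVia M σ) where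
  chain p q := ((((X.total_isDGFunctor hΦ).pairing p q).comp (X.lam_isChainMap hΦ M p)
    (IsChainMap.id _)).compr (hσ.chain q)).isChainMap (X.T_isComplex hΦ p)
  act_one p := by
    have h : (X.gammaVia M σ p p).flip (X.cat.one p) = (σ p).comp (H.lam M p) := by
      ext x
      exact congrArg (σ p) ((X.total_isDGFunctor hΦ).act_one (a := p) (H.lam M p x))
    exact cast (congrArg (fun t => Homotopic t (AddMonoidHom.id (H.T Φ p))) h.symm) (hσ.left p)
  act_comp p q r := by
    have hC : ((H.pow q.2 Φ).obj q.1).IsComplex := (X.pow_isDGFunctor hΦ q.2).isComplex q.1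
    have hD := X.cat.isComplex q r
    have hA : IsChainMap (onTensor (X.act Φ q r)) :=
      ((X.total_isDGFunctor hΦ).pairing q r).isChainMap hC
    -- The iterated action is γ, then λσ, then the action of g, then σ. With λσ replaced by the
    -- identity it is the action of the composite.
    have hTD := tensor_isComplex (X.T_isComplex hΦ p) (X.cat.isComplex p q)
    have h := (((Homotopic.tmap_left hC hC hD (hσ.right q)).comp_left
      ((hσ.chain r).comp hA)).comp_right
      (tmap_isChainMap hTD hC (X.gamma_isChainMap hΦ M p q) (IsChainMap.id (X.cat.Hom q r))))
    refine cast (congrArg₂ Homotopic ?_ ?_) h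
    · exact tensor₃_hom_ext fun x f g => rfl
    · refine tensor₃_hom_ext fun x f g => ?_
      exact (congrArg (σ r) ((X.total_isDGFunctor hΦ).act_comp (H.lam M p x) f g)).symm
  monoidal := by
    let mul (p q : ℕ × ℕ) : H.T Φ p →+ H.T Φ q →+ H.T Φ (p + q) :=
      (((H.mulC M p q).comp (H.lam M p)).compl₂ (H.lam M q)).compr₂ (σ (p + q))
    have hmulC : ∀ p q, IsPairing (((H.mulC M p q).comp (H.lam M p)).compl₂ (H.lam M q)) :=
      fun p q => (X.mulC_isPairing hΦ M p q).comp (X.lam_isChainMap hΦ M p)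
        (X.lam_isChainMap hΦ M q)
    refine ⟨mul, fun p q => ((hmulC p q).compr (hσ.chain _)).isChainMap (X.T_isComplex hΦ p),
      fun n => ⟨(σ (0, n + 1)).comp (H.lam M (0, n + 1)), fun x y => ?_, hσ.left _⟩,
      fun m n => ⟨(σ (m + 1, n)).comp (H.lam M (m + 1, n)), fun x y => ?_, hσ.left _⟩,
      fun p q p' q' => ?_⟩
    · refine (congrArg (σ (0, n + 1)) (X.lam_V hΦ M n x y)).trans ?_
      exact congrArg (fun t => σ (0, n + 1) (H.mulC M (0, n) (0, 1) (H.lam M (0, n) x) t))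
        (X.lam_inV hΦ M y).symm
    · exact congrArg (fun t => σ (m + 1, n) (H.mulC M (m, n) (1, 0) (H.lam M (m, n) x) t))
        (X.lam_inW hΦ M y).symm
    · have hC : ∀ q : ℕ × ℕ, ((H.pow q.2 Φ).obj q.1).IsComplex :=
        fun q => (X.pow_isDGFunctor hΦ q.2).isComplex q.1
      have hT := X.T_isComplex (Φ := Φ) hΦ
      have hD := X.cat.isComplex
      have hll : ∀ q, IsChainMap ((H.lam M q).comp (σ q)) := fun q =>
        (X.lam_isChainMap hΦ M q).comp (hσ.chain q)
      have hG := X.gamma_isChainMap hΦ M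
      obtain ⟨s, hs, hst⟩ := exists_middleSwap (hT p) (hD p q) (hT p') (hD p' q')
      -- Acting and then multiplying inserts λσ in both factors, whereas multiplying and then acting
      -- (`h₂`) inserts it once, after the product. The two strict versions agree by naturality of
      -- the products of the Cⁿ(Φ).
      have h₁ := ((Homotopic.tmap_both (hC q) (hC q) (hC q') (hC q') (hσ.right q) (hσ.right q')
        (hll q') (IsChainMap.id _)).comp_right (tmap_isChainMap
          (tensor_isComplex (hT p) (hD p q)) (hC q) (hG p q) (hG p' q'))).comp_left
        ((hσ.chain (q + q')).comp ((X.mulC_isPairing hΦ M q q').isChainMap (hC q)))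
      have hA : IsChainMap (onTensor (X.act Φ (p + p') (q + q'))) :=
        ((X.total_isDGFunctor hΦ).pairing _ _).isChainMap (hC _)
      have htens : IsChainMap (onTensor (X.cat.tens (a := p) (b := q) (c := p') (e := q'))) :=
        IsPairing.isChainMap ⟨fun i j f g => X.cat.tens_deg i j f g,
          fun i f g => X.cat.tens_d i f g⟩ (hD p q)
      have hKs := (tmap_isChainMap (tensor_isComplex (hT p) (hT p')) (hC (p + p'))
        ((hmulC p p').isChainMap (hT p)) htens).comp hs
      have h₂ := ((Homotopic.tmap_left (hC (p + p')) (hC (p + p')) (hD (p + p') (q + q'))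
        (hσ.right (p + p'))).comp_right hKs).comp_left ((hσ.chain (q + q')).comp hA)
      -- The parameter r is λσ on the homotopy side and the identity on the strict side, so the
      -- Koszul sign of the reordering is extracted once for both.
      let K (r : (H.pow (p + p').2 Φ).obj (p + p').1 →+ (H.pow (p + p').2 Φ).obj (p + p').1) :
          tensor (tensor (H.T Φ p) (H.T Φ p')) (tensor (X.cat.Hom p q) (X.cat.Hom p' q')) →+
            H.T Φ (q + q') :=
        (((σ (q + q')).comp (onTensor (X.act Φ (p + p') (q + q')))).comp
          (tmap r (AddMonoidHom.id _))).comp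
            (tmap (onTensor (((H.mulC M p p').comp (H.lam M p)).compl₂ (H.lam M p')))
              (onTensor X.cat.tens))
      have hK : ∀ (r) (i j : ℤ) (x : H.T Φ p) (f : X.cat.Hom p q) (y : H.T Φ p')
          (g : X.cat.Hom p' q'), f ∈ (X.cat.Hom p q).deg i → y ∈ (H.T Φ p').deg j →
          K r (s (tmk (tmk x f) (tmk y g))) = sgn (i * j) • K r (tmk (tmk x y) (tmk f g)) :=
        fun r i j x f y g hf hy =>
          (congrArg (K r) (hst i j x f y g hf hy)).trans (map_zsmul (K r) _ _)
      refine ⟨_, _, fun x f y g => ?_, fun i j x f y g hf hy => ?_, h₁.trans_symm h₂ fun z => ?_⟩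
      · rfl
      · exact hK _ i j x f y g hf hy
      · refine tensor₄_hom_ext (hT p) (hD p q) (hT p') (hD p' q')
          (fun i j k l x f y g hx hf hy hg => ?_) z
        have hn := (X.totalMon hΦ M).naturality j k (H.lam M p x) f (H.lam M p' y) g hf
          ((X.lam_isChainMap hΦ M p').map_deg k y hy)
        refine (congrArg (σ (q + q')) hn).trans ?_
        exact (map_zsmul (σ (q + q')) _ _).trans (hK (AddMonoidHom.id _) j k x f y g hf hy).symm

theorem mulC_middle (a b c e : ℕ × ℕ) {τ : Symmetry X.cat} (s : (X.total Φ).obj a)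
    (x : (X.total Φ).obj (b + c)) (t : (X.total Φ).obj e) :
    X.act Φ _ _ (H.mulC M (a + (b + c)) e (H.mulC M a (b + c) s x) t) (blockSwap τ a b c e) =
      H.mulC M (a + (c + b)) e (H.mulC M a (c + b) s (X.act Φ (b + c) (c + b) x (τ.braid b c))) t := by
  have hF := X.total_isDGFunctor hΦ
  have h1 := (X.totalMon hΦ M).naturality_zero hF
    ((X.totalMon hΦ M).mul s x) t (X.cat.one e)
    (X.cat.tens_deg 0 0 _ _ (X.cat.one_deg a) (τ.braid_deg b c))
  have h2 := (X.totalMon hΦ M).naturality_zero hF s x (τ.braid b c) (X.cat.one_deg a)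
  rw [← h2, hF.act_one, hF.act_one] at h1
  exact h1.symm

/-- The defining property of P concerns reordered products, and these generate. On them λ is a
product of four factors, and the symmetry of the functor on Ẽ exchanges the two in the middle. -/
theorem act_blockSwap {τ : Symmetry X.cat} (hτ : X.Compatible τ) (hS : M.Symmetric E.sym)
    (a b c e : ℕ × ℕ) {P} (hP : IsBlockSwap ((H.op Φ).obj 0) (Φ.obj 1) a b c e P)
    (z : H.T Φ (a + (b + c) + e)) :
    X.act Φ _ _ (H.lam M (a + (b + c) + e) z) (blockSwap τ a b c e) =
      H.lam M (a + (c + b) + e) (P z) := by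
  have hV : ((H.op Φ).obj 0).IsComplex := (X.pow_isDGFunctor hΦ 1).isComplex 0
  have hW := hΦ.isComplex 1
  have hT := X.T_isComplex (Φ := Φ) hΦ
  let L : H.T Φ (a + (b + c) + e) →+ (X.total Φ).obj (a + (c + b) + e) :=
    ((X.act Φ (a + (b + c) + e) (a + (c + b) + e)).flip (blockSwap τ a b c e)).comp
      (H.lam M (a + (b + c) + e))
  let R : H.T Φ (a + (b + c) + e) →+ (X.total Φ).obj (a + (c + b) + e) :=
    (H.lam M (a + (c + b) + e)).comp P
  refine shuffle_mem hV hW (AddMonoidHom.eqLocus L R) (fun u t => ?_) z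
  refine shuffle_mem hV hW ((AddMonoidHom.eqLocus L R).comap ((shuffle _ _ _ _).flip t))
    (fun s v => ?_) u
  refine shuffle_mem hV hW (((AddMonoidHom.eqLocus L R).comap ((shuffle _ _ _ _).flip t)).comap
    (shuffle _ _ _ _ s)) (fun x y => ?_) v
  change L (shuffle _ _ _ _ (shuffle _ _ _ _ s (shuffle _ _ _ _ x y)) t) =
    R (shuffle _ _ _ _ (shuffle _ _ _ _ s (shuffle _ _ _ _ x y)) t)
  let Q : H.T Φ b →+ H.T Φ c →+ H.T Φ (a + (b + c) + e) :=
    (shuffle _ _ b c).compr₂ (((shuffle _ _ (a + (b + c)) e).flip t).comp (shuffle _ _ a (b + c) s))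
  refine hom_ext (hT b).internal (f := L.comp (Q.flip y)) (g := R.comp (Q.flip y))
    (fun i x hx => ?_) x
  refine hom_ext (hT c).internal (f := L.comp (Q x)) (g := R.comp (Q x)) (fun j y hy => ?_) y
  have hl := X.lam_shuffle hΦ M hS
  have h1 : H.lam M _ (shuffle _ _ (a + (b + c)) e (shuffle _ _ a (b + c) s
      (shuffle _ _ b c x y)) t) = H.mulC M (a + (b + c)) e (H.mulC M a (b + c) (H.lam M a s)
        (H.mulC M b c (H.lam M b x) (H.lam M c y))) (H.lam M e t) :=
    (hl _ _ _ t).trans (congrArg (fun w => H.mulC M (a + (b + c)) e w (H.lam M e t))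
      ((hl a (b + c) s _).trans (congrArg (H.mulC M a (b + c) (H.lam M a s)) (hl b c x y))))
  have h2 : H.lam M _ (shuffle _ _ (a + (c + b)) e (shuffle _ _ a (c + b) s
      (shuffle _ _ c b y x)) t) = H.mulC M (a + (c + b)) e (H.mulC M a (c + b) (H.lam M a s)
        (H.mulC M c b (H.lam M c y) (H.lam M b x))) (H.lam M e t) :=
    (hl _ _ _ t).trans (congrArg (fun w => H.mulC M (a + (c + b)) e w (H.lam M e t))
      ((hl a (c + b) s _).trans (congrArg (H.mulC M a (c + b) (H.lam M a s)) (hl c b y x))))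
  have h3 := X.totalMon_symmetric hΦ M hτ hS i j (H.lam M b x) (H.lam M c y)
    ((X.lam_isChainMap hΦ M b).map_deg i x hx) ((X.lam_isChainMap hΦ M c).map_deg j y hy)
  refine (congrArg (fun w => X.act Φ _ _ w (blockSwap τ a b c e)) h1).trans ?_
  refine (X.mulC_middle hΦ M a b c e _ _ _).trans ?_
  refine Eq.trans ?_ (congrArg (H.lam M (a + (c + b) + e)) (hP i j s x y t hx hy)).symm
  refine Eq.trans ?_ (map_zsmul (H.lam M (a + (c + b) + e)) _ _).symm
  refine Eq.trans ?_ (congrArg (fun w => sgn (i * j) • w) h2).symm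
  refine (congrArg (fun w => H.mulC M (a + (c + b)) e (H.mulC M a (c + b) (H.lam M a s) w)
    (H.lam M e t)) h3).trans ?_
  exact map_zsmul (((H.mulC M (a + (c + b)) e).flip (H.lam M e t)).comp
    (H.mulC M a (c + b) (H.lam M a s))) _ _

theorem isEquivariantHomotopyModule {τ : Symmetry X.cat} (hτ : X.Compatible τ)
    (hS : M.Symmetric E.sym) {σ : ∀ p : ℕ × ℕ, (H.pow p.2 Φ).obj p.1 →+ H.T Φ p}
    (hσ : IsSymMonInverse H M σ X τ) :
    IsEquivariantHomotopyModule X.cat ((H.op Φ).obj 0) (Φ.obj 1) (X.gammaVia M σ) τ where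
  mul {p q p' q'} i j x f y g hf hy := by
    have hn := (X.totalMon hΦ M).naturality i j (H.lam M p x) f (H.lam M p' y) g hf
      ((X.lam_isChainMap hΦ M p').map_deg j y hy)
    refine (hσ.mul q q' (X.act Φ p q (H.lam M p x) f) (X.act Φ p' q' (H.lam M p' y) g)).symm.trans ?_
    refine (congrArg (σ (q + q')) hn).trans ?_
    refine (map_zsmul (σ (q + q')) _ _).trans ?_
    exact congrArg (fun w => sgn (i * j) • σ (q + q') (X.act Φ (p + p') (q + q') w
      (X.cat.tens f g))) (X.lam_shuffle hΦ M hS p p' x y).symm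
  source {q} a b c e P hP x f := by
    refine (congrArg (σ q) ((X.total_isDGFunctor hΦ).act_comp (H.lam M _ x)
      (blockSwap τ a b c e) f)).trans ?_
    exact congrArg (fun w => σ q (X.act Φ _ q w f)) (X.act_blockSwap hΦ M hτ hS a b c e hP x)
  target {p} a b c e P hP x f := by
    refine (congrArg (σ _) ((X.total_isDGFunctor hΦ).act_comp (H.lam M p x) f
      (blockSwap τ a b c e))).trans ?_
    exact hσ.swap a b c e P hP (X.act Φ p _ (H.lam M p x) f)

end Extension

end HochschildAction
-- The theorem, for both variants at once
theorem theorem5p9 (E : DGProp.{u}) (A : AInfMult E) (H : Variant A) (X : Extension H)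
    (Φ : PreFunctor.{u, v} E.toDGCat) (hΦ : Φ.IsDGFunctor)
    (M : MonStr (D := E.toMonDGCat) Φ) :
    -- the iterated Hochschild complexes are dg-functors, so that all complexes below are complexes
    (∀ n, (H.pow n Φ).IsDGFunctor) ∧ (∀ p, (H.T Φ p).IsComplex) ∧
    -- the diagram of chain maps
    (∀ p, IsChainMap (H.lam M p)) ∧ (∀ p q, IsChainMap (X.gamma M p q)) ∧
    -- it is natural in the monoidal functor
    (∀ (Φ' : PreFunctor.{u, v} E.toDGCat) (_ : Φ'.IsDGFunctor)
      (M' : MonStr (D := E.toMonDGCat) Φ') (η : ∀ a, Φ.obj a →+ Φ'.obj a), IsMonNat M M' η →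
      ∀ (p q : ℕ × ℕ) (x : H.T Φ p) (f : X.cat.Hom p q),
        H.lam M' p (vwmap (H.map η 1 0) (η 1) p.2 p.1 x) = H.map η p.2 p.1 (H.lam M p x) ∧
        X.gamma M' p q (tmk (vwmap (H.map η 1 0) (η 1) p.2 p.1 x) f) =
          H.map η q.2 q.1 (X.gamma M p q (tmk x f))) ∧
    -- the split case
    (M.Split → (∀ p, Function.Bijective (H.lam M p)) ∧
      ∀ σ : ∀ p : ℕ × ℕ, (H.pow p.2 Φ).obj p.1 →+ H.T Φ p,
        (∀ p, Function.LeftInverse (σ p) (H.lam M p) ∧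
          Function.RightInverse (σ p) (H.lam M p)) →
        IsModule X.cat ((H.op Φ).obj 0) (Φ.obj 1) (X.gammaVia M σ) ∧
        ∀ τ : Symmetry X.cat, X.Compatible τ → M.Symmetric E.sym →
          IsEquivariantModule X.cat ((H.op Φ).obj 0) (Φ.obj 1) (X.gammaVia M σ) τ) ∧
    -- the h-split case
    (M.HSplit → ∀ σ : ∀ p : ℕ × ℕ, (H.pow p.2 Φ).obj p.1 →+ H.T Φ p,
        IsHomotopyInverse H M σ →
        IsHomotopyModule X.cat ((H.op Φ).obj 0) (Φ.obj 1) (X.gammaVia M σ) ∧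
        ∀ τ : Symmetry X.cat, X.Compatible τ → M.Symmetric E.sym → IsSymMonInverse H M σ X τ →
          IsEquivariantHomotopyModule X.cat ((H.op Φ).obj 0) (Φ.obj 1) (X.gammaVia M σ) τ) := by
  have hC := X.pow_isDGFunctor hΦ
  refine ⟨hC, X.T_isComplex hΦ, X.lam_isChainMap hΦ M, X.gamma_isChainMap hΦ M,
    fun Φ' hΦ' M' η hη p q x f => ⟨X.map_lam hΦ hΦ' hη p x, ?_⟩,
    fun hM => ⟨X.lam_bijective hΦ M hM, fun σ hσ => ⟨X.isModule hΦ M hσ hM,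
      fun τ hτ hS => X.isEquivariantModule hΦ M hσ hM hτ hS⟩⟩,
    fun _ σ hσ => ⟨X.isHomotopyModule hΦ M hσ,
      fun τ hτ hS hσ' => X.isEquivariantHomotopyModule hΦ M hτ hS hσ'⟩⟩
  -- Naturality of γ is naturality of λ followed by naturality of the action of Ẽ.
  refine Eq.trans ?_ (X.map_total_act hΦ hΦ' hη.map_act _ f).symm
  exact congrArg (fun w => X.act Φ' p q w f) (X.map_lam hΦ hΦ' hη p x)
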